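/- **Setting.** Let $1\le r\le d$, $n\ge1$, let $\Theta\subseteq\mathbb R^d$ be open, and let $f(\cdot|\theta)$, $\theta\in\Theta$, be probability densities with respect to a measure on a measurable space (for instance Lebesgue measure on $\mathbb R^t$, or counting measure for mass functions), positive on a common support $\mathbb X$ that carries each of these distributions. Let $X=(X_1,\dots,X_n)$ be i.i.d. with density $f(\cdot|\theta_0)$, where $\theta_0\in\Theta_0=\{\theta\in\Theta:\theta_1=\dots=\theta_r=0\}$. Put $L(\theta;x)=\prod_{i=1}^n f(x_i|\theta)$, $\ell(\theta;x)=\log L(\theta;x)$. Assume that, almost surely, the maximum likelihood estimators $\hat\theta=\operatorname{argmax}_{\Theta}L(\cdot;X)$ and $\hat\theta^{\rm res}=\operatorname{argmax}_{\Theta_0}L(\cdot;X)$ exist and are unique, and let $$-2\log\Lambda=2\log\frac{L(\hat\theta;X)/L(\theta_0;X)}{L(\hat\theta^{\rm res};X)/L(\theta_0;X)}.$$ Write $\mathbb E_\theta$ for expectation under $f(\cdot|\theta)$, $\mathbb E=\mathbb E_{\theta_0}$, $\partial_j=\partial/\partial\theta_j$, and $I(\theta)_{jk}=\mathbb E_\theta[\partial_j\log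 f(X_1|\theta)\,\partial_k\log f(X_1|\theta)]$. Assume: * (R.C.1) different $\theta\in\Theta$ give different densities; * (R.C.2) for $x\in\mathbb X$, $\theta\mapsto\log f(x|\theta)$ is three times differentiable on $\Theta$ with continuous third partial derivatives; * (R.C.3) there are $\epsilon_0>0$ such that $\{\theta:|\theta_j-\theta_{0,j}|<\epsilon_0\ \forall j\}\subseteq\Theta$, and functions $M_{jkl}$ with $\mathbb E|M_{jkl}(X)|<\infty$, such that $|\partial_j\partial_k\partial_l\ell(\theta;x)|\le M_{jkl}(x)$ for all $x\in\mathbb X^n$, all $j,k,l$, and all $\theta$ with $|\theta_i-\theta_{0,i}|<\epsilon_0$ for every $i$; * (R.C.4) $\mathbb E_\theta[\partial_j\log f(X_1|\theta)]=0$ for all $\theta\in\Theta$ and $j$; * (R.C.5) for all $\theta\in\Theta$, $I(\theta)$ is finite and positive definite, and $I(\theta)_{jk}=-\mathbb E_\theta[\partial_j\partial_k\log f(X_1|\theta)]$; * (O1) there are functions $M^*_{jkl}$, $1\le j,k,l\le d-r$, with $|\partial_{r+j}\partial_{r+k}\partial_{r+l}\,\ell(\theta;x)|\le M^*_{jkl}(x)$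 for all $x\in\mathbb X^n$ and all $\theta$ with $\theta_1=\dots=\theta_r=0$ and $|\theta_i-\theta_{0,i}|<\epsilon_0$ for $i>r$; * (O2) for $0<\epsilon\le\epsilon_0$ and $\kappa=2,4$, $\mathbb E[M_{jkl}(X)^\kappa\mid\max_i|Q_i|<\epsilon]<\infty$ and $\mathbb E[M^*_{jkl}(X)^\kappa\mid\max_i|Q^*_i|<\epsilon]<\infty$; * (O3) the variables $\partial_j\log f(X_1|\theta_0)$ have finite absolute fifth moments. Here $Q_j=\hat\theta_j-\theta_{0,j}$ ($1\le j\le d$), $Q^*_j=\hat\theta^{\rm res}_{r+j}-\theta_{0,r+j}$ ($1\le j\le d-r$). Further put $T_{lj}=\partial_l\partial_j\ell(\theta_0;X)+nI(\theta_0)_{lj}$, $V_{jk}=\operatorname{Var}(\partial_j\partial_k\log f(X_1|\theta_0))$, and write $I(\theta_0)=\begin{pmatrix}A&B\\B^{\mathsf T}&C\end{pmatrix}$ with $A$ of size $r\times r$. Let $Y_{ji}=\partial_j\log f(X_i|\theta_0)$, $W_j=n^{-1/2}\sum_{i=1}^nY_{ji}$, let $Z$ be standard normal in $\mathbb R^d$,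 $G_s=(I(\theta_0)^{-1/2}Z)_s$, and, for an $r\times r$ matrix $U$ and an $r\times(d-r)$ matrix $D$, $c=c(U,D)=\max\{|||U|||_\infty,|||D^{\mathsf T}UD|||_\infty,|||D^{\mathsf T}U|||_\infty\}$, where $|||\cdot|||_\infty$ is the maximal absolute row sum, and $$R(W,U,D)=\min_{1\le s\le d}\frac cn\,\mathbb E|G_s|\sum_{i=1}^n\sum_{j,k,l=1}^d\Big\{\mathbb E|Y_{ji}Y_{ki}Y_{li}|+8cd\sum_{t=1}^d\Big(4\,\mathbb E|Y_{ji}Y_{ki}Y_{li}|\,\mathbb E W_t^2+\tfrac4n\mathbb E|Y_{ji}Y_{ki}Y_{li}Y_{ti}^2|+\tfrac{\mathbb E|G_sZ_t^2|}{\mathbb E|G_s|}\mathbb E|Y_{ji}Y_{ki}Y_{li}|\Big)$$ $$\qquad+2\,|\mathbb E(Y_{ji}Y_{ki})|\Big[\mathbb E|Y_{li}|+16cd\sum_{t=1}^d\Big(4\,\mathbb E|Y_{li}|\,\mathbb E W_t^2+\tfrac4n\mathbb E|Y_{li}Y_{ti}^2|+\tfrac{\mathbb E|G_sZ_t^2|}{\mathbb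 E|G_s|}\mathbb E|Y_{li}|\Big)\Big]\Big\}.$$ **Theorem.** Let $h\in C_b^2(\mathbb R)$ (that is, $h$ is $C^2$ and $h,h',h''$ are bounded), let $\|\cdot\|$ be the supremum norm, $K\sim\chi^2_r$ and $0<\epsilon\le\epsilon_0$. Then $$\big|\mathbb E h(-2\log\Lambda)-\mathbb E h(K)\big|\le\frac{2(\|h'\|+\|h''\|)}{\sqrt n}R\big(W,(A-BC^{-1}B^{\mathsf T})^{-1},BC^{-1}\big)+\frac1{\sqrt n}\Big(\|h'\|(K_1+K_1^*)+K_2+K_2^*\Big),\tag{1}$$ where, with $J=I(\theta_0)^{-1}$, $\mathcal A=\{\max_i|Q_i|<\epsilon\}$ and all sums over $\{1,\dots,d\}$, $$K_1=3n\sum_{j,k}\big[\mathbb E(Q_j^2Q_k^2)\big]^{1/2}V_{jk}^{1/2}+\sum_{l,m}|J_{lm}|\sum_{j,k}V_{lj}^{1/2}\big[\mathbb E(Q_j^6)\,\mathbb E(Q_k^6)\,\mathbb E(T_{mk}^6)\big]^{1/6},$$ $$K_2=\frac{2\sqrt n\,\|h\|}{\epsilon^2}\mathbb E\Big(\sum_jQ_j^2\Big)+\frac73\sqrt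 n\,\|h'\|\sum_{j,k,l}\big[\mathbb E(Q_j^2Q_k^2Q_l^2)\big]^{1/2}\big[\mathbb E(M_{jkl}(X)^2|\mathcal A)\big]^{1/2}$$ $$+\frac{\|h'\|}{\sqrt n}\sum_{q,k}|J_{kq}|\sum_{j,l,s}\big[\mathbb E(Q_j^2Q_l^2Q_s^2)\big]^{1/2}\big[\mathbb E(T_{kj}^4|\mathcal A)\big]^{1/4}\big[\mathbb E(M_{qsl}(X)^4|\mathcal A)\big]^{1/4}$$ $$+\frac{\|h'\|}{4\sqrt n}\sum_{b,k,s,q,l,j}|J_{qb}|\big[\mathbb E(Q_k^2Q_s^2Q_j^2Q_l^2)\big]^{1/2}\big[\mathbb E(M_{bsk}(X)^4|\mathcal A)\big]^{1/4}\big[\mathbb E(M_{qjl}(X)^4|\mathcal A)\big]^{1/4},$$ and $K_1^*,K_2^*$ are the same expressions for the model of the null hypothesis: sums over $\{1,\dots,d-r\}$, $Q^*_j$, $T^*_{lj}=T_{r+l,r+j}$, $V^*_{jk}=V_{r+j,r+k}$, $C^{-1}$, $M^*_{jkl}$ and $\{\max_i|Q_i^*|<\epsilon\}$ in place of $Q_j,T_{lj},V_{jk},J,M_{jkl},\mathcal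 A$. (Expectations of nonnegative variables take values in $[0,\infty]$, with $0\cdot\infty=0$; conditional expectations given a null event count as $0$.) **Order of the bound.** For every $\kappa$ there is a constant $c_\kappa$, depending on $\kappa$ only, such that the right-hand side of (1) is at most $$c_\kappa\,(\|h\|+\|h'\|+\|h''\|)\,\frac{d^7}{\sqrt n}$$ (in particular $O(n^{-1/2})$ for fixed $d$) whenever $\kappa\epsilon\ge1$ and the following orders hold with the constant $\kappa$, for all indices: $|J_{jk}|\le\kappa$, $\mathbb E|\partial_j\log f(X_1|\theta_0)|^5\le\kappa$, $V_{jk}\le\kappa$, $\mathbb E(Q_j^8)\le\kappa n^{-4}$, $\mathbb E(T_{jk}^6)\le\kappa n^3$, $\mathbb E(T_{jk}^4|\mathcal A)\le\kappa n^2$, $\mathbb E(M_{jkl}(X)^4|\mathcal A)\le\kappa n^4$, and likewise $V^*_{jk}\le\kappa$, $\mathbb E((Q_j^*)^8)\le\kappa n^{-4}$, $\mathbb E((T^*_{jk})^6)\le\kappa n^3$ and the last two bounds for $T^*$, $M^*$ given $\max_i|Q_i^*|<\epsilon$. -/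

import Mathlib

open MeasureTheory ProbabilityTheory
open scoped ENNReal NNReal MatrixOrder

noncomputable section

namespace Wilks

/-! ### Analytic preliminaries -/

/-- Expectation, as an element of `[0, ∞]`, of a nonnegative random variable `g`. -/
def mean {α : Type*} [MeasurableSpace α] (μ : Measure α) (g : α → ℝ) : ℝ≥0∞ :=
  ∫⁻ a, ENNReal.ofReal (g a) ∂μ

/-- The partial derivative `∂F/∂θ_i`. -/
def pd {ι : Type*} [Fintype ι] [DecidableEq ι] (i : ι) (F : (ι → ℝ) → ℝ) (θ : ι → ℝ) : ℝ :=
  fderiv ℝ F θ (Pi.single i 1)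

/-- The supremum norm of a bounded function on the real line. -/
def supNorm (g : ℝ → ℝ) : ℝ := ⨆ x, |g x|

/-- The class `C_b²(ℝ)`: twice continuously differentiable, bounded together with the first two
derivatives. -/
structure IsCb2 (h : ℝ → ℝ) : Prop where
  contDiff : ContDiff ℝ 2 h
  bdd : ∃ c, ∀ x, |h x| ≤ c
  bdd_deriv : ∃ c, ∀ x, |deriv h x| ≤ c
  bdd_deriv2 : ∃ c, ∀ x, |deriv (deriv h) x| ≤ c

/-- The standard normal distribution on `ℝ^ι`. -/
def stdNormal (ι : Type*) [Fintype ι] : Measure (ι → ℝ) :=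
  Measure.pi fun _ => gaussianReal 0 1

/-- The chi-square distribution with `r` degrees of freedom: the law of the sum of the squares of
`r` independent standard normal variables. -/
def chiSq (r : ℕ) : Measure ℝ :=
  (stdNormal (Fin r)).map fun z => ∑ i, z i ^ 2

/-- `|||A|||_∞`, the maximal absolute row sum (`0` for a matrix without rows). -/
def rowSumNorm {κ₁ κ₂ : Type*} [Fintype κ₁] [Fintype κ₂] (A : Matrix κ₁ κ₂ ℝ) : ℝ≥0 :=
  Finset.univ.sup fun i => ∑ j, ‖A i j‖₊

/-- The parameter is `θ = (θ_[1:r], θ_[r+1:d])` with `d = r + q`; its coordinates are indexed by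
`Fin r ⊕ Fin q`, the left summand standing for the first `r` coordinates. -/
abbrev Idx (r q : ℕ) := Fin r ⊕ Fin q

/-! ### The data of the testing problem -/

/-- The objects of the problem: a parametric family of densities `f(· | θ)`, `θ ∈ Θ`, with respect
to `ν`, on an arbitrary measurable space `𝒳` (Lebesgue measure on `ℝ^t` for probability density
functions, counting measure for mass functions), a true parameter, a sample of size `n` on a
probability space, the two estimators, and the dominating functions and radius that occur in the
regularity conditions. -/
structure Problem (𝒳 Ω : Type*) [MeasurableSpace 𝒳] [MeasurableSpace Ω] (r q n : ℕ) where
  /-- dominating measure -/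
  ν : Measure 𝒳
  /-- density `f x θ = f(x | θ)` -/
  f : 𝒳 → (Idx r q → ℝ) → ℝ
  /-- parameter space -/
  Θ : Set (Idx r q → ℝ)
  /-- support of one observation -/
  supp : Set 𝒳
  /-- true parameter -/
  θ₀ : Idx r q → ℝ
  /-- probability measure on the sample space -/
  P : Measure Ω
  /-- observations -/
  X : Fin n → Ω → 𝒳
  /-- unrestricted maximum likelihood estimator -/
  θhat : (Fin n → 𝒳) → (Idx r q → ℝ)
  /-- maximum likelihood estimator under the null hypothesis -/
  θres : (Fin n → 𝒳) → (Idx r q → ℝ)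
  /-- dominating functions for the third derivatives of the log-likelihood -/
  M : Idx r q → Idx r q → Idx r q → (Fin n → 𝒳) → ℝ
  /-- the same in the model of the null hypothesis -/
  Mnull : Fin q → Fin q → Fin q → (Fin n → 𝒳) → ℝ
  /-- radius on which these dominate -/
  ε₀ : ℝ

namespace Problem

variable {𝒳 Ω : Type*} [MeasurableSpace 𝒳] [MeasurableSpace Ω] {r q n : ℕ}
  (S : Problem 𝒳 Ω r q n)

/-- The law of one observation under the parameter `θ`. -/
def law (θ : Idx r q → ℝ) : Measure 𝒳 :=
  S.ν.withDensity fun x => ENNReal.ofReal (S.f x θ)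

/-- The parameter set `Θ₀` of the null hypothesis: the first `r` coordinates vanish. -/
def Θnull : Set (Idx r q → ℝ) := {θ | θ ∈ S.Θ ∧ ∀ i : Fin r, θ (Sum.inl i) = 0}

/-- The whole sample `X(ω) = (X₁(ω), …, X_n(ω))`. -/
def sample (ω : Ω) : Fin n → 𝒳 := fun i => S.X i ω

/-- Likelihood `L(θ; x) = ∏ f(x_i | θ)`. -/
def lik (θ : Idx r q → ℝ) (x : Fin n → 𝒳) : ℝ := ∏ i, S.f (x i) θ

/-- Log-likelihood `ℓ(θ; x) = ∑ log f(x_i | θ)`. -/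
def loglik (x : Fin n → 𝒳) (θ : Idx r q → ℝ) : ℝ := ∑ i, Real.log (S.f (x i) θ)

/-- Score of one observation: `∂/∂θ_j log f(x | θ)`. -/
def score (j : Idx r q) (θ : Idx r q → ℝ) (x : 𝒳) : ℝ :=
  pd j (fun θ' => Real.log (S.f x θ')) θ

/-- `∂²/∂θ_j∂θ_k log f(x | θ)`. -/
def hess (j k : Idx r q) (θ : Idx r q → ℝ) (x : 𝒳) : ℝ :=
  pd j (pd k fun θ' => Real.log (S.f x θ')) θ

/-- `∂³/∂θ_j∂θ_k∂θ_l ℓ(θ; x)`. -/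
def third (j k l : Idx r q) (θ : Idx r q → ℝ) (x : Fin n → 𝒳) : ℝ :=
  pd j (pd k (pd l (S.loglik x))) θ

/-- Expected Fisher information matrix `I(θ)` for one observation. -/
def fisher (θ : Idx r q → ℝ) : Matrix (Idx r q) (Idx r q) ℝ :=
  Matrix.of fun j k => ∫ x, S.score j θ x * S.score k θ x ∂(S.law θ)

/-- `θmax` is the unique maximiser of the likelihood of the sample `x` over `T`. -/
def IsUniqueMLE (T : Set (Idx r q → ℝ)) (x : Fin n → 𝒳) (θmax : Idx r q → ℝ) : Prop :=
  θmax ∈ T ∧ ∀ θ ∈ T, θ ≠ θmax → S.lik θ x < S.lik θmax x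

/-- `-2 log Λ = 2 log (T₁ / T₂)`, where `T₁ = L(θhat; X) / L(θ₀; X)` and
`T₂ = L(θres; X) / L(θ₀; X)`. -/
def llr (ω : Ω) : ℝ :=
  2 * Real.log
    ((S.lik (S.θhat (S.sample ω)) (S.sample ω) / S.lik S.θ₀ (S.sample ω)) /
      (S.lik (S.θres (S.sample ω)) (S.sample ω) / S.lik S.θ₀ (S.sample ω)))

/-! ### The quantities in the bound -/

/-- `Q_j = θhat(X)_j - θ_{0,j}`. -/
def Q (j : Idx r q) (ω : Ω) : ℝ := S.θhat (S.sample ω) j - S.θ₀ j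

/-- `Q*_j`, the error of the estimator in the model of the null hypothesis. -/
def Qnull (j : Fin q) (ω : Ω) : ℝ := S.θres (S.sample ω) (Sum.inr j) - S.θ₀ (Sum.inr j)

/-- `T_{lj} = ∂²/∂θ_l∂θ_j ℓ(θ₀; X) + n I(θ₀)_{lj}`. -/
def T (l j : Idx r q) (ω : Ω) : ℝ :=
  pd l (pd j (S.loglik (S.sample ω))) S.θ₀ + n * S.fisher S.θ₀ l j

/-- The block `A` of `I(θ₀) = [[A, B], [Bᵀ, C]]`. -/
def A : Matrix (Fin r) (Fin r) ℝ := (S.fisher S.θ₀).toBlocks₁₁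

/-- The block `B` of `I(θ₀)`. -/
def B : Matrix (Fin r) (Fin q) ℝ := (S.fisher S.θ₀).toBlocks₁₂

/-- The block `C` of `I(θ₀)`. -/
def C : Matrix (Fin q) (Fin q) ℝ := (S.fisher S.θ₀).toBlocks₂₂

/-- `Y_{j,i} = ∂/∂θ_j log f(X_i | θ₀)`. -/
def Y (j : Idx r q) (i : Fin n) (ω : Ω) : ℝ := S.score j S.θ₀ (S.X i ω)

/-- `W = (ξ, η)`, `W_j = n^{-1/2} ∑_i Y_{j,i}`. -/
def W (j : Idx r q) (ω : Ω) : ℝ := (Real.sqrt n)⁻¹ * ∑ i, S.Y j i ω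

/-- `(I(θ₀)^{-1/2} z)_s`, with the positive definite square root. -/
def rootInv (s : Idx r q) (z : Idx r q → ℝ) : ℝ :=
  (CFC.sqrt (S.fisher S.θ₀)⁻¹).mulVec z s

end Problem

/-- `c(U, D) = max {|||U|||_∞, |||Dᵀ U D|||_∞, |||Dᵀ U|||_∞}`. -/
def cConst {r q : ℕ} (U : Matrix (Fin r) (Fin r) ℝ) (D : Matrix (Fin r) (Fin q) ℝ) : ℝ≥0 :=
  max (rowSumNorm U) (max (rowSumNorm (D.transpose * U * D)) (rowSumNorm (D.transpose * U)))

namespace Problem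

variable {𝒳 Ω : Type*} [MeasurableSpace 𝒳] [MeasurableSpace Ω] {r q n : ℕ}
  (S : Problem 𝒳 Ω r q n)

/-- `E|(I(θ₀)^{-1/2} Z)_s|` for a standard normal vector `Z`. -/
def gaussAbs (s : Idx r q) : ℝ≥0∞ :=
  mean (stdNormal (Idx r q)) fun z => |S.rootInv s z|

/-- `E|(I(θ₀)^{-1/2} Z)_s Z_t²|` for a standard normal vector `Z`. -/
def gaussAbsSq (s t : Idx r q) : ℝ≥0∞ :=
  mean (stdNormal (Idx r q)) fun z => |S.rootInv s z * z t ^ 2|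

/-- The quantity `R(W, U, D)`; the minimum over the coordinates `s` is the infimum over a finite
index set. -/
def R (U : Matrix (Fin r) (Fin r) ℝ) (D : Matrix (Fin r) (Fin q) ℝ) : ℝ≥0∞ :=
  ⨅ s : Idx r q,
    (cConst U D : ℝ≥0∞) / (n : ℝ≥0∞) * S.gaussAbs s *
      ∑ i : Fin n, ∑ j : Idx r q, ∑ k : Idx r q, ∑ l : Idx r q,
        (mean S.P (fun ω => |S.Y j i ω * S.Y k i ω * S.Y l i ω|)
          + 8 * (cConst U D : ℝ≥0∞) * ((r + q : ℕ) : ℝ≥0∞) *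
            ∑ t : Idx r q,
              (4 * mean S.P (fun ω => |S.Y j i ω * S.Y k i ω * S.Y l i ω|)
                  * mean S.P (fun ω => S.W t ω ^ 2)
                + 4 / (n : ℝ≥0∞)
                  * mean S.P (fun ω => |S.Y j i ω * S.Y k i ω * S.Y l i ω * S.Y t i ω ^ 2|)
                + S.gaussAbsSq s t / S.gaussAbs s
                  * mean S.P (fun ω => |S.Y j i ω * S.Y k i ω * S.Y l i ω|))
          + 2 * ENNReal.ofReal |∫ ω, S.Y j i ω * S.Y k i ω ∂S.P| *
            (mean S.P (fun ω => |S.Y l i ω|)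
              + 16 * (cConst U D : ℝ≥0∞) * ((r + q : ℕ) : ℝ≥0∞) *
                ∑ t : Idx r q,
                  (4 * mean S.P (fun ω => |S.Y l i ω|) * mean S.P (fun ω => S.W t ω ^ 2)
                    + 4 / (n : ℝ≥0∞) * mean S.P (fun ω => |S.Y l i ω * S.Y t i ω ^ 2|)
                    + S.gaussAbsSq s t / S.gaussAbs s * mean S.P (fun ω => |S.Y l i ω|))))

end Problem

/-- The ingredients of `K₁` and `K₂`, for the full model or the model of the null hypothesis: the
estimation errors `Q`, the centred second derivatives `T`, the variances `V` of the second
derivatives of the log-density, the inverse information matrix `J`, and the dominating functions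
`M`, evaluated at the sample. -/
structure ErrData (ι Ω : Type*) where
  Q : ι → Ω → ℝ
  T : ι → ι → Ω → ℝ
  V : ι → ι → ℝ≥0∞
  J : Matrix ι ι ℝ
  M : ι → ι → ι → Ω → ℝ

namespace ErrData

variable {ι Ω : Type*} [Fintype ι] [MeasurableSpace Ω] (E : ErrData ι Ω) (P : Measure Ω)

/-- The event `|Q_(m)| = max_j |Q_j| < ε`. -/
def near (ε : ℝ) : Set Ω := {ω | ∀ j, |E.Q j ω| < ε}

/-- The quantity `K₁`. -/
def K1 (n : ℕ) : ℝ≥0∞ :=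
  3 * (n : ℝ≥0∞) * ∑ j, ∑ k,
      mean P (fun ω => E.Q j ω ^ 2 * E.Q k ω ^ 2) ^ (1 / 2 : ℝ) * E.V j k ^ (1 / 2 : ℝ)
    + ∑ l, ∑ m, ENNReal.ofReal |E.J l m| * ∑ j, ∑ k,
        E.V l j ^ (1 / 2 : ℝ) *
          (mean P (fun ω => E.Q j ω ^ 6) * mean P (fun ω => E.Q k ω ^ 6)
            * mean P (fun ω => E.T m k ω ^ 6)) ^ (1 / 6 : ℝ)

/-- The quantity `K₂`; conditional expectations given `|Q_(m)| < ε` are expectations with respect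
to the conditional probability measure. -/
def K2 (n : ℕ) (h : ℝ → ℝ) (ε : ℝ) : ℝ≥0∞ :=
  ENNReal.ofReal (2 * Real.sqrt n * supNorm h / ε ^ 2) * mean P (fun ω => ∑ j, E.Q j ω ^ 2)
    + ENNReal.ofReal (Real.sqrt n * supNorm (deriv h) * (7 / 3)) * ∑ j, ∑ k, ∑ l,
        mean P (fun ω => E.Q j ω ^ 2 * E.Q k ω ^ 2 * E.Q l ω ^ 2) ^ (1 / 2 : ℝ) *
          mean P[|E.near ε] (fun ω => E.M j k l ω ^ 2) ^ (1 / 2 : ℝ)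
    + ENNReal.ofReal (supNorm (deriv h) / Real.sqrt n) * ∑ q, ∑ k,
        ENNReal.ofReal |E.J k q| * ∑ j, ∑ l, ∑ s,
          mean P (fun ω => E.Q j ω ^ 2 * E.Q l ω ^ 2 * E.Q s ω ^ 2) ^ (1 / 2 : ℝ) *
            mean P[|E.near ε] (fun ω => E.T k j ω ^ 4) ^ (1 / 4 : ℝ) *
            mean P[|E.near ε] (fun ω => E.M q s l ω ^ 4) ^ (1 / 4 : ℝ)
    + ENNReal.ofReal (supNorm (deriv h) / (4 * Real.sqrt n)) *
        ∑ b, ∑ k, ∑ s, ∑ q, ∑ l, ∑ j,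
          ENNReal.ofReal |E.J q b| *
            mean P (fun ω => E.Q k ω ^ 2 * E.Q s ω ^ 2 * E.Q j ω ^ 2 * E.Q l ω ^ 2) ^ (1 / 2 : ℝ) *
            mean P[|E.near ε] (fun ω => E.M b s k ω ^ 4) ^ (1 / 4 : ℝ) *
            mean P[|E.near ε] (fun ω => E.M q j l ω ^ 4) ^ (1 / 4 : ℝ)

/-- The usual orders in the sample size, with a common constant `κ`: the estimation errors are of
order `n^{-1/2}`, the centred second derivatives `T` of order `n^{1/2}`, the dominating functions
`M` of order `n`, the variances `V` of order one. -/
structure Scaling (n : ℕ) (ε κ : ℝ) : Prop where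
  err : ∀ j, mean P (fun ω => E.Q j ω ^ 8) ≤ ENNReal.ofReal (κ / (n : ℝ) ^ 4)
  var : ∀ j k, E.V j k ≤ ENNReal.ofReal κ
  sixth : ∀ j k, mean P (fun ω => E.T j k ω ^ 6) ≤ ENNReal.ofReal (κ * (n : ℝ) ^ 3)
  condT : ∀ j k, mean P[|E.near ε] (fun ω => E.T j k ω ^ 4) ≤ ENNReal.ofReal (κ * (n : ℝ) ^ 2)
  condM : ∀ j k l,
    mean P[|E.near ε] (fun ω => E.M j k l ω ^ 4) ≤ ENNReal.ofReal (κ * (n : ℝ) ^ 4)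

end ErrData

namespace Problem

variable {𝒳 Ω : Type*} [MeasurableSpace 𝒳] [MeasurableSpace Ω] {r q n : ℕ}
  (S : Problem 𝒳 Ω r q n)

/-- The ingredients in the full model. -/
def full : ErrData (Idx r q) Ω where
  Q := S.Q
  T := S.T
  V j k := evariance (S.hess j k S.θ₀) (S.law S.θ₀)
  J := (S.fisher S.θ₀)⁻¹
  M j k l ω := S.M j k l (S.sample ω)

/-- The ingredients in the model of the null hypothesis, whose parameter is the vector of the last
`q = d - r` coordinates and whose information matrix is `C`. -/
def null : ErrData (Fin q) Ω where
  Q := S.Qnull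
  T l j := S.T (Sum.inr l) (Sum.inr j)
  V j k := evariance (S.hess (Sum.inr j) (Sum.inr k) S.θ₀) (S.law S.θ₀)
  J := S.C⁻¹
  M j k l ω := S.Mnull j k l (S.sample ω)

/-- The right-hand side of the bound on `|E h(-2 log Λ) - E h(χ²_r)|`. -/
def bound (h : ℝ → ℝ) (ε : ℝ) : ℝ≥0∞ :=
  ENNReal.ofReal (2 * (supNorm (deriv h) + supNorm (deriv (deriv h))) / Real.sqrt n) *
      S.R (S.A - S.B * S.C⁻¹ * S.B.transpose)⁻¹ (S.B * S.C⁻¹)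
    + ENNReal.ofReal (1 / Real.sqrt n) *
      (ENNReal.ofReal (supNorm (deriv h)) * (S.full.K1 S.P n + S.null.K1 S.P n)
        + S.full.K2 S.P n h ε + S.null.K2 S.P n h ε)

/-! ### The assumptions -/

/-- The standing assumptions: a family of probability densities on an open parameter set, with a
support `supp` common to all parameters (so that the log-likelihood is defined), the null hypothesis
holds for the true parameter, the observations are independent with density `f(· | θ₀)`, and almost
surely the maximum likelihood estimators, in the full model and in the model of the null hypothesis,
exist and are unique. -/
structure Standing : Prop where
  isOpen : IsOpen S.Θ
  measurable_f : ∀ θ ∈ S.Θ, Measurable fun x => S.f x θ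
  nonneg_f : ∀ θ ∈ S.Θ, ∀ x, 0 ≤ S.f x θ
  prob_law : ∀ θ ∈ S.Θ, IsProbabilityMeasure (S.law θ)
  measurable_supp : MeasurableSet S.supp
  pos_f : ∀ θ ∈ S.Θ, ∀ x ∈ S.supp, 0 < S.f x θ
  null_compl_supp : ∀ θ ∈ S.Θ, S.law θ S.suppᶜ = 0
  true_mem : S.θ₀ ∈ S.Θnull
  prob : IsProbabilityMeasure S.P
  measurable_X : ∀ i, Measurable (S.X i)
  indep : iIndepFun S.X S.P
  law_X : ∀ i, S.P.map (S.X i) = S.law S.θ₀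
  measurable_θhat : Measurable S.θhat
  measurable_θres : Measurable S.θres
  mle : ∀ᵐ ω ∂S.P, S.IsUniqueMLE S.Θ (S.sample ω) (S.θhat (S.sample ω))
  mle_null : ∀ᵐ ω ∂S.P, S.IsUniqueMLE S.Θnull (S.sample ω) (S.θres (S.sample ω))

/-- Different parameters give different densities. -/
def RC1 : Prop :=
  ∀ θ ∈ S.Θ, ∀ θ' ∈ S.Θ, θ ≠ θ' → ¬ (fun x => S.f x θ) =ᵐ[S.ν] fun x => S.f x θ'

/-- The log-likelihood is three times differentiable in the parameter, with continuous third
partial derivatives. -/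
def RC2 : Prop :=
  ∀ x ∈ S.supp, ContDiffOn ℝ 3 (fun θ => Real.log (S.f x θ)) S.Θ

/-- Near the true parameter the third derivatives of the log-likelihood are dominated by integrable
functions of the sample. The neighbourhood lies in the parameter set. -/
structure RC3 : Prop where
  pos : 0 < S.ε₀
  box : ∀ θ : Idx r q → ℝ, (∀ j, |θ j - S.θ₀ j| < S.ε₀) → θ ∈ S.Θ
  le : ∀ x : Fin n → 𝒳, (∀ i, x i ∈ S.supp) → ∀ θ : Idx r q → ℝ,
    (∀ j, |θ j - S.θ₀ j| < S.ε₀) → ∀ j k l, |S.third j k l θ x| ≤ S.M j k l x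
  integrable : ∀ j k l, Integrable (fun ω => S.M j k l (S.sample ω)) S.P

/-- The score of one observation has mean zero. -/
def RC4 : Prop :=
  ∀ θ ∈ S.Θ, ∀ j, Integrable (S.score j θ) (S.law θ) ∧ ∫ x, S.score j θ x ∂(S.law θ) = 0

/-- The Fisher information matrix is finite and positive definite, and equal to minus the
expectation of the second derivatives of the log-density. -/
structure RC5 : Prop where
  integrable : ∀ θ ∈ S.Θ, ∀ j k,
    Integrable (fun x => S.score j θ x * S.score k θ x) (S.law θ)
  integrable_hess : ∀ θ ∈ S.Θ, ∀ j k, Integrable (S.hess j k θ) (S.law θ)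
  eq_hess : ∀ θ ∈ S.Θ, ∀ j k, S.fisher θ j k = - ∫ x, S.hess j k θ x ∂(S.law θ)
  posDef : ∀ θ ∈ S.Θ, (S.fisher θ).PosDef

/-- In the model of the null hypothesis, too, the third derivatives of the log-likelihood are
dominated near the true parameter. -/
structure O1 : Prop where
  le : ∀ x : Fin n → 𝒳, (∀ i, x i ∈ S.supp) → ∀ θ : Idx r q → ℝ,
    (∀ i : Fin r, θ (Sum.inl i) = 0) →
    (∀ j : Fin q, |θ (Sum.inr j) - S.θ₀ (Sum.inr j)| < S.ε₀) →
    ∀ j k l : Fin q, |S.third (Sum.inr j) (Sum.inr k) (Sum.inr l) θ x| ≤ S.Mnull j k l x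
  measurable : ∀ j k l, AEMeasurable (fun ω => S.Mnull j k l (S.sample ω)) S.P

/-- Second and fourth conditional moments of the dominating functions are finite. -/
def O2 : Prop :=
  ∀ ε : ℝ, 0 < ε → ε ≤ S.ε₀ → ∀ κ ∈ ({2, 4} : Set ℕ),
    (∀ j k l, mean S.P[|S.full.near ε] (fun ω => S.full.M j k l ω ^ κ) < ∞) ∧
    (∀ j k l, mean S.P[|S.null.near ε] (fun ω => S.null.M j k l ω ^ κ) < ∞)

/-- The scores at the true parameter have finite absolute moments up to order five. -/
def O3 : Prop := ∀ j, MemLp (S.score j S.θ₀) 5 (S.law S.θ₀)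

/-- All the regularity conditions. -/
structure Regular : Prop where
  standing : S.Standing
  rc1 : S.RC1
  rc2 : S.RC2
  rc3 : S.RC3
  rc4 : S.RC4
  rc5 : S.RC5
  o1 : S.O1
  o2 : S.O2
  o3 : S.O3

/-- The quantities in the bound have their usual orders in the sample size, with a common constant
`κ`: besides the orders of the estimation errors and derivatives, the radius `ε` is bounded below,
and the entries of the inverse information matrix and the fifth absolute moments of the scores are
bounded. -/
structure Scaling (ε κ : ℝ) : Prop where
  radius : 1 ≤ κ * ε
  invFisher : ∀ j k, |((S.fisher S.θ₀)⁻¹ : Matrix _ _ ℝ) j k| ≤ κ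
  score : ∀ j, mean (S.law S.θ₀) (fun x => |S.score j S.θ₀ x| ^ 5) ≤ ENNReal.ofReal κ
  full : S.full.Scaling S.P n ε κ
  null : S.null.Scaling S.P n ε κ

end Problem

end Wilks

end

set_option linter.unusedSectionVars false

namespace Wilks

/-! ### Gaussian measures -/

section Gaussian

open scoped RealInnerProductSpace

/-! The statistic is the difference of two likelihood ratios, `2 (ℓ(θhat) - ℓ(θ₀))` and `2 (ℓ(θres)
- ℓ(θ₀))`. The proof replaces each by a quadratic form in the normalised score `W`, then compares
the difference of the two forms with chi-square.

Quadratic approximation. On the event that the estimator lies within `ε` of the truth, Taylor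
expansion of `ℓ` together with the likelihood equation at the maximiser gives `2 (ℓ(θhat) - ℓ(θ₀)) =
Wᵀ J W + error`. Every term of the error is a product of estimation errors `Q`, centred second
derivatives `T` and dominating functions `M` (`abs_likelihood_ratio_sub_le`). Since `h` is Lipschitz
with constant `‖h'‖`, Hölder's inequality turns these terms into `K₁` and `K₂`. Off the event, `|h x
- h y| ≤ 2 ‖h‖` and Markov's inequality give the first term of `K₂`
(`lintegral_abs_le_of_errBound`). The same argument, restricted to the last `d - r` coordinates,
handles the null model.

Chi-square approximation. By the block inversion formula, `Wᵀ I⁻¹ W - W₂ᵀ C⁻¹ W₂ = ‖L W‖²` for an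
`r`-row matrix `L` with `L I Lᵀ = 1` (`exists_whitening`). Thus `L W` is a sum of `n` i.i.d. centred
vectors in `ℝ^r` with covariance `1/n` times the identity, and `h(‖L W‖²)` must be compared with
`h(‖Z‖²)`, `Z` standard normal. The summands are exchanged for Gaussian ones one at a time. The
usual Lindeberg step needs three derivatives and `h` has two; the missing one comes from the
Gaussian summands already inserted. By the Cameron-Martin formula a shift `v` of a Gaussian of
standard deviation `σ` costs a factor `‖v‖/σ`, so the second-order remainder averages to order
`‖v‖³/σ` (`DerivBounds.abs_integral_quadRem_le`). With `m` Gaussian summands present, `σ = √(m/n)`,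
and `∑ m^{-1/2}` is of order `√n`. This gives a bound `13 (1 + √3) r (‖h'‖ + ‖h''‖) n E‖v‖³`
(`DerivBounds.abs_integral_convPow_sub_le`).

Comparison with `R`. This bound is at most the `R` term of the theorem: a single summand of `R`, the
one containing `E W_t²`, already dominates it (`Regular.le_R`). The ingredients are `r = tr(LᵀL I)`,
`J_ss I_ss ≥ 1` and `E|G_s| ≥ √(J_ss/3)`.

Order of the bound. Under the scaling hypotheses each term of `K₁`, `K₂` and `R` is estimated
separately. Powers of `√n` cancel or come out negative, and the largest power of the dimension,
`d⁷`, comes from `R`. -/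

theorem integrable_pow_gaussianReal (v : ℝ≥0) (k : ℕ) :
    Integrable (fun x : ℝ => x ^ k) (gaussianReal 0 v) := by
  have h := (memLp_id_gaussianReal (μ := 0) (v := v) k).integrable_norm_pow'
  refine (integrable_norm_iff (by fun_prop)).1 ?_
  simpa using h

theorem integral_sq_gaussianReal (v : ℝ≥0) : ∫ x, x ^ 2 ∂gaussianReal 0 v = v := by
  have h := variance_id_gaussianReal (μ := 0) (v := v)
  rw [variance_of_integral_eq_zero (by fun_prop) (by simp)] at h
  simpa using h

/-- The sum of two independent copies is distributed as `√2` times one copy. Its fourth moment is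
therefore `4 m₄` by scaling and `2 m₄ + 6` by expanding `(x + y)⁴`, which forces `m₄ = 3`. -/
theorem integral_pow_four_gaussianReal_one : ∫ x, x ^ 4 ∂gaussianReal 0 1 = 3 := by
  have hi := fun k => integrable_pow_gaussianReal 1 k
  have hmap : (gaussianReal 0 1 ∗ gaussianReal 0 1) = (gaussianReal 0 1).map (√2 * ·) := by
    rw [gaussianReal_conv_gaussianReal, gaussianReal_map_const_mul]
    congr 1
    · simp
    · ext; norm_num
  have h1 : ∫ x, x ^ 4 ∂(gaussianReal 0 1 ∗ gaussianReal 0 1)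
      = 4 * ∫ x, x ^ 4 ∂gaussianReal 0 1 := by
    rw [hmap, integral_map (by fun_prop) (by fun_prop), ← integral_const_mul]
    refine integral_congr_ae (ae_of_all _ fun x => ?_)
    have : √2 ^ 4 = 4 := by
      rw [show √2 ^ 4 = (√2 ^ 2) ^ 2 by ring, Real.sq_sqrt (by norm_num)]; norm_num
    simp only [mul_pow, this]
  have hI : Integrable (fun x : ℝ => x ^ 4) (gaussianReal 0 1 ∗ gaussianReal 0 1) := by
    rw [hmap, integrable_map_measure (by fun_prop) (by fun_prop)]
    simpa [Function.comp_def, mul_pow] using (hi 4).const_mul _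
  have h0 : ∫ y, y ∂gaussianReal 0 1 = 0 := integral_id_gaussianReal
  have h3 : ∀ x : ℝ, ∫ y, (x + y) ^ 4 ∂gaussianReal 0 1
      = x ^ 4 + 6 * x ^ 2 + 4 * (∫ y, y ^ 3 ∂gaussianReal 0 1) * x
        + ∫ y, y ^ 4 ∂gaussianReal 0 1 := by
    intro x
    have : (fun y : ℝ => (x + y) ^ 4) = fun y => x ^ 4 + 4 * x ^ 3 * y + 6 * x ^ 2 * y ^ 2
        + 4 * x * y ^ 3 + y ^ 4 := by ext; ring
    have i1 : Integrable (fun y : ℝ => y) (gaussianReal 0 1) := by simpa using hi 1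
    have e1 : ∫ y : ℝ, 4 * x ^ 3 * y ∂gaussianReal 0 1 = 0 := by
      rw [integral_const_mul, h0, mul_zero]
    rw [this, integral_add, integral_add, integral_add, integral_add, e1]
    · simp only [integral_const_mul, integral_const, integral_sq_gaussianReal]
      simp; ring
    · fun_prop
    · exact i1.const_mul _
    · exact (integrable_const _).add (i1.const_mul _)
    · exact (hi 2).const_mul _
    · exact ((integrable_const _).add (i1.const_mul _)).add ((hi 2).const_mul _)
    · exact (hi 3).const_mul _
    · exact (((integrable_const _).add (i1.const_mul _)).add ((hi 2).const_mul _)).add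
        ((hi 3).const_mul _)
    · exact hi 4
  have h2 : ∫ x, x ^ 4 ∂(gaussianReal 0 1 ∗ gaussianReal 0 1)
      = 2 * (∫ x, x ^ 4 ∂gaussianReal 0 1) + 6 := by
    rw [integral_conv hI]
    simp_rw [h3]
    have i1 : Integrable (fun y : ℝ => y) (gaussianReal 0 1) := by simpa using hi 1
    have e1 : ∀ c : ℝ, ∫ y : ℝ, c * y ∂gaussianReal 0 1 = 0 := fun c => by
      rw [integral_const_mul, h0, mul_zero]
    rw [integral_add, integral_add, integral_add, e1]
    · simp only [integral_const_mul, integral_const, integral_sq_gaussianReal]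
      simp; ring
    · exact hi 4
    · exact (hi 2).const_mul _
    · exact (hi 4).add ((hi 2).const_mul _)
    · exact i1.const_mul _
    · exact ((hi 4).add ((hi 2).const_mul _)).add (i1.const_mul _)
    · fun_prop
  linarith

theorem integral_pow_four_gaussianReal (v : ℝ≥0) : ∫ x, x ^ 4 ∂gaussianReal 0 v = 3 * v ^ 2 := by
  have hmap : gaussianReal 0 v = (gaussianReal 0 1).map (√(v : ℝ) * ·) := by
    rw [gaussianReal_map_const_mul]
    congr 1
    · simp
    · ext; simp
  rw [hmap, integral_map (by fun_prop) (by fun_prop)]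
  simp_rw [mul_pow]
  rw [integral_const_mul, integral_pow_four_gaussianReal_one,
    show √(v : ℝ) ^ 4 = (√(v : ℝ) ^ 2) ^ 2 by ring, Real.sq_sqrt (by positivity)]
  ring

theorem gaussianReal_map_add_const_eq_withDensity (u : ℝ) :
    (gaussianReal 0 1).map (· + u) =
      (gaussianReal 0 1).withDensity fun x => ENNReal.ofReal (Real.exp (u * x - u ^ 2 / 2)) := by
  rw [gaussianReal_map_add_const, gaussianReal_of_var_ne_zero _ (by simp),
    gaussianReal_of_var_ne_zero _ (by simp), ← withDensity_mul _ (by fun_prop) (by fun_prop)]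
  congr 1
  ext x
  rw [Pi.mul_apply, gaussianPDF, gaussianPDF, ← ENNReal.ofReal_mul (gaussianPDFReal_nonneg _ _ _)]
  congr 1
  simp only [gaussianPDFReal]
  rw [mul_assoc _ (Real.exp _) (Real.exp _), ← Real.exp_add]
  congr 2
  push_cast
  ring

theorem lintegral_pi_prod {ι : Type*} [Fintype ι] (μ : ι → Measure ℝ)
    [∀ i, IsProbabilityMeasure (μ i)] (f : ι → ℝ → ℝ≥0∞) (hf : ∀ i, Measurable (f i)) :
    ∫⁻ x, ∏ i, f i (x i) ∂Measure.pi μ = ∏ i, ∫⁻ x, f i x ∂μ i := by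
  have h := lintegral_prod_eq_prod_lintegral_of_indepFun (μ := Measure.pi μ) Finset.univ
    (fun i (x : ι → ℝ) => f i (x i)) (iIndepFun_pi fun i => (hf i).aemeasurable)
    (fun i => (hf i).comp (measurable_pi_apply i))
  rw [h]
  exact Finset.prod_congr rfl fun i _ => (measurePreserving_eval μ i).lintegral_comp (hf i)

theorem pi_withDensity_prod {ι : Type*} [Fintype ι] (μ : ι → Measure ℝ)
    [∀ i, IsProbabilityMeasure (μ i)] (f : ι → ℝ → ℝ≥0∞) (hf : ∀ i, Measurable (f i))
    [∀ i, SigmaFinite ((μ i).withDensity (f i))] :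
    Measure.pi (fun i => (μ i).withDensity (f i)) =
      (Measure.pi μ).withDensity fun x => ∏ i, f i (x i) := by
  refine Measure.pi_eq fun s hs => ?_
  rw [withDensity_apply _ (MeasurableSet.univ_pi hs),
    ← lintegral_indicator (MeasurableSet.univ_pi hs)]
  have h : (Set.univ.pi s).indicator (fun x : ι → ℝ => ∏ i, f i (x i))
      = fun x => ∏ i, (s i).indicator (f i) (x i) := by
    ext x
    by_cases hx : x ∈ Set.univ.pi s
    · rw [Set.indicator_of_mem hx]
      exact Finset.prod_congr rfl fun i _ => (Set.indicator_of_mem (hx i trivial) _).symm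
    · rw [Set.indicator_of_notMem hx]
      obtain ⟨i, hi⟩ : ∃ i, x i ∉ s i := by simpa using hx
      exact (Finset.prod_eq_zero (Finset.mem_univ i) (Set.indicator_of_notMem hi _)).symm
  rw [h, lintegral_pi_prod _ _ fun i => (hf i).indicator (hs i)]
  refine Finset.prod_congr rfl fun i _ => ?_
  rw [withDensity_apply _ (hs i), lintegral_indicator (hs i)]

theorem pi_gaussianReal_map_add {ι : Type*} [Fintype ι] (u : ι → ℝ) :
    (Measure.pi fun _ : ι => gaussianReal 0 1).map (· + u) =
      (Measure.pi fun _ : ι => gaussianReal 0 1).withDensity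
        fun x => ENNReal.ofReal (Real.exp (∑ i, u i * x i - (∑ i, u i ^ 2) / 2)) := by
  have hP : ∀ i, IsProbabilityMeasure ((gaussianReal 0 1).map (· + u i)) := fun i =>
    Measure.isProbabilityMeasure_map (by fun_prop)
  have hP' : ∀ i, IsProbabilityMeasure ((gaussianReal 0 1).withDensity
      fun x => ENNReal.ofReal (Real.exp (u i * x - u i ^ 2 / 2))) := fun i => by
    rw [← gaussianReal_map_add_const_eq_withDensity]; exact hP i
  have h := Measure.pi_map_pi (μ := fun _ : ι => gaussianReal 0 1) (f := fun i x => x + u i)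
    (fun i => by fun_prop)
  rw [show (fun x : ι → ℝ => x + u) = fun x i => x i + u i from rfl, h]
  simp_rw [gaussianReal_map_add_const_eq_withDensity]
  rw [pi_withDensity_prod _ _ fun i => by fun_prop]
  congr 1
  ext x
  rw [← ENNReal.ofReal_prod_of_nonneg fun i _ => (Real.exp_pos _).le, ← Real.exp_sum,
    Finset.sum_sub_distrib, Finset.sum_div]

variable {E : Type*} [NormedAddCommGroup E] [InnerProductSpace ℝ E] [FiniteDimensional ℝ E]
  [MeasurableSpace E] [BorelSpace E]

/-- The Cameron-Martin formula for the standard Gaussian measure. -/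
theorem stdGaussian_map_add (u : E) :
    (stdGaussian E).map (· + u) =
      (stdGaussian E).withDensity fun z => ENNReal.ofReal (Real.exp (⟪u, z⟫ - ‖u‖ ^ 2 / 2)) := by
  set b := stdOrthonormalBasis ℝ E
  set T : (Fin (Module.finrank ℝ E) → ℝ) → E := fun x => ∑ i, x i • b i with hT
  have hTm : Measurable T := by fun_prop
  have hu : T (fun i => ⟪b i, u⟫) = u := b.sum_repr' u
  have hγ : stdGaussian E = (Measure.pi fun _ => gaussianReal 0 1).map T := rfl
  ext s hs
  rw [withDensity_apply _ hs, hγ, Measure.map_map (by fun_prop) hTm,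
    setLIntegral_map hs (by fun_prop) hTm]
  have h1 : (fun x => x + u) ∘ T = T ∘ (· + fun i => ⟪b i, u⟫) := by
    ext x
    conv_lhs => rw [Function.comp_apply, ← hu]
    simp [hT, add_smul, Finset.sum_add_distrib]
  rw [h1, ← Measure.map_map hTm (by fun_prop), pi_gaussianReal_map_add, Measure.map_apply hTm hs,
    withDensity_apply _ (hTm hs)]
  refine setLIntegral_congr_fun (hTm hs) fun x _ => ?_
  congr 3
  · simp only [hT, inner_sum, inner_smul_right]
    exact Finset.sum_congr rfl fun i _ => by rw [real_inner_comm, mul_comm]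
  · rw [← b.sum_sq_inner_right u]

theorem integral_add_stdGaussian {F : E → ℝ} (hF : Measurable F) (u : E) :
    ∫ z, F (z + u) ∂stdGaussian E
      = ∫ z, Real.exp (⟪u, z⟫ - ‖u‖ ^ 2 / 2) * F z ∂stdGaussian E := by
  have h := integral_map (μ := stdGaussian E) (φ := (· + u)) (f := F) (by fun_prop)
    hF.aestronglyMeasurable
  rw [← h, stdGaussian_map_add, integral_withDensity_eq_integral_toReal_smul (by fun_prop)
    (ae_of_all _ fun _ => ENNReal.ofReal_lt_top)]
  simp [ENNReal.toReal_ofReal (Real.exp_pos _).le]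

theorem stdGaussian_map_inner (a : E) :
    (stdGaussian E).map (fun z => ⟪a, z⟫) = gaussianReal 0 (‖a‖₊ ^ 2) := by
  have h := IsGaussian.map_eq_gaussianReal (μ := stdGaussian E) (innerSL ℝ a)
  rw [integral_strongDual_stdGaussian, variance_dual_stdGaussian] at h
  rw [show (fun z => ⟪a, z⟫) = ⇑(innerSL ℝ a) from rfl, h]
  congr 1
  ext
  simp

theorem integrable_norm_pow_stdGaussian (k : ℕ) :
    Integrable (fun z : E => ‖z‖ ^ k) (stdGaussian E) := by
  simpa using (IsGaussian.memLp_id (stdGaussian E) k (by simp)).integrable_norm_pow'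

theorem integral_inner_stdGaussian (a : E) : ∫ z, ⟪a, z⟫ ∂stdGaussian E = 0 :=
  integral_strongDual_stdGaussian (innerSL ℝ a)

theorem integral_inner_sq_stdGaussian (a : E) : ∫ z, ⟪a, z⟫ ^ 2 ∂stdGaussian E = ‖a‖ ^ 2 := by
  have h := integral_map (μ := stdGaussian E) (φ := fun z => ⟪a, z⟫) (f := fun x : ℝ => x ^ 2)
    (by fun_prop) (by fun_prop)
  rw [← h, stdGaussian_map_inner, integral_sq_gaussianReal]
  simp

theorem integral_inner_pow_four_stdGaussian (a : E) :
    ∫ z, ⟪a, z⟫ ^ 4 ∂stdGaussian E = 3 * ‖a‖ ^ 4 := by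
  have h := integral_map (μ := stdGaussian E) (φ := fun z => ⟪a, z⟫) (f := fun x : ℝ => x ^ 4)
    (by fun_prop) (by fun_prop)
  rw [← h, stdGaussian_map_inner, integral_pow_four_gaussianReal]
  push_cast
  ring

theorem integral_exp_inner_stdGaussian (a : E) :
    ∫ z, Real.exp ⟪a, z⟫ ∂stdGaussian E = Real.exp (‖a‖ ^ 2 / 2) := by
  have h := mgf_gaussianReal (stdGaussian_map_inner a) 1
  simpa [mgf] using h

/-- A non-integrable function has Bochner integral `0`, whereas the value computed above is
positive. -/
theorem integrable_exp_inner_stdGaussian (a : E) :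
    Integrable (fun z => Real.exp ⟪a, z⟫) (stdGaussian E) := by
  by_contra h
  have h1 := integral_exp_inner_stdGaussian a
  rw [integral_undef h] at h1
  exact (Real.exp_pos _).ne h1

/-- The squared `L²` distance from `1` of the Cameron-Martin density. It is of order `‖u‖²` for
small `u`, which makes Gaussian averages Lipschitz under shifts. -/
theorem integral_exp_sub_one_sq_stdGaussian (u : E) :
    Integrable (fun z => (Real.exp (⟪u, z⟫ - ‖u‖ ^ 2 / 2) - 1) ^ 2) (stdGaussian E) ∧
    ∫ z, (Real.exp (⟪u, z⟫ - ‖u‖ ^ 2 / 2) - 1) ^ 2 ∂stdGaussian E = Real.exp (‖u‖ ^ 2) - 1 := by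
  have e : (fun z => (Real.exp (⟪u, z⟫ - ‖u‖ ^ 2 / 2) - 1) ^ 2) = fun z =>
      Real.exp (-‖u‖ ^ 2) * Real.exp ⟪(2 : ℝ) • u, z⟫
        - 2 * Real.exp (-‖u‖ ^ 2 / 2) * Real.exp ⟪u, z⟫ + 1 := by
    ext z
    rw [inner_smul_left, ← Real.exp_add, mul_assoc, ← Real.exp_add, sub_sq, ← Real.exp_nat_mul]
    simp only [conj_trivial]
    congr 1
    · congr 1
      · congr 1; push_cast; ring
      · rw [mul_one]; congr 2; ring
    · norm_num
  have i2 := integrable_exp_inner_stdGaussian ((2 : ℝ) • u)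
  have i1 := integrable_exp_inner_stdGaussian u
  rw [e]
  refine ⟨((i2.const_mul _).sub (i1.const_mul _)).add (integrable_const _), ?_⟩
  rw [integral_add (by exact (i2.const_mul _).sub (i1.const_mul _)) (integrable_const _),
    integral_sub (i2.const_mul _) (i1.const_mul _), integral_const_mul, integral_const_mul,
    integral_exp_inner_stdGaussian, integral_exp_inner_stdGaussian, ← Real.exp_add, mul_assoc,
    ← Real.exp_add, norm_smul]
  have h1 : -‖u‖ ^ 2 + (‖(2 : ℝ)‖ * ‖u‖) ^ 2 / 2 = ‖u‖ ^ 2 := by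
    rw [Real.norm_ofNat]; ring
  have h2 : -‖u‖ ^ 2 / 2 + ‖u‖ ^ 2 / 2 = 0 := by ring
  rw [h1, h2]
  simp
  ring

theorem integrable_inner_pow {μ : Measure E} {k : ℕ} (h : Integrable (fun z : E => ‖z‖ ^ k) μ)
    (a : E) : Integrable (fun z => ⟪a, z⟫ ^ k) μ := by
  refine (h.const_mul (‖a‖ ^ k)).mono' (by fun_prop) (ae_of_all _ fun z => ?_)
  rw [norm_pow, ← mul_pow]
  exact pow_le_pow_left₀ (norm_nonneg _) (norm_inner_le_norm a z) k

theorem integral_norm_sq_of_isotropic {μ : Measure E} {s : ℝ}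
    (hi : Integrable (fun z : E => ‖z‖ ^ 2) μ) (h : ∀ a, ∫ z, ⟪a, z⟫ ^ 2 ∂μ = s * ‖a‖ ^ 2) :
    ∫ z, ‖z‖ ^ 2 ∂μ = s * Module.finrank ℝ E := by
  set b := stdOrthonormalBasis ℝ E
  have e : (fun z : E => ‖z‖ ^ 2) = fun z => ∑ i, ⟪b i, z⟫ ^ 2 := by
    ext z; rw [b.sum_sq_inner_right]
  rw [e, integral_finsetSum _ fun i _ => integrable_inner_pow hi _]
  simp [h, mul_comm]

theorem integral_norm_sq_stdGaussian :
    ∫ z : E, ‖z‖ ^ 2 ∂stdGaussian E = Module.finrank ℝ E := by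
  rw [integral_norm_sq_of_isotropic (s := 1) (integrable_norm_pow_stdGaussian 2)
    (by simp [integral_inner_sq_stdGaussian]), one_mul]

/-- Cauchy-Schwarz over an orthonormal basis reduces to one-dimensional fourth moments; the lost
factor is harmless. -/
theorem integral_norm_pow_four_stdGaussian_le :
    ∫ z : E, ‖z‖ ^ 4 ∂stdGaussian E ≤ 3 * (Module.finrank ℝ E : ℝ) ^ 2 := by
  set b := stdOrthonormalBasis ℝ E
  have i4 := fun i => integrable_inner_pow (integrable_norm_pow_stdGaussian (E := E) 4) (b i)
  have e : ∀ z : E, ‖z‖ ^ 4 ≤ Module.finrank ℝ E * ∑ i, ⟪b i, z⟫ ^ 4 := by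
    intro z
    have h := sq_sum_le_card_mul_sum_sq (s := Finset.univ) (f := fun i => ⟪b i, z⟫ ^ 2)
    rw [b.sum_sq_inner_right] at h
    simpa [← pow_mul] using h
  refine (integral_mono (integrable_norm_pow_stdGaussian 4)
    ((integrable_finsetSum _ fun i _ => i4 i).const_mul _) e).trans_eq ?_
  rw [integral_const_mul, integral_finsetSum _ fun i _ => i4 i]
  simp [integral_inner_pow_four_stdGaussian]
  ring

theorem integral_norm_pow_three_stdGaussian_le :
    ∫ z : E, ‖z‖ ^ 3 ∂stdGaussian E
      ≤ √3 * (√(Module.finrank ℝ E) * Module.finrank ℝ E) := by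
  set r : ℝ := (Module.finrank ℝ E : ℝ) with hr
  rcases (Nat.cast_nonneg (Module.finrank ℝ E) : (0 : ℝ) ≤ r).eq_or_lt with h0 | h0
  · have : Subsingleton E := Module.finrank_zero_iff.1 (by exact_mod_cast (hr.symm.trans h0.symm))
    have : (fun z : E => ‖z‖ ^ 3) = fun _ => 0 := by
      ext z; simp [Subsingleton.elim z 0]
    rw [this, show r = 0 from h0.symm]; simp
  -- The third moment is interpolated between the second and fourth by `t³ ≤ (s/2) t² + t⁴/(2s)`.
  -- The choice `s² = 3r` balances the two moment bounds `r` and `3r²`.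
  set s := √3 * √r with hs
  have hs0 : 0 < s := by positivity
  have hss : s ^ 2 = 3 * r := by
    rw [hs, mul_pow, Real.sq_sqrt (by norm_num), Real.sq_sqrt h0.le]
  have e : ∀ z : E, ‖z‖ ^ 3 ≤ s / 2 * ‖z‖ ^ 2 + 1 / (2 * s) * ‖z‖ ^ 4 := by
    intro z
    have : s / 2 * ‖z‖ ^ 2 + 1 / (2 * s) * ‖z‖ ^ 4 - ‖z‖ ^ 3
        = ‖z‖ ^ 2 * (s - ‖z‖) ^ 2 / (2 * s) := by field_simp; ring
    have h2 : 0 ≤ ‖z‖ ^ 2 * (s - ‖z‖) ^ 2 / (2 * s) := by positivity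
    linarith
  have i2 := integrable_norm_pow_stdGaussian (E := E) 2
  have i4 := integrable_norm_pow_stdGaussian (E := E) 4
  refine (integral_mono (integrable_norm_pow_stdGaussian 3)
    ((i2.const_mul _).add (i4.const_mul _)) e).trans ?_
  rw [integral_add' (i2.const_mul _) (i4.const_mul _), integral_const_mul, integral_const_mul,
    integral_norm_sq_stdGaussian, ← hr]
  have h4 := integral_norm_pow_four_stdGaussian_le (E := E)
  calc s / 2 * r + 1 / (2 * s) * ∫ z : E, ‖z‖ ^ 4 ∂stdGaussian E
      ≤ s / 2 * r + 1 / (2 * s) * (3 * r ^ 2) := by gcongr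
    _ = s * r := by
        have : 3 * r ^ 2 = s ^ 2 * r := by rw [hss]; ring
        rw [this]; field_simp; ring
    _ = _ := by rw [hs]; ring

/-- The centred Gaussian measure with covariance `s ^ 2` times the identity. -/
noncomputable def scaledGaussian (E : Type*) [NormedAddCommGroup E] [InnerProductSpace ℝ E]
    [FiniteDimensional ℝ E] [MeasurableSpace E] (s : ℝ) : Measure E :=
  (stdGaussian E).map (s • ·)

instance (s : ℝ) : IsProbabilityMeasure (scaledGaussian E s) :=
  Measure.isProbabilityMeasure_map (by fun_prop)

theorem integral_scaledGaussian {F : E → ℝ} (hF : Measurable F) (s : ℝ) :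
    ∫ z, F z ∂scaledGaussian E s = ∫ z, F (s • z) ∂stdGaussian E :=
  integral_map (by fun_prop) hF.aestronglyMeasurable

theorem integrable_norm_pow_scaledGaussian (s : ℝ) (k : ℕ) :
    Integrable (fun z : E => ‖z‖ ^ k) (scaledGaussian E s) := by
  rw [scaledGaussian, integrable_map_measure (by fun_prop) (by fun_prop)]
  simpa [Function.comp_def, norm_smul, mul_pow] using
    (integrable_norm_pow_stdGaussian (E := E) k).const_mul (|s| ^ k)

theorem scaledGaussian_conv {s t u : ℝ} (h : s ^ 2 + t ^ 2 = u ^ 2) :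
    scaledGaussian E s ∗ scaledGaussian E t = scaledGaussian E u := by
  refine Measure.ext_of_charFun ?_
  ext x
  have hc : ∀ s : ℝ, charFun (scaledGaussian E s) x = Complex.exp (-(s ^ 2 * ‖x‖ ^ 2 / 2)) := by
    intro s
    rw [scaledGaussian, charFun_map_smul, charFun_stdGaussian, norm_smul]
    congr 1
    push_cast
    rw [mul_pow, ← Complex.ofReal_pow ‖s‖, Real.norm_eq_abs, sq_abs]
    push_cast
    ring
  rw [charFun_conv, hc, hc, hc, ← Complex.exp_add]
  congr 1
  have : (u : ℂ) ^ 2 = s ^ 2 + t ^ 2 := by exact_mod_cast h.symm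
  rw [this]; ring

theorem scaledGaussian_zero : scaledGaussian E 0 = Measure.dirac 0 := by
  rw [scaledGaussian]
  simp

theorem scaledGaussian_one (E : Type*) [NormedAddCommGroup E] [InnerProductSpace ℝ E]
    [FiniteDimensional ℝ E] [MeasurableSpace E] :
    scaledGaussian E 1 = stdGaussian E := by
  rw [scaledGaussian]
  simp

end Gaussian

/-! ### Second order expansion of smooth functions of the squared norm -/

section Expansion

open scoped RealInnerProductSpace
open intervalIntegral

/-- The function `φ t + (1 - t) φ' t` is a primitive of `(1 - t) φ'' t`. -/
theorem sub_sub_eq_integral_of_hasDerivAt {φ φ' φ'' : ℝ → ℝ} (h1 : ∀ t, HasDerivAt φ (φ' t) t)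
    (h2 : ∀ t, HasDerivAt φ' (φ'' t) t) (hc : Continuous φ'') :
    φ 1 - φ 0 - φ' 0 = ∫ t in (0 : ℝ)..1, (1 - t) * φ'' t := by
  have h : ∀ t ∈ Set.uIcc (0 : ℝ) 1,
      HasDerivAt (fun t => φ t + (1 - t) * φ' t) ((1 - t) * φ'' t) t := by
    intro t _
    have := (h1 t).add (((hasDerivAt_id t).const_sub 1).mul (h2 t))
    refine this.congr_deriv ?_
    simp only [id]
    ring
  rw [integral_eq_sub_of_hasDerivAt h (Continuous.intervalIntegrable (by fun_prop) _ _)]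
  ring

/-- The first derivatives of `h` are bounded by `a`, the second by `b`. -/
structure DerivBounds (h : ℝ → ℝ) (a b : ℝ) : Prop where
  contDiff : ContDiff ℝ 2 h
  fst : ∀ x, |deriv h x| ≤ a
  snd : ∀ x, |deriv (deriv h) x| ≤ b

namespace DerivBounds

variable {h : ℝ → ℝ} {a b : ℝ}

theorem nonneg_fst (H : DerivBounds h a b) : 0 ≤ a := (abs_nonneg _).trans (H.fst 0)

theorem nonneg_snd (H : DerivBounds h a b) : 0 ≤ b := (abs_nonneg _).trans (H.snd 0)

theorem hasDerivAt (H : DerivBounds h a b) (x : ℝ) : HasDerivAt h (deriv h x) x :=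
  (H.contDiff.differentiable (by norm_num) x).hasDerivAt

theorem contDiff_deriv (H : DerivBounds h a b) : ContDiff ℝ 1 (deriv h) := by
  have := H.contDiff
  rw [show (2 : WithTop ℕ∞) = 1 + 1 by norm_num, contDiff_succ_iff_deriv] at this
  exact this.2.2

theorem hasDerivAt_deriv (H : DerivBounds h a b) (x : ℝ) :
    HasDerivAt (deriv h) (deriv (deriv h) x) x :=
  (H.contDiff_deriv.differentiable (by norm_num) x).hasDerivAt

theorem continuous (H : DerivBounds h a b) : Continuous h := H.contDiff.continuous

theorem continuous_deriv (H : DerivBounds h a b) : Continuous (deriv h) :=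
  H.contDiff_deriv.continuous

theorem continuous_deriv2 (H : DerivBounds h a b) : Continuous (deriv (deriv h)) :=
  H.contDiff_deriv.continuous_deriv_one

theorem abs_sub_le (H : DerivBounds h a b) (p q : ℝ) : |h q - h p| ≤ a * |q - p| := by
  have := Convex.norm_image_sub_le_of_norm_deriv_le (f := h) (C := a) (s := Set.univ) (x := p)
    (y := q) (fun x _ => H.contDiff.differentiable (by norm_num) x) (fun x _ => H.fst x)
    convex_univ trivial trivial
  simpa using this

theorem abs_sub_sub_le_fst (H : DerivBounds h a b) (p q : ℝ) :
    |h q - h p - deriv h p * (q - p)| ≤ 2 * a * |q - p| := by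
  refine (abs_sub _ _).trans ?_
  have h1 := H.abs_sub_le p q
  rw [abs_mul]
  nlinarith [H.fst p, abs_nonneg (q - p)]

theorem abs_sub_sub_le_snd (H : DerivBounds h a b) (p q : ℝ) :
    |h q - h p - deriv h p * (q - p)| ≤ b / 2 * (q - p) ^ 2 := by
  have e := sub_sub_eq_integral_of_hasDerivAt (φ := fun t => h (p + t * (q - p)))
    (φ' := fun t => deriv h (p + t * (q - p)) * (q - p))
    (φ'' := fun t => deriv (deriv h) (p + t * (q - p)) * (q - p) * (q - p))
    (fun t => by
      have := (H.hasDerivAt (p + t * (q - p))).comp t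
        (((hasDerivAt_id t).mul_const (q - p)).const_add p)
      simpa [Function.comp_def] using this)
    (fun t => by
      have := ((H.hasDerivAt_deriv (p + t * (q - p))).comp t
        (((hasDerivAt_id t).mul_const (q - p)).const_add p)).mul_const (q - p)
      simpa [Function.comp_def] using this)
    (by have := H.continuous_deriv2; fun_prop)
  simp only [one_mul, add_sub_cancel, zero_mul, add_zero] at e
  rw [e]
  have hb : ∀ t ∈ Set.Ioc (0 : ℝ) 1,
      ‖(1 - t) * (deriv (deriv h) (p + t * (q - p)) * (q - p) * (q - p))‖
        ≤ (1 - t) * (b * (q - p) ^ 2) := by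
    intro t ht
    rw [norm_mul, Real.norm_of_nonneg (by linarith [ht.2]), mul_assoc _ (q - p), norm_mul, ← sq,
      Real.norm_of_nonneg (sq_nonneg (q - p))]
    have := H.snd (p + t * (q - p))
    have h1 : 0 ≤ 1 - t := by linarith [ht.2]
    rw [Real.norm_eq_abs]
    gcongr
  have := norm_integral_le_of_norm_le (μ := volume) zero_le_one (ae_of_all _ hb)
    (Continuous.intervalIntegrable (by fun_prop) _ _)
  rw [Real.norm_eq_abs] at this
  refine this.trans_eq ?_
  rw [intervalIntegral.integral_mul_const, intervalIntegral.integral_sub (by simp) (by simp)]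
  simp
  ring

end DerivBounds

variable {E : Type*} [NormedAddCommGroup E] [InnerProductSpace ℝ E]

/-- The remainder of the second order expansion of `y ↦ h (‖y‖ ^ 2)`. -/
noncomputable def quadRem (h : ℝ → ℝ) (y v : E) : ℝ :=
  h (‖y + v‖ ^ 2) - h (‖y‖ ^ 2) - (deriv h (‖y‖ ^ 2) * (2 * ⟪y, v⟫ + ‖v‖ ^ 2)
    + 2 * deriv (deriv h) (‖y‖ ^ 2) * ⟪y, v⟫ ^ 2)

/-- The second derivative of `y ↦ h (‖y‖ ^ 2)` in direction `v`. -/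
noncomputable def quadSnd (h : ℝ → ℝ) (v y : E) : ℝ :=
  4 * deriv (deriv h) (‖y‖ ^ 2) * ⟪y, v⟫ ^ 2 + 2 * deriv h (‖y‖ ^ 2) * ‖v‖ ^ 2

variable {h : ℝ → ℝ} {a b : ℝ}

/-- The increment `δ = 2⟪y, v⟫ + ‖v‖²` of the squared norm is itself quadratic in `v`, so the bound
by `δ²` is of order `‖v‖²` only for `‖v‖ ≤ 1`. For larger `v` the bound linear in `δ` is used,
because then `|δ| ≤ ‖v‖² (2 + ‖y‖²)`. The result is quadratic in `v` without restriction. -/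
theorem DerivBounds.abs_quadRem_le (H : DerivBounds h a b) (y v : E) :
    |quadRem h y v| ≤ ‖v‖ ^ 2 * (a * (4 + 2 * ‖y‖ ^ 2) + b * (5 * ‖y‖ ^ 2 + 3 / 2)) := by
  have ha := H.nonneg_fst
  have hb := H.nonneg_snd
  have hn : ‖y + v‖ ^ 2 = ‖y‖ ^ 2 + (2 * ⟪y, v⟫ + ‖v‖ ^ 2) := by
    rw [norm_add_sq_real]; ring
  set p := ‖y‖ ^ 2 with hp
  set δ := 2 * ⟪y, v⟫ + ‖v‖ ^ 2 with hδ
  have hyv : ⟪y, v⟫ ^ 2 ≤ ‖y‖ ^ 2 * ‖v‖ ^ 2 := by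
    rw [← mul_pow, ← sq_abs]
    exact pow_le_pow_left₀ (abs_nonneg _) (abs_real_inner_le_norm y v) 2
  have hyv' : |⟪y, v⟫| ≤ ‖y‖ * ‖v‖ := abs_real_inner_le_norm y v
  have hδle : |δ| ≤ 2 * (‖y‖ * ‖v‖) + ‖v‖ ^ 2 := by
    refine (abs_add_le _ _).trans ?_
    rw [abs_mul, abs_two, abs_of_nonneg (sq_nonneg ‖v‖)]
    linarith
  have hy0 := norm_nonneg y
  have hv0 := norm_nonneg v
  have hr : |quadRem h y v| ≤ |h (p + δ) - h p - deriv h p * δ| + 2 * b * (p * ‖v‖ ^ 2) := by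
    have e : quadRem h y v = (h (p + δ) - h p - deriv h p * δ)
        - 2 * deriv (deriv h) p * ⟪y, v⟫ ^ 2 := by
      rw [quadRem, hn]; ring
    rw [e]
    refine (abs_sub _ _).trans ?_
    rw [abs_mul, abs_mul, abs_two, abs_of_nonneg (sq_nonneg ⟪y, v⟫)]
    have := H.snd p
    gcongr
  have h1 := H.abs_sub_sub_le_fst p (p + δ)
  have h2 := H.abs_sub_sub_le_snd p (p + δ)
  rw [add_sub_cancel_left] at h1 h2
  have hyy : 2 * ‖y‖ ≤ 1 + ‖y‖ ^ 2 := by nlinarith [sq_nonneg (‖y‖ - 1)]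
  rcases le_or_gt ‖v‖ 1 with hv | hv
  · have hδ2 : δ ^ 2 ≤ ‖v‖ ^ 2 * (6 * ‖y‖ ^ 2 + 3) := by
      have h3 : |δ| ≤ ‖v‖ * (2 * ‖y‖ + 1) := by nlinarith
      have h4 : δ ^ 2 ≤ (‖v‖ * (2 * ‖y‖ + 1)) ^ 2 := by
        rw [← sq_abs]; exact pow_le_pow_left₀ (abs_nonneg _) h3 2
      have h5 : (2 * ‖y‖ + 1) ^ 2 ≤ 6 * ‖y‖ ^ 2 + 3 := by nlinarith
      calc δ ^ 2 ≤ ‖v‖ ^ 2 * (2 * ‖y‖ + 1) ^ 2 := by rw [← mul_pow]; exact h4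
        _ ≤ _ := by gcongr
    have h6 : b / 2 * δ ^ 2 ≤ b / 2 * (‖v‖ ^ 2 * (6 * ‖y‖ ^ 2 + 3)) := by gcongr
    have h7 : 0 ≤ ‖v‖ ^ 2 * (a * (4 + 2 * ‖y‖ ^ 2)) := by positivity
    rw [hp] at hr ⊢
    nlinarith
  · have h3 : |δ| ≤ ‖v‖ ^ 2 * (2 + ‖y‖ ^ 2) := by
      have : ‖y‖ * ‖v‖ ≤ ‖y‖ * ‖v‖ ^ 2 := by gcongr; nlinarith
      nlinarith [sq_nonneg ‖v‖]
    have h6 : 2 * a * |δ| ≤ 2 * a * (‖v‖ ^ 2 * (2 + ‖y‖ ^ 2)) := by gcongr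
    have h7 : 0 ≤ ‖v‖ ^ 2 * (b * (3 * ‖y‖ ^ 2 + 3 / 2)) := by positivity
    rw [hp] at hr ⊢
    nlinarith

theorem DerivBounds.abs_quadSnd_le (H : DerivBounds h a b) (v y : E) :
    |quadSnd h v y| ≤ 2 * a * ‖v‖ ^ 2 + 4 * b * ‖v‖ ^ 2 * ‖y‖ ^ 2 := by
  have hyv : ⟪y, v⟫ ^ 2 ≤ ‖y‖ ^ 2 * ‖v‖ ^ 2 := by
    rw [← mul_pow, ← sq_abs]
    exact pow_le_pow_left₀ (abs_nonneg _) (abs_real_inner_le_norm y v) 2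
  have h1 := H.fst (‖y‖ ^ 2)
  have h2 := H.snd (‖y‖ ^ 2)
  have hb := H.nonneg_snd
  rw [quadSnd]
  refine (abs_add_le _ _).trans ?_
  rw [abs_mul, abs_mul, abs_mul, abs_mul, abs_two, abs_of_nonneg (sq_nonneg ⟪y, v⟫),
    abs_of_nonneg (sq_nonneg ‖v‖), abs_of_pos (by norm_num : (0 : ℝ) < 4)]
  have h3 : 4 * |deriv (deriv h) (‖y‖ ^ 2)| * ⟪y, v⟫ ^ 2 ≤ 4 * b * (‖y‖ ^ 2 * ‖v‖ ^ 2) := by gcongr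
  have h4 : 2 * |deriv h (‖y‖ ^ 2)| * ‖v‖ ^ 2 ≤ 2 * a * ‖v‖ ^ 2 := by gcongr
  linarith

theorem DerivBounds.continuous_quadSnd (H : DerivBounds h a b) (v : E) :
    Continuous (quadSnd h v) := by
  have h1 := H.continuous_deriv
  have h2 := H.continuous_deriv2
  unfold quadSnd
  fun_prop

/-- The remainder becomes an average of increments of the second derivative. Pointwise these have no
rate, since `h''` is merely continuous, but after Gaussian averaging they do. -/
theorem DerivBounds.quadRem_eq_integral (H : DerivBounds h a b) (y v : E) :
    quadRem h y v = ∫ t in (0 : ℝ)..1, (1 - t) * (quadSnd h v (y + t • v) - quadSnd h v y) := by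
  have hsq : ∀ t : ℝ, HasDerivAt (fun t : ℝ => ‖y + t • v‖ ^ 2) (2 * ⟪y + t • v, v⟫) t := by
    intro t
    have h1 : HasDerivAt (fun t : ℝ => y + t • v) v t := by
      simpa using ((hasDerivAt_id t).smul_const v).const_add y
    exact h1.norm_sq
  have hin : ∀ t : ℝ, HasDerivAt (fun t : ℝ => 2 * ⟪y + t • v, v⟫) (2 * ‖v‖ ^ 2) t := by
    intro t
    have h1 : HasDerivAt (fun t : ℝ => y + t • v) v t := by
      simpa using ((hasDerivAt_id t).smul_const v).const_add y
    have := (h1.inner ℝ (hasDerivAt_const t v)).const_mul 2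
    simpa using this
  have hcont := H.continuous_quadSnd v
  have e := sub_sub_eq_integral_of_hasDerivAt (φ := fun t => h (‖y + t • v‖ ^ 2))
    (φ' := fun t => deriv h (‖y + t • v‖ ^ 2) * (2 * ⟪y + t • v, v⟫))
    (φ'' := fun t => quadSnd h v (y + t • v))
    (fun t => (H.hasDerivAt _).comp t (hsq t))
    (fun t => by
      have := ((H.hasDerivAt_deriv _).comp t (hsq t)).mul (hin t)
      refine this.congr_deriv ?_
      rw [quadSnd, Function.comp_apply]
      ring)
    (by fun_prop)
  simp only [one_smul, zero_smul, add_zero] at e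
  have e2 : ∫ t in (0 : ℝ)..1, (1 - t) * quadSnd h v y = quadSnd h v y / 2 := by
    rw [intervalIntegral.integral_mul_const, intervalIntegral.integral_sub (by simp) (by simp)]
    simp
    ring
  simp_rw [mul_sub]
  rw [intervalIntegral.integral_sub (Continuous.intervalIntegrable (by fun_prop) _ _)
    (Continuous.intervalIntegrable (by fun_prop) _ _), ← e, e2, quadRem, quadSnd]
  ring

end Expansion

/-! ### Gaussian smoothing -/

section Smoothing

open scoped RealInnerProductSpace

theorem norm_add_sq_le {E : Type*} [SeminormedAddCommGroup E] (x y : E) :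
    ‖x + y‖ ^ 2 ≤ 2 * ‖x‖ ^ 2 + 2 * ‖y‖ ^ 2 := by
  have h := norm_add_le x y
  have h1 : ‖x + y‖ ^ 2 ≤ (‖x‖ + ‖y‖) ^ 2 := pow_le_pow_left₀ (norm_nonneg _) h 2
  nlinarith [sq_nonneg (‖x‖ - ‖y‖)]

theorem norm_add_pow_four_le {E : Type*} [SeminormedAddCommGroup E] (x y : E) :
    (‖x + y‖ ^ 2) ^ 2 ≤ 8 * ‖x‖ ^ 4 + 8 * ‖y‖ ^ 4 := by
  have h1 : (‖x + y‖ ^ 2) ^ 2 ≤ (2 * ‖x‖ ^ 2 + 2 * ‖y‖ ^ 2) ^ 2 :=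
    pow_le_pow_left₀ (by positivity) (norm_add_sq_le x y) 2
  nlinarith [sq_nonneg (‖x‖ ^ 2 - ‖y‖ ^ 2)]

variable {E : Type*} [NormedAddCommGroup E] [InnerProductSpace ℝ E] [FiniteDimensional ℝ E]
  [MeasurableSpace E] [BorelSpace E]

theorem integrable_norm_add_smul_pow_four (x : E) (σ : ℝ) :
    Integrable (fun z : E => (‖x + σ • z‖ ^ 2) ^ 2) (stdGaussian E) := by
  have i4 := integrable_norm_pow_stdGaussian (E := E) 4
  refine ((integrable_const (8 * ‖x‖ ^ 4)).add (i4.const_mul (8 * σ ^ 4))).mono' (by fun_prop)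
    (ae_of_all _ fun z => ?_)
  rw [Real.norm_of_nonneg (by positivity)]
  refine (norm_add_pow_four_le x (σ • z)).trans_eq ?_
  simp only [Pi.add_apply, norm_smul, mul_pow, Real.norm_eq_abs]
  rw [show |σ| ^ 4 = (|σ| ^ 2) ^ 2 by ring, sq_abs]
  ring

theorem integral_norm_add_smul_pow_four_le (x : E) (σ : ℝ) :
    ∫ z : E, (‖x + σ • z‖ ^ 2) ^ 2 ∂stdGaussian E
      ≤ 24 * (‖x‖ ^ 2 + σ ^ 2 * Module.finrank ℝ E) ^ 2 := by
  have i4 := integrable_norm_pow_stdGaussian (E := E) 4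
  have h : ∀ z : E, (‖x + σ • z‖ ^ 2) ^ 2 ≤ 8 * ‖x‖ ^ 4 + 8 * σ ^ 4 * ‖z‖ ^ 4 := by
    intro z
    refine (norm_add_pow_four_le x (σ • z)).trans_eq ?_
    rw [norm_smul, mul_pow, Real.norm_eq_abs, show |σ| ^ 4 = (|σ| ^ 2) ^ 2 by ring, sq_abs]
    ring
  refine (integral_mono (integrable_norm_add_smul_pow_four x σ)
    ((integrable_const _).add (i4.const_mul _)) h).trans ?_
  rw [integral_add' (integrable_const _) (i4.const_mul _), integral_const_mul (8 * σ ^ 4)]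
  have h4 := integral_norm_pow_four_stdGaussian_le (E := E)
  set r : ℝ := (Module.finrank ℝ E : ℝ)
  have hr : 0 ≤ r := Nat.cast_nonneg _
  have h5 : 8 * σ ^ 4 * ∫ z : E, ‖z‖ ^ 4 ∂stdGaussian E ≤ 8 * σ ^ 4 * (3 * r ^ 2) := by gcongr
  have h6 : 0 ≤ ‖x‖ ^ 2 * (σ ^ 2 * r) := by positivity
  simp only [integral_const, probReal_univ, smul_eq_mul, one_mul]
  nlinarith [sq_nonneg (‖x‖ ^ 2)]

theorem integrable_norm_add_smul_sq (x : E) (σ : ℝ) :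
    Integrable (fun z : E => ‖x + σ • z‖ ^ 2) (stdGaussian E) := by
  have i2 := integrable_norm_pow_stdGaussian (E := E) 2
  refine ((integrable_const (2 * ‖x‖ ^ 2)).add (i2.const_mul (2 * σ ^ 2))).mono' (by fun_prop)
    (ae_of_all _ fun z => ?_)
  rw [Real.norm_of_nonneg (by positivity)]
  refine (norm_add_sq_le x (σ • z)).trans_eq ?_
  simp only [Pi.add_apply, norm_smul, mul_pow, Real.norm_eq_abs, sq_abs]
  ring

theorem integrable_of_abs_le_norm_sq {f : E → ℝ} (hf : Measurable f) {p q σ : ℝ} {x : E}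
    (hb : ∀ z, |f z| ≤ p + q * ‖x + σ • z‖ ^ 2) : Integrable f (stdGaussian E) :=
  ((integrable_const p).add ((integrable_norm_add_smul_sq x σ).const_mul q)).mono'
    hf.aestronglyMeasurable (ae_of_all _ hb)

theorem integrable_add_of_abs_le_norm_sq {f : E → ℝ} (hf : Measurable f) {p q σ : ℝ} {x : E}
    (hb : ∀ z, |f z| ≤ p + q * ‖x + σ • z‖ ^ 2) (u : E) :
    Integrable (fun z => f (z + u)) (stdGaussian E) :=
  integrable_of_abs_le_norm_sq (p := p) (q := q) (σ := σ) (x := x + σ • u)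
    (hf.comp (by fun_prop)) fun z => by
      have := hb (z + u)
      rwa [smul_add, ← add_assoc, add_right_comm] at this

/-- By Cameron-Martin the shift is moved from `f` to the density, so no smoothness of `f` is needed:
the difference equals `∫ D f` with `D` the density minus one. Cauchy-Schwarz, applied in the form of
Young's inequality, pairs `∫ D² ≤ 2 ‖u‖²` with the second and fourth moments of `x + σ z`. -/
theorem abs_integral_add_sub_le {f : E → ℝ} (hf : Measurable f) {p q σ : ℝ} (hp : 0 ≤ p)
    (hq : 0 ≤ q) (hσ : 0 < σ) (hr : 1 ≤ Module.finrank ℝ E) {x : E}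
    (hb : ∀ z, |f z| ≤ p + q * ‖x + σ • z‖ ^ 2) {u : E} (hu : ‖u‖ ≤ 1) :
    |∫ z, (f (z + u) - f z) ∂stdGaussian E|
      ≤ ‖u‖ * (3 / 2 * p + 7 * q * (‖x‖ ^ 2 + σ ^ 2 * Module.finrank ℝ E)) := by
  rcases eq_or_ne u 0 with rfl | hu0
  · simp
  set r : ℝ := (Module.finrank ℝ E : ℝ) with hrdef
  have hr' : 1 ≤ r := by rw [hrdef]; exact_mod_cast hr
  set m := ‖x‖ ^ 2 + σ ^ 2 * r with hm
  have hm0 : 0 < m := by positivity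
  set U := ‖u‖
  have hU : 0 < U := norm_pos_iff.2 hu0
  set D : E → ℝ := fun z => Real.exp (⟪u, z⟫ - U ^ 2 / 2) - 1 with hD
  obtain ⟨iD, eD⟩ := integral_exp_sub_one_sq_stdGaussian u
  have hexp : Real.exp (U ^ 2) - 1 ≤ 2 * U ^ 2 := by
    have h1 : |U ^ 2| ≤ 1 := by rw [abs_of_nonneg (by positivity)]; nlinarith
    have h2 := (abs_le.1 (Real.abs_exp_sub_one_sub_id_le h1)).2
    rw [abs_of_nonneg (by positivity)] at h1
    have h3 : (U ^ 2) ^ 2 ≤ U ^ 2 := by nlinarith [sq_nonneg U]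
    linarith
  have i4 := integrable_norm_add_smul_pow_four x σ
  have e4 := integral_norm_add_smul_pow_four_le x σ
  have hyoung : ∀ s t c : ℝ, 0 < c → s * |t| ≤ (s ^ 2 / c + c * t ^ 2) / 2 := by
    intro s t c hc
    have : (s ^ 2 / c + c * t ^ 2) / 2 - s * |t| = (s - c * |t|) ^ 2 / (2 * c) := by
      rw [← sq_abs t]; field_simp; ring
    have h2 : 0 ≤ (s - c * |t|) ^ 2 / (2 * c) := by positivity
    linarith
  set G : E → ℝ := fun z => (p * U / 2 + q * U / (7 * m) * (‖x + σ • z‖ ^ 2) ^ 2)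
    + (p / (2 * U) + q * (7 * m / (4 * U))) * D z ^ 2 with hG
  have iG1 : Integrable (fun z => p * U / 2 + q * U / (7 * m) * (‖x + σ • z‖ ^ 2) ^ 2)
      (stdGaussian E) := (integrable_const _).add (i4.const_mul _)
  have iG : Integrable G (stdGaussian E) := iG1.add (iD.const_mul _)
  have hle : ∀ z, |D z * f z| ≤ G z := by
    intro z
    rw [abs_mul]
    have h1 := hyoung 1 (D z) U⁻¹ (by positivity)
    -- Balancing the fourth moment bound `24 m²` against `∫ D² ≤ 2U²` would call for the weight `√12
    -- m/U`; `7/2` is a rational substitute for `√12`, and leads to `24/7 + 7/2 ≤ 7`.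
    have h2 := hyoung (‖x + σ • z‖ ^ 2) (D z) (7 * m / (2 * U)) (by positivity)
    calc |D z| * |f z| ≤ |D z| * (p + q * ‖x + σ • z‖ ^ 2) := by gcongr; exact hb z
      _ = p * (1 * |D z|) + q * (‖x + σ • z‖ ^ 2 * |D z|) := by ring
      _ ≤ p * ((1 ^ 2 / U⁻¹ + U⁻¹ * D z ^ 2) / 2)
          + q * (((‖x + σ • z‖ ^ 2) ^ 2 / (7 * m / (2 * U)) + 7 * m / (2 * U) * D z ^ 2) / 2) := by
        gcongr
      _ = G z := by rw [hG]; field_simp; ring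
  have iDf : Integrable (fun z => D z * f z) (stdGaussian E) :=
    iG.mono' (by fun_prop) (ae_of_all _ hle)
  have if0 := integrable_of_abs_le_norm_sq hf hb
  have if1 := integrable_add_of_abs_le_norm_sq hf hb u
  have e1 : ∫ z, (f (z + u) - f z) ∂stdGaussian E = ∫ z, D z * f z ∂stdGaussian E := by
    have iρ : Integrable (fun z => Real.exp (⟪u, z⟫ - ‖u‖ ^ 2 / 2) * f z) (stdGaussian E) := by
      refine (iDf.add if0).congr (ae_of_all _ fun z => ?_)
      simp only [Pi.add_apply, hD]; ring
    rw [integral_sub if1 if0, integral_add_stdGaussian hf, ← integral_sub iρ if0]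
    refine integral_congr_ae (ae_of_all _ fun z => ?_)
    simp only [hD]; ring
  rw [e1]
  refine (abs_integral_le_integral_abs.trans (integral_mono iDf.abs iG hle)).trans ?_
  rw [hG, integral_add iG1 (iD.const_mul _), integral_const_mul, eD,
    integral_add (integrable_const _) (i4.const_mul _), integral_const_mul]
  simp only [integral_const, probReal_univ, smul_eq_mul, one_mul]
  calc p * U / 2 + q * U / (7 * m) * ∫ z, (‖x + σ • z‖ ^ 2) ^ 2 ∂stdGaussian E
        + (p / (2 * U) + q * (7 * m / (4 * U))) * (Real.exp (U ^ 2) - 1)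
      ≤ p * U / 2 + q * U / (7 * m) * (24 * m ^ 2)
        + (p / (2 * U) + q * (7 * m / (4 * U))) * (2 * U ^ 2) := by gcongr
    _ = U * (3 / 2 * p + (24 / 7 + 7 / 2) * q * m) := by field_simp; ring
    _ ≤ U * (3 / 2 * p + 7 * q * m) := by gcongr; norm_num

/-- The gain of one derivative by smoothing. A shift of `x + σ z` by `t v` is a shift of `z` by
`(t/σ) v`, of norm at most `1` because `‖v‖ ≤ σ`; averaging the second derivative over `z` therefore
yields an extra factor `‖v‖/σ`. The remaining weight is `∫ (1 - t) t dt = 1/6`, which turns `3a +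
28bm` into at most `a + 5bm`. -/
theorem DerivBounds.abs_integral_quadRem_le {h : ℝ → ℝ} {a b : ℝ} (H : DerivBounds h a b)
    (hr : 1 ≤ Module.finrank ℝ E) {σ : ℝ} (hσ : 0 < σ) (x : E) {v : E} (hv : ‖v‖ ≤ σ) :
    |∫ z, quadRem h (x + σ • z) v ∂stdGaussian E|
      ≤ ‖v‖ ^ 3 / σ * (a + 5 * b * (‖x‖ ^ 2 + σ ^ 2 * Module.finrank ℝ E)) := by
  have ha := H.nonneg_fst
  have hb := H.nonneg_snd
  set m := ‖x‖ ^ 2 + σ ^ 2 * (Module.finrank ℝ E : ℝ) with hm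
  have hm0 : 0 ≤ m := by positivity
  have hcont := H.continuous_quadSnd v
  set f : E → ℝ := fun z => quadSnd h v (x + σ • z) with hf
  have hfm : Measurable f := (by fun_prop : Continuous f).measurable
  have hfb : ∀ z, |f z| ≤ 2 * a * ‖v‖ ^ 2 + 4 * b * ‖v‖ ^ 2 * ‖x + σ • z‖ ^ 2 := fun z =>
    H.abs_quadSnd_le v _
  have hshift : ∀ (t : ℝ) (z : E), quadSnd h v (x + σ • z + t • v) = f (z + (t / σ) • v) := by
    intro t z
    simp only [hf, smul_add, smul_smul, add_assoc, mul_div_cancel₀ _ hσ.ne']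
  have hinner : ∀ t ∈ Set.Ioc (0 : ℝ) 1,
      |∫ z, (1 - t) * (quadSnd h v (x + σ • z + t • v) - quadSnd h v (x + σ • z)) ∂stdGaussian E|
        ≤ (t - t ^ 2) * (‖v‖ ^ 3 / σ * (3 * a + 28 * b * m)) := by
    intro t ht
    have hu : ‖(t / σ) • v‖ = t / σ * ‖v‖ := by
      rw [norm_smul, Real.norm_of_nonneg (by have := ht.1; positivity)]
    have hu1 : ‖(t / σ) • v‖ ≤ 1 := by
      rw [hu, div_mul_eq_mul_div, div_le_one hσ]
      nlinarith [ht.1, ht.2, norm_nonneg v]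
    have := abs_integral_add_sub_le hfm (by positivity) (by positivity) hσ hr hfb hu1
    rw [integral_const_mul, abs_mul, abs_of_nonneg (by linarith [ht.2])]
    simp_rw [hshift]
    calc (1 - t) * |∫ z, (f (z + (t / σ) • v) - f z) ∂stdGaussian E|
        ≤ (1 - t) * (‖(t / σ) • v‖ * (3 / 2 * (2 * a * ‖v‖ ^ 2) + 7 * (4 * b * ‖v‖ ^ 2) * m)) := by
          gcongr
          linarith [ht.2]
      _ = _ := by rw [hu]; ring
  have hint : Integrable (Function.uncurry fun (t : ℝ) (z : E) =>
      (1 - t) * (quadSnd h v (x + σ • z + t • v) - quadSnd h v (x + σ • z)))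
      ((volume.restrict (Set.uIoc 0 1)).prod (stdGaussian E)) := by
    have i1 : Integrable (fun z : E => 4 * a * ‖v‖ ^ 2 + 8 * b * ‖v‖ ^ 4
        + 12 * b * ‖v‖ ^ 2 * ‖x + σ • z‖ ^ 2) (stdGaussian E) :=
      (integrable_const _).add ((integrable_norm_add_smul_sq x σ).const_mul _)
    have i2 : Integrable (fun t : ℝ => |1 - t| * (1 + t ^ 2)) (volume.restrict (Set.uIoc 0 1)) :=
      (intervalIntegrable_iff.1 (Continuous.intervalIntegrable (by fun_prop) _ _))
    refine (i2.mul_prod i1).mono' ?_ (ae_of_all _ fun ⟨t, z⟩ => ?_)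
    · exact (by fun_prop : Continuous _).aestronglyMeasurable
    simp only [Function.uncurry_apply_pair]
    rw [norm_mul, Real.norm_eq_abs, Real.norm_eq_abs]
    have h1 := H.abs_quadSnd_le v (x + σ • z + t • v)
    have h2 := H.abs_quadSnd_le v (x + σ • z)
    have h3 := norm_add_sq_le (x + σ • z) (t • v)
    rw [norm_smul, mul_pow, Real.norm_eq_abs, sq_abs] at h3
    have h4 : 4 * b * ‖v‖ ^ 2 * ‖x + σ • z + t • v‖ ^ 2
        ≤ 4 * b * ‖v‖ ^ 2 * (2 * ‖x + σ • z‖ ^ 2 + 2 * (t ^ 2 * ‖v‖ ^ 2)) := by gcongr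
    have h5 := abs_sub (quadSnd h v (x + σ • z + t • v)) (quadSnd h v (x + σ • z))
    have h6 : 0 ≤ 12 * b * ‖v‖ ^ 2 * ‖x + σ • z‖ ^ 2 * t ^ 2 := by positivity
    have h7 : 0 ≤ 4 * a * ‖v‖ ^ 2 * t ^ 2 := by positivity
    have h8 : 0 ≤ 8 * b * ‖v‖ ^ 4 := by positivity
    rw [mul_assoc]
    gcongr
    nlinarith
  simp_rw [H.quadRem_eq_integral]
  rw [← intervalIntegral_integral_swap hint, ← Real.norm_eq_abs]
  refine (intervalIntegral.norm_integral_le_of_norm_le (μ := volume) zero_le_one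
    (ae_of_all _ hinner) (Continuous.intervalIntegrable (by fun_prop) _ _)).trans ?_
  rw [intervalIntegral.integral_mul_const, intervalIntegral.integral_sub (by simp) (by simp),
    integral_id, integral_pow]
  have h1 : 0 ≤ ‖v‖ ^ 3 / σ := by positivity
  have h2 : 0 ≤ b * m := by positivity
  have h3 : (((1 : ℝ) ^ 2 - 0 ^ 2) / 2 - (1 ^ (2 + 1) - 0 ^ (2 + 1)) / ((2 : ℕ) + 1))
      * (‖v‖ ^ 3 / σ * (3 * a + 28 * b * m)) = ‖v‖ ^ 3 / σ * (a / 2 + 14 / 3 * (b * m)) := by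
    push_cast; ring
  rw [h3]
  exact mul_le_mul_of_nonneg_left (by nlinarith) h1

end Smoothing

/-! ### Replacing the summands by Gaussian vectors -/

section Lindeberg

open scoped RealInnerProductSpace

theorem DerivBounds.continuous_quadRem {E : Type*} [NormedAddCommGroup E]
    [InnerProductSpace ℝ E] {h : ℝ → ℝ} {a b : ℝ} (H : DerivBounds h a b) :
    Continuous fun z : E × E => quadRem h z.1 z.2 := by
  have h0 := H.continuous
  have h1 := H.continuous_deriv
  have h2 := H.continuous_deriv2
  unfold quadRem
  fun_prop

theorem DerivBounds.continuous_quadRem_left {E : Type*} [NormedAddCommGroup E]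
    [InnerProductSpace ℝ E] {h : ℝ → ℝ} {a b : ℝ} (H : DerivBounds h a b) (v : E) :
    Continuous fun y : E => quadRem h y v := by
  have h0 := H.continuous
  have h1 := H.continuous_deriv
  have h2 := H.continuous_deriv2
  unfold quadRem
  fun_prop

variable {E : Type*} [NormedAddCommGroup E] [InnerProductSpace ℝ E] [FiniteDimensional ℝ E]
  [MeasurableSpace E] [BorelSpace E]

/-- `ρ` is a centred probability measure with covariance `s` times the identity and finite third
moment. -/
structure IsIsotropic (ρ : Measure E) (s : ℝ) : Prop where
  prob : IsProbabilityMeasure ρ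
  integrable : Integrable (fun v : E => ‖v‖ ^ 3) ρ
  mean : ∀ a : E, ∫ v, ⟪a, v⟫ ∂ρ = 0
  cov : ∀ a : E, ∫ v, ⟪a, v⟫ ^ 2 ∂ρ = s * ‖a‖ ^ 2

theorem IsIsotropic.integrable_sq {ρ : Measure E} {s : ℝ} (hρ : IsIsotropic ρ s) :
    Integrable (fun v : E => ‖v‖ ^ 2) ρ := by
  have := hρ.prob
  refine ((integrable_const 1).add hρ.integrable).mono' (by fun_prop) (ae_of_all _ fun v => ?_)
  rw [Real.norm_of_nonneg (by positivity), Pi.add_apply]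
  have h0 := norm_nonneg v
  rcases le_total ‖v‖ 1 with h | h
  · nlinarith [pow_nonneg h0 3]
  · nlinarith [sq_nonneg ‖v‖]

theorem IsIsotropic.integrable_inner {ρ : Measure E} {s : ℝ} (hρ : IsIsotropic ρ s) (a : E) :
    Integrable (fun v : E => ⟪a, v⟫) ρ := by
  have := hρ.prob
  refine (((integrable_const 1).add hρ.integrable_sq).const_mul ‖a‖).mono' (by fun_prop)
    (ae_of_all _ fun v => ?_)
  refine (norm_inner_le_norm a v).trans ?_
  simp only [Pi.add_apply]
  gcongr
  nlinarith [sq_nonneg (‖v‖ - 1)]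

theorem IsIsotropic.integral_norm_sq {ρ : Measure E} {s : ℝ} (hρ : IsIsotropic ρ s) :
    ∫ v, ‖v‖ ^ 2 ∂ρ = s * Module.finrank ℝ E :=
  integral_norm_sq_of_isotropic hρ.integrable_sq hρ.cov

theorem isIsotropic_scaledGaussian (s : ℝ) : IsIsotropic (scaledGaussian E s) (s ^ 2) where
  prob := inferInstance
  integrable := integrable_norm_pow_scaledGaussian s 3
  mean a := by
    rw [integral_scaledGaussian (by fun_prop)]
    simp_rw [inner_smul_right]
    rw [integral_const_mul, integral_inner_stdGaussian, mul_zero]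
  cov a := by
    rw [integral_scaledGaussian (by fun_prop)]
    simp_rw [inner_smul_right, mul_pow]
    rw [integral_const_mul, integral_inner_sq_stdGaussian]

theorem integrable_norm_sq_conv {μ ν : Measure E} [IsProbabilityMeasure μ]
    [IsProbabilityMeasure ν] (hμ : Integrable (fun x : E => ‖x‖ ^ 2) μ)
    (hν : Integrable (fun x : E => ‖x‖ ^ 2) ν) : Integrable (fun x : E => ‖x‖ ^ 2) (μ ∗ ν) := by
  rw [Measure.conv, integrable_map_measure (by fun_prop) (by fun_prop)]
  refine (((hμ.comp_fst ν).const_mul 2).add ((hν.comp_snd μ).const_mul 2)).mono' (by fun_prop)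
    (ae_of_all _ fun z => ?_)
  rw [Function.comp_apply, Real.norm_of_nonneg (by positivity)]
  exact norm_add_sq_le z.1 z.2

theorem IsIsotropic.integral_norm_sq_conv {ρ : Measure E} {s : ℝ} (hρ : IsIsotropic ρ s)
    {μ : Measure E} [IsProbabilityMeasure μ] (hμ : Integrable (fun x : E => ‖x‖ ^ 2) μ) :
    ∫ x, ‖x‖ ^ 2 ∂(μ ∗ ρ) = ∫ x, ‖x‖ ^ 2 ∂μ + s * Module.finrank ℝ E := by
  have := hρ.prob
  rw [integral_conv (integrable_norm_sq_conv hμ hρ.integrable_sq)]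
  have h : ∀ x : E, ∫ v, ‖x + v‖ ^ 2 ∂ρ = ‖x‖ ^ 2 + s * Module.finrank ℝ E := by
    intro x
    simp_rw [norm_add_sq_real]
    rw [integral_add (by exact (integrable_const _).add ((hρ.integrable_inner x).const_mul 2))
      hρ.integrable_sq, integral_add (integrable_const _) ((hρ.integrable_inner x).const_mul 2),
      integral_const_mul, hρ.mean, hρ.integral_norm_sq]
    simp
  simp_rw [h]
  rw [integral_add hμ (integrable_const _)]
  simp

variable {h : ℝ → ℝ} {a b : ℝ}

theorem DerivBounds.integrable_quadRem (H : DerivBounds h a b) {π ρ : Measure E}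
    [IsProbabilityMeasure π] [IsProbabilityMeasure ρ] (hπ : Integrable (fun x : E => ‖x‖ ^ 2) π)
    (hρ : Integrable (fun x : E => ‖x‖ ^ 2) ρ) :
    Integrable (fun z : E × E => quadRem h z.1 z.2) (π.prod ρ) := by
  have i1 : Integrable (fun y : E => a * (4 + 2 * ‖y‖ ^ 2) + b * (5 * ‖y‖ ^ 2 + 3 / 2)) π :=
    (((integrable_const _).add (hπ.const_mul _)).const_mul _).add
      (((hπ.const_mul _).add (integrable_const _)).const_mul _)
  refine (i1.mul_prod hρ).mono' H.continuous_quadRem.aestronglyMeasurable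
    (ae_of_all _ fun z => ?_)
  rw [mul_comm]
  exact H.abs_quadRem_le z.1 z.2

/-- The first integral on the right depends on `ρ` only through `s`. For two isotropic laws with the
same `s` it cancels, and only the remainders are left to compare. -/
theorem DerivBounds.integral_conv_eq (H : DerivBounds h a b) (hh : ∃ c, ∀ x, |h x| ≤ c)
    {π ρ : Measure E} [IsProbabilityMeasure π] {s : ℝ} (hπ : Integrable (fun x : E => ‖x‖ ^ 2) π)
    (hρ : IsIsotropic ρ s) :
    ∫ w, h (‖w‖ ^ 2) ∂(π ∗ ρ) =
      ∫ y, (h (‖y‖ ^ 2) + s * (deriv h (‖y‖ ^ 2) * Module.finrank ℝ E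
        + 2 * deriv (deriv h) (‖y‖ ^ 2) * ‖y‖ ^ 2)) ∂π
      + ∫ v, ∫ y, quadRem h y v ∂π ∂ρ := by
  have := hρ.prob
  have h0 := H.continuous
  have h1 := H.continuous_deriv
  have h2 := H.continuous_deriv2
  have hb := H.nonneg_snd
  obtain ⟨c, hc⟩ := hh
  have hi : ∀ (μ : Measure E) [IsProbabilityMeasure μ] (y : E),
      Integrable (fun x : E => h (‖y + x‖ ^ 2)) μ := fun μ _ y =>
    (integrable_const c).mono' (by fun_prop) (ae_of_all _ fun x => hc _)
  have hi0 : ∀ (μ : Measure E) [IsProbabilityMeasure μ],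
      Integrable (fun x : E => h (‖x‖ ^ 2)) μ := fun μ _ => by simpa using hi μ 0
  have hrem := H.integrable_quadRem hπ hρ.integrable_sq
  have hρ2 := hρ.integrable_sq
  have hin : ∀ y : E, ∫ v, h (‖y + v‖ ^ 2) ∂ρ = h (‖y‖ ^ 2)
      + s * (deriv h (‖y‖ ^ 2) * Module.finrank ℝ E + 2 * deriv (deriv h) (‖y‖ ^ 2) * ‖y‖ ^ 2)
      + ∫ v, quadRem h y v ∂ρ := by
    intro y
    have i1 := hρ.integrable_inner y
    have i2 : Integrable (fun v => ⟪y, v⟫ ^ 2) ρ := integrable_inner_pow hρ2 y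
    have iA : Integrable (fun v => deriv h (‖y‖ ^ 2) * (2 * ⟪y, v⟫ + ‖v‖ ^ 2)) ρ :=
      ((i1.const_mul 2).add hρ2).const_mul _
    have iB : Integrable (fun v => 2 * deriv (deriv h) (‖y‖ ^ 2) * ⟪y, v⟫ ^ 2) ρ :=
      i2.const_mul _
    have iR : Integrable (fun v => quadRem h y v) ρ := by
      unfold quadRem
      exact ((hi ρ y).sub (integrable_const _)).sub (iA.add iB)
    have e : (fun v => h (‖y + v‖ ^ 2)) = fun v => (h (‖y‖ ^ 2)
        + (deriv h (‖y‖ ^ 2) * (2 * ⟪y, v⟫ + ‖v‖ ^ 2)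
          + 2 * deriv (deriv h) (‖y‖ ^ 2) * ⟪y, v⟫ ^ 2)) + quadRem h y v := by
      ext v; rw [quadRem]; ring
    rw [e, integral_add (by exact (integrable_const _).add (iA.add iB)) iR,
      integral_add (integrable_const _) (by exact iA.add iB), integral_add iA iB,
      integral_const_mul,
      integral_add (i1.const_mul 2) hρ2, integral_const_mul, hρ.mean, hρ.integral_norm_sq,
      integral_const_mul, hρ.cov]
    simp only [integral_const, probReal_univ, smul_eq_mul]
    ring
  rw [integral_conv (hi0 _)]
  simp_rw [hin]
  rw [integral_add, integral_integral_swap (f := fun y v => quadRem h y v) hrem]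
  · refine (hi0 π).add (Integrable.const_mul (Integrable.add ?_ ?_) _)
    · refine Integrable.mul_const ((integrable_const a).mono' ?_ (ae_of_all _ fun x => H.fst _)) _
      exact (by fun_prop : Continuous fun y : E => deriv h (‖y‖ ^ 2)).aestronglyMeasurable
    · refine (hπ.const_mul (2 * b)).mono' ?_ (ae_of_all _ fun x => ?_)
      · exact (by fun_prop : Continuous fun y : E =>
          2 * deriv (deriv h) (‖y‖ ^ 2) * ‖y‖ ^ 2).aestronglyMeasurable
      rw [norm_mul, norm_mul, Real.norm_of_nonneg (sq_nonneg ‖x‖), Real.norm_ofNat,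
        Real.norm_eq_abs]
      have := H.snd (‖x‖ ^ 2)
      gcongr
  · exact hrem.integral_prod_left

theorem DerivBounds.integrable_quadRem_left (H : DerivBounds h a b) {π : Measure E}
    [IsProbabilityMeasure π] (hπ : Integrable (fun x : E => ‖x‖ ^ 2) π) (v : E) :
    Integrable (fun y => quadRem h y v) π := by
  have hcont := H.continuous_quadRem_left v
  have iA : Integrable (fun y : E => a * (4 + 2 * ‖y‖ ^ 2)) π :=
    ((integrable_const _).add (hπ.const_mul _)).const_mul _
  have iB : Integrable (fun y : E => b * (5 * ‖y‖ ^ 2 + 3 / 2)) π :=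
    ((hπ.const_mul _).add (integrable_const _)).const_mul _
  have iC : Integrable (fun y : E => ‖v‖ ^ 2 *
      (a * (4 + 2 * ‖y‖ ^ 2) + b * (5 * ‖y‖ ^ 2 + 3 / 2))) π := (iA.add iB).const_mul _
  exact iC.mono' hcont.aestronglyMeasurable (ae_of_all _ fun y => H.abs_quadRem_le y v)

theorem DerivBounds.abs_integral_quadRem_le_sq (H : DerivBounds h a b)
    (hr : 1 ≤ Module.finrank ℝ E) {π : Measure E} [IsProbabilityMeasure π]
    (hπ : Integrable (fun x : E => ‖x‖ ^ 2) π) (hπr : ∫ x, ‖x‖ ^ 2 ∂π ≤ Module.finrank ℝ E)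
    (v : E) :
    |∫ y, quadRem h y v ∂π| ≤ 13 / 2 * Module.finrank ℝ E * (a + b) * ‖v‖ ^ 2 := by
  have ha := H.nonneg_fst
  have hb := H.nonneg_snd
  have hr' : (1 : ℝ) ≤ Module.finrank ℝ E := by exact_mod_cast hr
  have iA : Integrable (fun y : E => a * (4 + 2 * ‖y‖ ^ 2)) π :=
    ((integrable_const _).add (hπ.const_mul _)).const_mul _
  have iB : Integrable (fun y : E => b * (5 * ‖y‖ ^ 2 + 3 / 2)) π :=
    ((hπ.const_mul _).add (integrable_const _)).const_mul _
  have iC : Integrable (fun y : E => ‖v‖ ^ 2 *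
      (a * (4 + 2 * ‖y‖ ^ 2) + b * (5 * ‖y‖ ^ 2 + 3 / 2))) π := (iA.add iB).const_mul _
  have hle := norm_integral_le_of_norm_le (f := fun y => quadRem h y v) iC
    (ae_of_all _ fun y => H.abs_quadRem_le y v)
  rw [Real.norm_eq_abs] at hle
  refine hle.trans ?_
  rw [integral_const_mul, integral_add iA iB, integral_const_mul, integral_const_mul,
    integral_add (integrable_const _) (hπ.const_mul _),
    integral_add (hπ.const_mul _) (integrable_const _), integral_const_mul, integral_const_mul]
  simp only [integral_const, probReal_univ, smul_eq_mul, one_mul]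
  rw [mul_comm (13 / 2 * (Module.finrank ℝ E : ℝ) * (a + b))]
  set r : ℝ := (Module.finrank ℝ E : ℝ)
  set S := ∫ x, ‖x‖ ^ 2 ∂π
  -- Here `S ≤ r` and `r ≥ 1`; the constant `13/2 = 5 + 3/2` is dictated by the coefficient of `b`.
  have h1 : a * (4 + 2 * S) ≤ a * (13 / 2 * r) := by gcongr; linarith
  have h2 : b * (5 * S + 3 / 2) ≤ b * (13 / 2 * r) := by gcongr; linarith
  gcongr
  linarith

/-- For `‖v‖ ≤ σ` the smoothing estimate applies, integrated over the non-Gaussian part. For `‖v‖ >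
σ` the quadratic bound is already enough, since then `‖v‖² ≤ ‖v‖³/σ`. -/
theorem DerivBounds.abs_integral_quadRem_le_cube (H : DerivBounds h a b)
    (hr : 1 ≤ Module.finrank ℝ E) {μ : Measure E} [IsProbabilityMeasure μ] {σ : ℝ} (hσ : 0 < σ)
    (hμ : Integrable (fun x : E => ‖x‖ ^ 2) μ)
    (hμr : ∫ x, ‖x‖ ^ 2 ∂μ + σ ^ 2 * Module.finrank ℝ E ≤ Module.finrank ℝ E) (v : E) :
    |∫ y, quadRem h y v ∂(μ ∗ scaledGaussian E σ)|
      ≤ 13 / 2 * Module.finrank ℝ E * (a + b) * (‖v‖ ^ 3 / σ) := by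
  have ha := H.nonneg_fst
  have hb := H.nonneg_snd
  have hr' : (1 : ℝ) ≤ Module.finrank ℝ E := by exact_mod_cast hr
  have hG := isIsotropic_scaledGaussian (E := E) σ
  have hπ := integrable_norm_sq_conv hμ hG.integrable_sq
  rcases le_or_gt ‖v‖ σ with hv | hv
  · have hcont := H.continuous_quadRem_left v
    have hq := H.integrable_quadRem_left hπ v
    rw [integral_conv hq]
    have hin : ∀ x : E, ‖∫ y, quadRem h (x + y) v ∂scaledGaussian E σ‖
        ≤ ‖v‖ ^ 3 / σ * (a + 5 * b * (‖x‖ ^ 2 + σ ^ 2 * Module.finrank ℝ E)) := by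
      intro x
      rw [integral_scaledGaussian (F := fun y => quadRem h (x + y) v)
        (by fun_prop : Continuous _).measurable]
      exact H.abs_integral_quadRem_le hr hσ x hv
    have iX : Integrable (fun x : E => ‖x‖ ^ 2 + σ ^ 2 * Module.finrank ℝ E) μ :=
      hμ.add (integrable_const _)
    have hle := norm_integral_le_of_norm_le
      (((integrable_const a).add (iX.const_mul (5 * b))).const_mul (‖v‖ ^ 3 / σ))
      (ae_of_all _ hin)
    rw [Real.norm_eq_abs] at hle
    refine hle.trans ?_
    simp only [Pi.add_apply]
    rw [integral_const_mul, integral_add (integrable_const _) (iX.const_mul _),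
      integral_const_mul, integral_add hμ (integrable_const _)]
    simp only [integral_const, probReal_univ, smul_eq_mul, one_mul]
    rw [mul_comm (13 / 2 * (Module.finrank ℝ E : ℝ) * (a + b))]
    set r : ℝ := (Module.finrank ℝ E : ℝ)
    have h1 : 5 * b * (∫ x, ‖x‖ ^ 2 ∂μ + σ ^ 2 * r) ≤ 5 * b * r := by gcongr
    have h2 : a ≤ a * r := le_mul_of_one_le_right ha hr'
    have h3 : 0 ≤ a * r := by positivity
    have h4 : 0 ≤ b * r := by positivity
    refine mul_le_mul_of_nonneg_left ?_ (by positivity)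
    nlinarith
  · have hπr : ∫ x, ‖x‖ ^ 2 ∂(μ ∗ scaledGaussian E σ) ≤ Module.finrank ℝ E := by
      rw [hG.integral_norm_sq_conv hμ]; exact hμr
    refine (H.abs_integral_quadRem_le_sq hr hπ hπr v).trans ?_
    gcongr
    rw [le_div_iff₀ hσ, show ‖v‖ ^ 3 = ‖v‖ ^ 2 * ‖v‖ by ring]
    gcongr

end Lindeberg

/-! ### The Lindeberg exchange along convolution powers -/

section Telescope

open scoped RealInnerProductSpace

variable {E : Type*} [NormedAddCommGroup E] [InnerProductSpace ℝ E] [FiniteDimensional ℝ E]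
  [MeasurableSpace E] [BorelSpace E]

/-- The `k`-fold convolution power of a measure. -/
noncomputable def convPow (ρ : Measure E) : ℕ → Measure E
  | 0 => Measure.dirac 0
  | k + 1 => convPow ρ k ∗ ρ

theorem isProbabilityMeasure_convPow (ρ : Measure E) [IsProbabilityMeasure ρ] (k : ℕ) :
    IsProbabilityMeasure (convPow ρ k) := by
  induction k with
  | zero => rw [convPow]; infer_instance
  | succ k ih => rw [convPow]; infer_instance

theorem IsIsotropic.convPow_sq {ρ : Measure E} {s : ℝ} (hρ : IsIsotropic ρ s) (k : ℕ) :
    Integrable (fun x : E => ‖x‖ ^ 2) (convPow ρ k) ∧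
      ∫ x, ‖x‖ ^ 2 ∂convPow ρ k = k * (s * Module.finrank ℝ E) := by
  have := hρ.prob
  have hP := isProbabilityMeasure_convPow ρ
  induction k with
  | zero => simp [convPow, integrable_dirac]
  | succ k ih =>
    refine ⟨integrable_norm_sq_conv ih.1 hρ.integrable_sq, ?_⟩
    rw [convPow, hρ.integral_norm_sq_conv ih.1, ih.2]
    push_cast
    ring

theorem map_sum_eq_convPow {Ω ι : Type*} [MeasurableSpace Ω] {P : Measure Ω}
    {X : ι → Ω → E} (hX : ∀ i, Measurable (X i)) (hind : iIndepFun X P) {ρ : Measure E}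
    (hρ : ∀ i, P.map (X i) = ρ) (s : Finset ι) :
    P.map (∑ i ∈ s, X i) = convPow ρ s.card := by
  classical
  have := hind.isProbabilityMeasure
  induction s using Finset.induction_on with
  | empty =>
    rw [Finset.sum_empty, Finset.card_empty, convPow, show (0 : Ω → E) = fun _ => 0 from rfl,
      Measure.map_const]
    simp
  | insert i s hi ih =>
    rw [Finset.sum_insert hi, Finset.card_insert_of_notMem hi, convPow, add_comm,
      (hind.indepFun_finsetSum_of_notMem hX hi).map_add_eq_map_conv_map
        (by fun_prop) (hX i), ih, hρ]

/-- Telescoping of `1/√(m+1) ≤ 2 (√(m+1) - √m)`. The isolated `1` stands for the exchange step in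
which no Gaussian summand is available. -/
theorem one_add_sum_inv_sqrt_le (n : ℕ) (hn : 1 ≤ n) :
    1 + ∑ m ∈ Finset.Ico 1 n, (√(m : ℝ))⁻¹ ≤ 2 * √(n : ℝ) := by
  have h : ∀ n : ℕ, 1 ≤ n → 1 + ∑ m ∈ Finset.Ico 1 (n + 1), (√(m : ℝ))⁻¹ ≤ 2 * √(n : ℝ) := by
    intro n hn
    induction n, hn using Nat.le_induction with
    | base => norm_num
    | succ n hn ih =>
      rw [Finset.sum_Ico_succ_top (by omega), ← add_assoc]
      have h1 : (√((n + 1 : ℕ) : ℝ))⁻¹ ≤ 2 * √((n + 1 : ℕ) : ℝ) - 2 * √(n : ℝ) := by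
        have hpos : 0 < √((n + 1 : ℕ) : ℝ) := Real.sqrt_pos.2 (by positivity)
        have e1 := Real.sq_sqrt (Nat.cast_nonneg (α := ℝ) (n + 1))
        have e2 := Real.sq_sqrt (Nat.cast_nonneg (α := ℝ) n)
        have e3 := Real.sqrt_nonneg (n : ℝ)
        rw [inv_eq_one_div, div_le_iff₀ hpos]
        push_cast at *
        nlinarith [sq_nonneg (√((n : ℝ) + 1) - √(n : ℝ))]
      linarith
  obtain ⟨k, rfl⟩ : ∃ k, n = k + 1 := ⟨n - 1, by omega⟩
  rcases Nat.eq_zero_or_pos k with rfl | hk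
  · norm_num
  · refine (h k hk).trans ?_
    gcongr
    simp

/-- Lyapunov's inequality between second and third moments, from `3 t x² ≤ 2 x³ + t³` with `t² =
E‖v‖²`. It allows Gaussian moments and second moments to be absorbed into the third moment of `ρ`.
-/
theorem IsIsotropic.pow_three_le {ρ : Measure E} {s : ℝ} (hρ : IsIsotropic ρ (s ^ 2))
    (hs : 0 ≤ s) :
    (s * √(Module.finrank ℝ E)) ^ 3 ≤ ∫ v, ‖v‖ ^ 3 ∂ρ := by
  have := hρ.prob
  set t := s * √(Module.finrank ℝ E : ℝ) with ht
  have ht0 : 0 ≤ t := by positivity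
  have h2 : ∫ v, ‖v‖ ^ 2 ∂ρ = t ^ 2 := by
    rw [hρ.integral_norm_sq, ht, mul_pow, Real.sq_sqrt (by positivity)]
  have h3 : ∫ v, 3 * t * ‖v‖ ^ 2 ∂ρ ≤ ∫ v, (2 * ‖v‖ ^ 3 + t ^ 3) ∂ρ := by
    refine integral_mono (hρ.integrable_sq.const_mul _)
      ((hρ.integrable.const_mul _).add (integrable_const _)) fun v => ?_
    have h0 := norm_nonneg v
    have : 2 * ‖v‖ ^ 3 + t ^ 3 - 3 * t * ‖v‖ ^ 2 = (‖v‖ - t) ^ 2 * (2 * ‖v‖ + t) := by ring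
    have h1 : 0 ≤ (‖v‖ - t) ^ 2 * (2 * ‖v‖ + t) := by positivity
    simp only
    linarith
  rw [integral_const_mul, h2, integral_add (hρ.integrable.const_mul _) (integrable_const _),
    integral_const_mul] at h3
  simp only [integral_const, probReal_univ, smul_eq_mul, one_mul] at h3
  nlinarith

theorem integral_norm_pow_three_scaledGaussian_le {s : ℝ} (hs : 0 ≤ s) :
    ∫ v : E, ‖v‖ ^ 3 ∂scaledGaussian E s ≤ √3 * (s * √(Module.finrank ℝ E)) ^ 3 := by
  rw [integral_scaledGaussian (by fun_prop)]
  simp_rw [norm_smul, mul_pow]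
  rw [integral_const_mul, Real.norm_of_nonneg hs]
  have h := integral_norm_pow_three_stdGaussian_le (E := E)
  have e : √(Module.finrank ℝ E : ℝ) ^ 3 = √(Module.finrank ℝ E) * Module.finrank ℝ E := by
    rw [pow_succ, Real.sq_sqrt (by positivity)]; ring
  rw [e]
  have h3 : 0 ≤ s ^ 3 := by positivity
  nlinarith

/-- Normal approximation of a smooth function of the squared norm of a sum of independent
isotropic vectors. -/
theorem DerivBounds.abs_integral_convPow_sub_le {h : ℝ → ℝ} {a b : ℝ} (H : DerivBounds h a b)
    (hh : ∃ c, ∀ x, |h x| ≤ c) (hr : 1 ≤ Module.finrank ℝ E) {n : ℕ} (hn : 1 ≤ n)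
    {ρ : Measure E} (hρ : IsIsotropic ρ ((√(n : ℝ))⁻¹ ^ 2)) :
    |∫ x, h (‖x‖ ^ 2) ∂convPow ρ n - ∫ x : E, h (‖x‖ ^ 2) ∂stdGaussian E|
      ≤ 13 * (1 + √3) * Module.finrank ℝ E * (a + b) * (n * ∫ v, ‖v‖ ^ 3 ∂ρ) := by
  have := hρ.prob
  have hP := isProbabilityMeasure_convPow ρ
  have ha := H.nonneg_fst
  have hb := H.nonneg_snd
  have hn0 : (0 : ℝ) < n := by exact_mod_cast hn
  have hsn : 0 < √(n : ℝ) := Real.sqrt_pos.2 hn0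
  set δ := (√(n : ℝ))⁻¹ with hδ
  have hδ0 : 0 < δ := by positivity
  have hδ2 : δ ^ 2 = (n : ℝ)⁻¹ := by rw [hδ, inv_pow, Real.sq_sqrt hn0.le]
  set r : ℝ := (Module.finrank ℝ E : ℝ) with hrdef
  have hr' : 1 ≤ r := by rw [hrdef]; exact_mod_cast hr
  set K := 13 / 2 * r * (a + b) with hK
  have hK0 : 0 ≤ K := by positivity
  set B := ∫ v, ‖v‖ ^ 3 ∂ρ with hB
  have hB3 : (δ * √r) ^ 3 ≤ B := hρ.pow_three_le hδ0.le
  have hB0 : 0 ≤ B := le_trans (by positivity) hB3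
  -- `σ m` is the standard deviation of a sum of `m` Gaussian summands, and `F k` below is the
  -- expectation with `k` original summands and `n - k` Gaussian ones.
  set σ : ℕ → ℝ := fun m => δ * √(m : ℝ) with hσ
  have hσ2 : ∀ m, σ m ^ 2 = m / n := fun m => by
    rw [hσ]; simp only; rw [mul_pow, hδ2, Real.sq_sqrt (Nat.cast_nonneg m)]; ring
  set F : ℕ → ℝ := fun k => ∫ x, h (‖x‖ ^ 2) ∂(convPow ρ k ∗ scaledGaussian E (σ (n - k))) with hF
  have hFn : F n = ∫ x, h (‖x‖ ^ 2) ∂convPow ρ n := by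
    simp [hF, hσ, scaledGaussian_zero]
  have hF0 : F 0 = ∫ x : E, h (‖x‖ ^ 2) ∂stdGaussian E := by
    have : σ n = 1 := by rw [hσ]; simp only; rw [hδ, inv_mul_cancel₀ hsn.ne']
    simp [hF, convPow, this, scaledGaussian_one]
  have hG := isIsotropic_scaledGaussian (E := E) δ
  -- Up to `√n` this is the reciprocal of the smoothing level `σ m`; the value `1` at `m = 0` is a
  -- convention for the unsmoothed step.
  set w : ℕ → ℝ := fun m => if m = 0 then 1 else (√(m : ℝ))⁻¹ with hw
  have hstep : ∀ k, k < n →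
      |F (k + 1) - F k| ≤ K * ((1 + √3) * B * √(n : ℝ)) * w (n - 1 - k) := by
    intro k hk
    set m := n - 1 - k with hm
    have hm1 : n - (k + 1) = m := by omega
    have hm2 : n - k = m + 1 := by omega
    obtain ⟨hμ, hμ2⟩ := hρ.convPow_sq k
    -- The part common to `F (k + 1)` and `F k`: the `k` original and `m = n - 1 - k` Gaussian
    -- summands. The two expectations differ only by one further summand, of law `ρ` or Gaussian.
    set π := convPow ρ k ∗ scaledGaussian E (σ m) with hπ
    have iπ : Integrable (fun x : E => ‖x‖ ^ 2) π :=
      integrable_norm_sq_conv hμ (isIsotropic_scaledGaussian _).integrable_sq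
    have hsum : ∫ x, ‖x‖ ^ 2 ∂convPow ρ k + σ m ^ 2 * r ≤ r := by
      rw [hμ2, hδ2, hσ2, ← hrdef]
      have : (k : ℝ) + m ≤ n := by exact_mod_cast (by omega : k + m ≤ n)
      have e : (k : ℝ) * ((n : ℝ)⁻¹ * r) + m / n * r = ((k + m) / n) * r := by ring
      rw [e]
      have : ((k : ℝ) + m) / n ≤ 1 := (div_le_one hn0).2 this
      nlinarith
    have hπr : ∫ x, ‖x‖ ^ 2 ∂π ≤ r := by
      rw [hπ, (isIsotropic_scaledGaussian _).integral_norm_sq_conv hμ]; exact hsum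
    have e1 : F (k + 1) = ∫ x, h (‖x‖ ^ 2) ∂(π ∗ ρ) := by
      simp only [hF, hm1, convPow, hπ]
      rw [Measure.conv_assoc, Measure.conv_comm ρ, ← Measure.conv_assoc]
    have e2 : F k = ∫ x, h (‖x‖ ^ 2) ∂(π ∗ scaledGaussian E δ) := by
      simp only [hF, hm2, hπ]
      rw [Measure.conv_assoc, scaledGaussian_conv (u := σ (m + 1))]
      rw [hσ2, hσ2, hδ2]; push_cast; ring
    rw [e1, e2, H.integral_conv_eq hh iπ hρ, H.integral_conv_eq hh iπ hG, add_sub_add_left_eq_sub]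
    refine (abs_sub _ _).trans ?_
    have hquad : ∀ v, |∫ y, quadRem h y v ∂π| ≤ K * ‖v‖ ^ 2 := fun v =>
      H.abs_integral_quadRem_le_sq hr iπ hπr v
    have hint : ∀ (ν : Measure E) (g : E → ℝ), Integrable g ν →
        (∀ v, |∫ y, quadRem h y v ∂π| ≤ K * g v) →
        |∫ v, ∫ y, quadRem h y v ∂π ∂ν| ≤ K * ∫ v, g v ∂ν := by
      intro ν g hg hle
      rw [← integral_const_mul, ← Real.norm_eq_abs]
      exact norm_integral_le_of_norm_le (hg.const_mul K) (ae_of_all _ hle)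
    -- Without Gaussian summands only the quadratic bound is available. It contributes `2 δ² r`, and
    -- `δ² r ≤ δ² r √r = (δ √r)³ √n ≤ B √n`, so this single step has the same form as the others.
    rcases Nat.eq_zero_or_pos m with h0 | h0
    · have b1 := hint ρ _ hρ.integrable_sq hquad
      have b2 := hint _ _ hG.integrable_sq hquad
      rw [hρ.integral_norm_sq, ← hrdef] at b1
      rw [hG.integral_norm_sq, ← hrdef] at b2
      have hw1 : w m = 1 := by simp [hw, h0]
      rw [hw1, mul_one]
      have h3 : (1 : ℝ) ≤ √3 := by rw [Real.one_le_sqrt]; norm_num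
      have hrr : 1 ≤ √r := by rw [Real.one_le_sqrt]; exact hr'
      have hsr : √r ^ 2 = r := Real.sq_sqrt (by linarith)
      have h4 : δ ^ 2 * r ≤ B * √(n : ℝ) := by
        calc δ ^ 2 * r ≤ δ ^ 2 * r * √r := le_mul_of_one_le_right (by positivity) hrr
          _ = (δ * √r) ^ 3 * √(n : ℝ) := by
              have : δ * √(n : ℝ) = 1 := by rw [hδ, inv_mul_cancel₀ hsn.ne']
              calc δ ^ 2 * r * √r = δ ^ 2 * √r ^ 2 * √r * 1 := by rw [hsr, mul_one]
                _ = _ := by rw [← this]; ring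
          _ ≤ B * √(n : ℝ) := by gcongr
      have h5 : 0 ≤ B * √(n : ℝ) := by positivity
      calc _ ≤ K * (δ ^ 2 * r) + K * (δ ^ 2 * r) := add_le_add b1 b2
        _ = K * (2 * (δ ^ 2 * r)) := by ring
        _ ≤ K * ((1 + √3) * B * √(n : ℝ)) :=
            mul_le_mul_of_nonneg_left (by nlinarith) hK0
    · have hσm : 0 < σ m := by
        have : 0 < √(m : ℝ) := Real.sqrt_pos.2 (by exact_mod_cast h0)
        simp only [hσ]; positivity
      have hcube : ∀ v, |∫ y, quadRem h y v ∂π| ≤ K * (‖v‖ ^ 3 / σ m) := fun v =>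
        H.abs_integral_quadRem_le_cube hr hσm hμ hsum v
      have b1 := hint ρ _ (hρ.integrable.div_const _) hcube
      have b2 := hint _ _ (hG.integrable.div_const _) hcube
      rw [integral_div, ← hB] at b1
      rw [integral_div] at b2
      have b3 := integral_norm_pow_three_scaledGaussian_le (E := E) hδ0.le
      have hwm : w m = (√(m : ℝ))⁻¹ := by simp [hw, h0.ne']
      have hσinv : (σ m)⁻¹ = √(n : ℝ) * w m := by
        simp only [hσ]; rw [hwm, mul_inv, hδ, inv_inv]
      have b4 : ∫ v : E, ‖v‖ ^ 3 ∂scaledGaussian E δ ≤ √3 * B := b3.trans (by gcongr)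
      calc _ ≤ K * (B / σ m) + K * ((∫ v : E, ‖v‖ ^ 3 ∂scaledGaussian E δ) / σ m) :=
            add_le_add b1 b2
        _ ≤ K * (B / σ m) + K * (√3 * B / σ m) := by gcongr
        _ = K * ((1 + √3) * B * (σ m)⁻¹) := by ring
        _ = _ := by rw [hσinv]; ring
  have htel : F n - F 0 = ∑ k ∈ Finset.range n, (F (k + 1) - F k) := (Finset.sum_range_sub F n).symm
  rw [← hFn, ← hF0, htel]
  have hwsum : ∑ k ∈ Finset.range n, w (n - 1 - k) ≤ 2 * √(n : ℝ) := by
    rw [Finset.sum_range_reflect w n]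
    refine le_trans (le_of_eq ?_) (one_add_sum_inv_sqrt_le n hn)
    rw [Finset.range_eq_Ico, Finset.sum_eq_sum_Ico_succ_bot (by omega)]
    congr 1
    refine Finset.sum_congr rfl fun m hm => ?_
    rw [Finset.mem_Ico] at hm
    simp only [hw]
    rw [if_neg (by omega)]
  calc |∑ k ∈ Finset.range n, (F (k + 1) - F k)|
      ≤ ∑ k ∈ Finset.range n, |F (k + 1) - F k| := Finset.abs_sum_le_sum_abs _ _
    _ ≤ ∑ k ∈ Finset.range n, K * ((1 + √3) * B * √(n : ℝ)) * w (n - 1 - k) :=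
        Finset.sum_le_sum fun k hk => hstep k (Finset.mem_range.1 hk)
    _ = K * ((1 + √3) * B * √(n : ℝ)) * ∑ k ∈ Finset.range n, w (n - 1 - k) := by
        rw [Finset.mul_sum]
    _ ≤ K * ((1 + √3) * B * √(n : ℝ)) * (2 * √(n : ℝ)) := by gcongr
    _ = 2 * K * (1 + √3) * B * (√(n : ℝ) ^ 2) := by ring
    _ = 13 * (1 + √3) * r * (a + b) * (n * B) := by
        rw [Real.sq_sqrt hn0.le, hK]; ring

end Telescope

/-! ### Partial derivatives and Taylor expansion of the log-likelihood -/

section Taylor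

/-- Integrates a bound on the derivative without any continuity of that derivative. Iterating it
gives the Taylor estimates below from a bound on the last derivative alone. -/
theorem norm_sub_le_of_hasDerivAt_pow {f f' : ℝ → ℝ} {c : ℝ} (k : ℕ)
    (hf : ∀ t ∈ Set.Icc (0 : ℝ) 1, HasDerivAt f (f' t) t)
    (hb : ∀ t ∈ Set.Icc (0 : ℝ) 1, |f' t| ≤ c * t ^ k) :
    ∀ t ∈ Set.Icc (0 : ℝ) 1, |f t - f 0| ≤ c / (k + 1) * t ^ (k + 1) := by
  have hk : ((k : ℝ) + 1) ≠ 0 := by positivity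
  have := image_norm_le_of_norm_deriv_right_le_deriv_boundary (f := fun t => f t - f 0)
    (f' := f') (a := 0) (b := 1) (B := fun t => c / (k + 1) * t ^ (k + 1))
    (B' := fun t => c * t ^ k)
    (fun t ht => ((hf t ht).continuousAt.continuousWithinAt).sub continuousWithinAt_const)
    (fun t ht => ((hf t (Set.Ico_subset_Icc_self ht)).sub_const _).hasDerivWithinAt)
    (by simp)
    (fun t => by
      have := (hasDerivAt_pow (k + 1) t).const_mul (c / ((k : ℝ) + 1))
      refine this.congr_deriv ?_
      push_cast
      field_simp)
    (fun t ht => hb t (Set.Ico_subset_Icc_self ht))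
  intro t ht
  exact this ht

theorem taylor_two_le {f f₁ f₂ : ℝ → ℝ} {c : ℝ}
    (h0 : ∀ t ∈ Set.Icc (0 : ℝ) 1, HasDerivAt f (f₁ t) t)
    (h1 : ∀ t ∈ Set.Icc (0 : ℝ) 1, HasDerivAt f₁ (f₂ t) t)
    (hb : ∀ t ∈ Set.Icc (0 : ℝ) 1, |f₂ t| ≤ c) :
    ∀ t ∈ Set.Icc (0 : ℝ) 1, |f t - f 0 - t * f₁ 0| ≤ c / 2 * t ^ 2 := by
  intro t ht
  have a1 := norm_sub_le_of_hasDerivAt_pow 0 h1 (by simpa using hb)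
  have a2 := norm_sub_le_of_hasDerivAt_pow (f := fun t => f t - t * f₁ 0)
    (f' := fun t => f₁ t - f₁ 0) (c := c) 1
    (fun t ht => ((h0 t ht).sub ((hasDerivAt_id t).mul_const (f₁ 0))).congr_deriv (by simp))
    (fun t ht => by simpa using a1 t ht) t ht
  have e : f t - f 0 - t * f₁ 0 = f t - t * f₁ 0 - (f 0 - 0 * f₁ 0) := by ring
  rw [e]
  refine a2.trans_eq ?_
  norm_num

theorem taylor_three_le {f f₁ f₂ f₃ : ℝ → ℝ} {c : ℝ}
    (h0 : ∀ t ∈ Set.Icc (0 : ℝ) 1, HasDerivAt f (f₁ t) t)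
    (h1 : ∀ t ∈ Set.Icc (0 : ℝ) 1, HasDerivAt f₁ (f₂ t) t)
    (h2 : ∀ t ∈ Set.Icc (0 : ℝ) 1, HasDerivAt f₂ (f₃ t) t)
    (hb : ∀ t ∈ Set.Icc (0 : ℝ) 1, |f₃ t| ≤ c) :
    |f 1 - f 0 - f₁ 0 - f₂ 0 / 2| ≤ c / 6 := by
  have a1 := taylor_two_le h1 h2 hb
  have a2 := norm_sub_le_of_hasDerivAt_pow (f := fun t => f t - t * f₁ 0 - t ^ 2 / 2 * f₂ 0)
    (f' := fun t => f₁ t - f₁ 0 - t * f₂ 0) (c := c / 2) 2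
    (fun t ht => by
      have := ((h0 t ht).sub ((hasDerivAt_id t).mul_const (f₁ 0))).sub
        (((hasDerivAt_pow 2 t).div_const 2).mul_const (f₂ 0))
      refine this.congr_deriv ?_
      norm_num)
    a1 1 (by simp)
  have e : f 1 - f 0 - f₁ 0 - f₂ 0 / 2
      = f 1 - 1 * f₁ 0 - 1 ^ 2 / 2 * f₂ 0 - (f 0 - 0 * f₁ 0 - 0 ^ 2 / 2 * f₂ 0) := by ring
  rw [e]
  refine a2.trans_eq ?_
  norm_num
  ring

variable {κ ι : Type*} [Fintype κ] [DecidableEq κ] [Fintype ι]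

theorem contDiffOn_pd {F : (κ → ℝ) → ℝ} {U : Set (κ → ℝ)} {m : WithTop ℕ∞}
    (hU : IsOpen U) (hF : ContDiffOn ℝ (m + 1) F U) (i : κ) : ContDiffOn ℝ m (pd i F) U :=
  (hF.fderiv_of_isOpen hU le_rfl).clm_apply contDiffOn_const

theorem pd_pd_comm {F : (κ → ℝ) → ℝ} {U : Set (κ → ℝ)} (hU : IsOpen U)
    (hF : ContDiffOn ℝ 2 F U) (i j : κ) {θ : κ → ℝ} (hθ : θ ∈ U) :
    pd i (pd j F) θ = pd j (pd i F) θ := by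
  have hc : ContDiffAt ℝ 2 F θ := hF.contDiffAt (hU.mem_nhds hθ)
  have hs := hc.isSymmSndFDerivAt (by simp)
  have hd : DifferentiableAt ℝ (fderiv ℝ F) θ :=
    (hc.fderiv_right (m := 1) (by norm_num)).differentiableAt (by norm_num)
  have h : ∀ i j : κ, pd i (pd j F) θ
      = fderiv ℝ (fderiv ℝ F) θ (Pi.single i 1) (Pi.single j 1) := by
    intro i j
    have : pd j F = fun θ => fderiv ℝ F θ (Pi.single j 1) := rfl
    rw [this, pd, fderiv_clm_apply hd (by fun_prop)]
    simp
  rw [h, h]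
  exact hs _ _

theorem pd_congr {F G : (κ → ℝ) → ℝ} {U : Set (κ → ℝ)} (hU : IsOpen U)
    (h : ∀ θ ∈ U, F θ = G θ) (i : κ) : ∀ θ ∈ U, pd i F θ = pd i G θ := by
  intro θ hθ
  have : F =ᶠ[nhds θ] G := Filter.eventuallyEq_of_mem (hU.mem_nhds hθ) h
  rw [pd, pd, this.fderiv_eq]

/-- The dominating functions are given for a fixed order of differentiation, whereas the Taylor
remainders produce another one; symmetry of second derivatives, applied twice, matches the indices.
-/
theorem pd_pd_pd_rotate {F : (κ → ℝ) → ℝ} {U : Set (κ → ℝ)} (hU : IsOpen U)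
    (hF : ContDiffOn ℝ 3 F U) (i j k : κ) {θ : κ → ℝ} (hθ : θ ∈ U) :
    pd i (pd j (pd k F)) θ = pd k (pd i (pd j F)) θ := by
  have hF2 : ContDiffOn ℝ 2 F U := hF.of_le (by norm_num)
  rw [pd_congr hU (fun θ hθ => pd_pd_comm hU hF2 j k hθ) i θ hθ]
  exact pd_pd_comm hU (contDiffOn_pd hU (by norm_num; exact hF) j) i k hθ

/-- The vector with coordinates `Q j` in the directions `e j`. -/
def direction (e : ι → κ) (Q : ι → ℝ) : κ → ℝ := ∑ j, Q j • Pi.single (e j) (1 : ℝ)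

theorem hasDerivAt_line {F : (κ → ℝ) → ℝ} {θ₀ : κ → ℝ} {e : ι → κ} {Q : ι → ℝ} {t : ℝ}
    (hF : DifferentiableAt ℝ F (θ₀ + t • direction e Q)) :
    HasDerivAt (fun t : ℝ => F (θ₀ + t • direction e Q))
      (∑ j, Q j * pd (e j) F (θ₀ + t • direction e Q)) t := by
  have h1 : HasDerivAt (fun t : ℝ => θ₀ + t • direction e Q) (direction e Q) t := by
    simpa using ((hasDerivAt_id t).smul_const (direction e Q)).const_add θ₀
  have := hF.hasFDerivAt.comp_hasDerivAt t h1
  refine this.congr_deriv ?_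
  rw [direction, map_sum]
  refine Finset.sum_congr rfl fun j _ => ?_
  rw [map_smul, smul_eq_mul]
  rfl

open Matrix

theorem abs_dotProduct_mulVec_le (x y : ι → ℝ) (J : Matrix ι ι ℝ) :
    |x ⬝ᵥ J *ᵥ y| ≤ ∑ l, ∑ m, |J l m| * (|x l| * |y m|) := by
  rw [dotProduct]
  refine (Finset.abs_sum_le_sum_abs _ _).trans (Finset.sum_le_sum fun l _ => ?_)
  rw [mulVec, dotProduct, abs_mul]
  refine (mul_le_mul_of_nonneg_left (Finset.abs_sum_le_sum_abs _ _) (abs_nonneg _)).trans_eq ?_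
  rw [Finset.mul_sum]
  refine Finset.sum_congr rfl fun m _ => ?_
  rw [abs_mul]; ring

/-- The hypothesis on `s` is the expanded likelihood equation: `c` is the sample size, `y = T Q`,
and `ρ/2` is the Taylor remainder of the gradient. The score statistic is thereby expressed through
the estimation error, in a form whose main terms also occur in the likelihood ratio. -/
theorem quadratic_expansion {I J : Matrix ι ι ℝ} [DecidableEq ι] (hJ : J * I = 1) (hJs : J.IsSymm)
    {c : ℝ} (hc : c ≠ 0) (Q s y ρ : ι → ℝ) (h : s = c • I *ᵥ Q - y - (1 / 2 : ℝ) • ρ) :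
    c⁻¹ * (s ⬝ᵥ J *ᵥ s) = c * (Q ⬝ᵥ I *ᵥ Q) - 2 * (Q ⬝ᵥ y) - Q ⬝ᵥ ρ
      + c⁻¹ * (y ⬝ᵥ J *ᵥ y + y ⬝ᵥ J *ᵥ ρ + 1 / 4 * (ρ ⬝ᵥ J *ᵥ ρ)) := by
  have hJI : J *ᵥ (I *ᵥ Q) = Q := by rw [mulVec_mulVec, hJ, one_mulVec]
  have hsym : ∀ u v : ι → ℝ, u ⬝ᵥ J *ᵥ v = v ⬝ᵥ J *ᵥ u := fun u v => by
    rw [dotProduct_mulVec, ← mulVec_transpose, hJs.eq, dotProduct_comm]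
  have hI : ∀ v : ι → ℝ, (I *ᵥ Q) ⬝ᵥ J *ᵥ v = Q ⬝ᵥ v := fun v => by
    rw [hsym, hJI, dotProduct_comm]
  rw [h]
  simp only [mulVec_sub, mulVec_smul, dotProduct_sub, sub_dotProduct, smul_dotProduct,
    dotProduct_smul, hJI, hI, smul_eq_mul, hsym ρ y, dotProduct_comm (I *ᵥ Q) Q,
    dotProduct_comm y Q, dotProduct_comm ρ Q]
  field_simp
  ring

/-- The likelihood ratio at a critical point, compared with the score statistic. -/
theorem abs_likelihood_ratio_sub_le [DecidableEq ι] {F : (κ → ℝ) → ℝ} {U : Set (κ → ℝ)}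
    (hU : IsOpen U) (hF : ContDiffOn ℝ 3 F U) {θ₀ : κ → ℝ} {e : ι → κ} {Q : ι → ℝ}
    (hseg : ∀ t ∈ Set.Icc (0 : ℝ) 1, θ₀ + t • direction e Q ∈ U) {M : ι → ι → ι → ℝ}
    (hM : ∀ t ∈ Set.Icc (0 : ℝ) 1, ∀ j k l,
      |pd (e j) (pd (e k) (pd (e l) F)) (θ₀ + t • direction e Q)| ≤ M j k l)
    (hcrit : ∀ k, pd (e k) F (θ₀ + direction e Q) = 0) {I J : Matrix ι ι ℝ} (hJ : J * I = 1)
    (hJs : J.IsSymm) {c : ℝ} (hc : 0 < c) {T : ι → ι → ℝ}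
    (hT : ∀ l j, T l j = pd (e l) (pd (e j) F) θ₀ + c * I l j) {s : ι → ℝ}
    (hs : ∀ k, s k = pd (e k) F θ₀) :
    |2 * (F (θ₀ + direction e Q) - F θ₀) - c⁻¹ * (s ⬝ᵥ J *ᵥ s)| ≤
      ∑ j, ∑ k, |Q j * Q k| * |T j k|
      + 7 / 3 * ∑ j, ∑ k, ∑ l, |Q j * Q k * Q l| * M j k l
      + c⁻¹ * ∑ l, ∑ m, |J l m| * ∑ j, ∑ k, |T l j| * (|Q j| * |Q k| * |T m k|)
      + c⁻¹ * ∑ q, ∑ k, |J k q| * ∑ j, ∑ l, ∑ s, |Q j * Q l * Q s| * |T k j| * M q s l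
      + c⁻¹ / 4 * ∑ b, ∑ k, ∑ s, ∑ q, ∑ l, ∑ j,
          |J q b| * |Q k * Q s * Q j * Q l| * M b s k * M q j l := by
  have hF2 : ContDiffOn ℝ 2 F U := hF.of_le (by norm_num)
  have c1 : ∀ i, ContDiffOn ℝ 2 (pd i F) U := fun i => contDiffOn_pd hU (by norm_num; exact hF) i
  have c2 : ∀ i j, ContDiffOn ℝ 1 (pd i (pd j F)) U := fun i j =>
    contDiffOn_pd hU (by norm_num; exact c1 j) i
  have dF : ∀ t ∈ Set.Icc (0 : ℝ) 1, DifferentiableAt ℝ F (θ₀ + t • direction e Q) := fun t ht =>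
    (hF.contDiffAt (hU.mem_nhds (hseg t ht))).differentiableAt (by norm_num)
  have dF1 : ∀ i, ∀ t ∈ Set.Icc (0 : ℝ) 1,
      DifferentiableAt ℝ (pd i F) (θ₀ + t • direction e Q) := fun i t ht =>
    ((c1 i).contDiffAt (hU.mem_nhds (hseg t ht))).differentiableAt (by norm_num)
  have dF2 : ∀ i j, ∀ t ∈ Set.Icc (0 : ℝ) 1,
      DifferentiableAt ℝ (pd i (pd j F)) (θ₀ + t • direction e Q) := fun i j t ht =>
    ((c2 i j).contDiffAt (hU.mem_nhds (hseg t ht))).differentiableAt (by norm_num)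
  have hθ₀ : θ₀ ∈ U := by simpa using hseg 0 (by simp)
  have hTs : ∀ j k, pd (e j) (pd (e k) F) θ₀ = T k j - c * I k j := fun j k => by
    rw [pd_pd_comm hU hF2 _ _ hθ₀, hT]; ring
  -- The Hessian at the true parameter is `T - c I`; `y` collects the fluctuating part. The vector
  -- `ρ` is defined so that the expanded likelihood equation holds exactly.
  set y : ι → ℝ := fun k => ∑ j, T k j * Q j with hy
  set ρ : ι → ℝ := fun k => 2 * (c * (I *ᵥ Q) k - y k - s k) with hρ
  have hsum : ∀ k, ∑ j, Q j * pd (e j) (pd (e k) F) θ₀ = y k - c * (I *ᵥ Q) k := by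
    intro k
    simp only [hTs, hy, mulVec, dotProduct, Finset.mul_sum, ← Finset.sum_sub_distrib]
    exact Finset.sum_congr rfl fun j _ => by ring
  -- At the end of the segment the gradient vanishes by `hcrit`, so `ρ k / 2` is the second-order
  -- Taylor remainder of the `k`-th partial derivative.
  have hρb : ∀ k, |ρ k| ≤ ∑ j, ∑ l, |Q j * Q l| * M k j l := by
    intro k
    have := taylor_two_le (f := fun t => pd (e k) F (θ₀ + t • direction e Q))
      (f₁ := fun t => ∑ j, Q j * pd (e j) (pd (e k) F) (θ₀ + t • direction e Q))
      (f₂ := fun t => ∑ j, Q j * ∑ l, Q l *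
        pd (e l) (pd (e j) (pd (e k) F)) (θ₀ + t • direction e Q))
      (c := ∑ j, ∑ l, |Q j * Q l| * M k j l)
      (fun t ht => hasDerivAt_line (dF1 _ t ht))
      (fun t ht => HasDerivAt.fun_sum fun j _ => (hasDerivAt_line (dF2 _ _ t ht)).const_mul _)
      (fun t ht => by
        refine (Finset.abs_sum_le_sum_abs _ _).trans (Finset.sum_le_sum fun j _ => ?_)
        rw [Finset.mul_sum]
        refine (Finset.abs_sum_le_sum_abs _ _).trans (Finset.sum_le_sum fun l _ => ?_)
        rw [← mul_assoc, abs_mul, pd_pd_pd_rotate hU hF _ _ _ (hseg t ht),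
          pd_congr hU (fun θ hθ => pd_pd_comm hU hF2 (e l) (e j) hθ) _ _ (hseg t ht)]
        exact mul_le_mul_of_nonneg_left (hM t ht k j l) (abs_nonneg _)) 1 (by simp)
    simp only [one_smul, zero_smul, add_zero, hcrit, one_mul, hsum, one_pow, mul_one,
      ← hs] at this
    have e1 : ρ k = 2 * (0 - s k - (y k - c * (I *ᵥ Q) k)) := by simp only [hρ]; ring
    rw [e1, abs_mul, abs_two]
    linarith
  have hρb' : ∀ k, |ρ k| ≤ ∑ l, ∑ j, |Q l * Q j| * M k j l := fun k => by
    refine (hρb k).trans_eq ?_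
    rw [Finset.sum_comm]
    exact Finset.sum_congr rfl fun l _ => Finset.sum_congr rfl fun j _ => by rw [mul_comm (Q j)]
  -- The third-order Taylor remainder of `F` itself.
  set E := F (θ₀ + direction e Q) - F θ₀ - ∑ j, Q j * s j
    - (∑ k, Q k * (y k - c * (I *ᵥ Q) k)) / 2 with hE
  have hEb : |E| ≤ (∑ j, ∑ k, ∑ l, |Q j * Q k * Q l| * M j k l) / 6 := by
    have := taylor_three_le (f := fun t => F (θ₀ + t • direction e Q))
      (f₁ := fun t => ∑ k, Q k * pd (e k) F (θ₀ + t • direction e Q))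
      (f₂ := fun t => ∑ k, Q k * ∑ j, Q j * pd (e j) (pd (e k) F) (θ₀ + t • direction e Q))
      (f₃ := fun t => ∑ k, Q k * ∑ j, Q j * ∑ l, Q l *
        pd (e l) (pd (e j) (pd (e k) F)) (θ₀ + t • direction e Q))
      (c := ∑ j, ∑ k, ∑ l, |Q j * Q k * Q l| * M j k l)
      (fun t ht => hasDerivAt_line (dF t ht))
      (fun t ht => HasDerivAt.fun_sum fun j _ => (hasDerivAt_line (dF1 _ t ht)).const_mul _)
      (fun t ht => HasDerivAt.fun_sum fun k _ => (HasDerivAt.fun_sum fun j _ =>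
        (hasDerivAt_line (dF2 _ _ t ht)).const_mul _).const_mul _)
      (fun t ht => by
        refine (Finset.abs_sum_le_sum_abs _ _).trans (Finset.sum_le_sum fun k _ => ?_)
        rw [Finset.mul_sum]
        refine (Finset.abs_sum_le_sum_abs _ _).trans (Finset.sum_le_sum fun j _ => ?_)
        rw [← mul_assoc, Finset.mul_sum]
        refine (Finset.abs_sum_le_sum_abs _ _).trans (Finset.sum_le_sum fun l _ => ?_)
        rw [← mul_assoc, abs_mul, pd_pd_pd_rotate hU hF _ _ _ (hseg t ht),
          pd_congr hU (fun θ hθ => pd_pd_comm hU hF2 (e l) (e j) hθ) _ _ (hseg t ht)]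
        exact mul_le_mul_of_nonneg_left (hM t ht k j l) (abs_nonneg _))
    simp only [one_smul, zero_smul, add_zero, hsum, ← hs] at this
    exact this
  have hM0 : ∀ j k l, 0 ≤ M j k l := fun j k l => (abs_nonneg _).trans (hM 0 (by simp) j k l)
  have hyb : ∀ k, |y k| ≤ ∑ j, |T k j| * |Q j| := fun k =>
    (Finset.abs_sum_le_sum_abs _ _).trans_eq (Finset.sum_congr rfl fun j _ => abs_mul _ _)
  have hsvec : s = c • I *ᵥ Q - y - (1 / 2 : ℝ) • ρ := by
    ext k; simp only [hρ, Pi.sub_apply, Pi.smul_apply, smul_eq_mul]; ring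
  have hquad := quadratic_expansion hJ hJs hc.ne' Q s y ρ hsvec
  have hQs : ∑ j, Q j * s j = c * (Q ⬝ᵥ I *ᵥ Q) - Q ⬝ᵥ y - 1 / 2 * (Q ⬝ᵥ ρ) := by
    change Q ⬝ᵥ s = _
    rw [hsvec]
    simp only [dotProduct_sub, dotProduct_smul, smul_eq_mul]
  have hQy : ∑ k, Q k * (y k - c * (I *ᵥ Q) k) = Q ⬝ᵥ y - c * (Q ⬝ᵥ I *ᵥ Q) := by
    simp only [dotProduct, mul_sub, Finset.sum_sub_distrib, Finset.mul_sum]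
    congr 1
    exact Finset.sum_congr rfl fun j _ => by ring
  -- Both `c Q·IQ` and `Q·ρ` occur in the likelihood ratio and in the score statistic and cancel;
  -- what is left contains only small quantities.
  have hdiff : 2 * (F (θ₀ + direction e Q) - F θ₀) - c⁻¹ * (s ⬝ᵥ J *ᵥ s)
      = Q ⬝ᵥ y + 2 * E - c⁻¹ * (y ⬝ᵥ J *ᵥ y) - c⁻¹ * (y ⬝ᵥ J *ᵥ ρ)
        - c⁻¹ / 4 * (ρ ⬝ᵥ J *ᵥ ρ) := by
    rw [hquad, hE, hQs, hQy]; ring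
  rw [hdiff]
  have hci : 0 ≤ c⁻¹ := by positivity
  have b1 : |Q ⬝ᵥ y| ≤ ∑ j, ∑ k, |Q j * Q k| * |T j k| := by
    refine (Finset.abs_sum_le_sum_abs _ _).trans (Finset.sum_le_sum fun j _ => ?_)
    rw [abs_mul]
    refine (mul_le_mul_of_nonneg_left (hyb j) (abs_nonneg _)).trans_eq ?_
    rw [Finset.mul_sum]
    exact Finset.sum_congr rfl fun k _ => by rw [abs_mul]; ring
  have b2 : |y ⬝ᵥ J *ᵥ y| ≤ ∑ l, ∑ m, |J l m| * ∑ j, ∑ k, |T l j| * (|Q j| * |Q k| * |T m k|) := by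
    refine (abs_dotProduct_mulVec_le _ _ _).trans (Finset.sum_le_sum fun l _ =>
      Finset.sum_le_sum fun m _ => mul_le_mul_of_nonneg_left ?_ (abs_nonneg _))
    refine (mul_le_mul (hyb l) (hyb m) (abs_nonneg _)
      (Finset.sum_nonneg fun _ _ => by positivity)).trans_eq ?_
    rw [Finset.sum_mul_sum]
    exact Finset.sum_congr rfl fun j _ => Finset.sum_congr rfl fun k _ => by ring
  have b3 : |y ⬝ᵥ J *ᵥ ρ| ≤ ∑ q, ∑ k, |J k q| *
      ∑ j, ∑ l, ∑ s, |Q j * Q l * Q s| * |T k j| * M q s l := by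
    refine (abs_dotProduct_mulVec_le _ _ _).trans ?_
    rw [Finset.sum_comm]
    refine Finset.sum_le_sum fun q _ => Finset.sum_le_sum fun k _ =>
      mul_le_mul_of_nonneg_left ?_ (abs_nonneg _)
    refine (mul_le_mul (hyb k) (hρb' q) (abs_nonneg _)
      (Finset.sum_nonneg fun _ _ => by positivity)).trans_eq ?_
    rw [Finset.sum_mul]
    refine Finset.sum_congr rfl fun j _ => ?_
    rw [Finset.mul_sum]
    refine Finset.sum_congr rfl fun x _ => ?_
    rw [Finset.mul_sum]
    exact Finset.sum_congr rfl fun s _ => by simp only [abs_mul]; ring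
  have b4 : |ρ ⬝ᵥ J *ᵥ ρ| ≤ ∑ b, ∑ k, ∑ s, ∑ q, ∑ l, ∑ j,
          |J q b| * |Q k * Q s * Q j * Q l| * M b s k * M q j l := by
    refine (abs_dotProduct_mulVec_le _ _ _).trans ?_
    rw [Finset.sum_comm]
    refine Finset.sum_le_sum fun b _ => ?_
    calc ∑ q, |J q b| * (|ρ q| * |ρ b|) = |ρ b| * ∑ q, |J q b| * |ρ q| := by
          rw [Finset.mul_sum]; exact Finset.sum_congr rfl fun q _ => by ring
      _ ≤ (∑ k, ∑ s, |Q k * Q s| * M b s k)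
          * ∑ q, |J q b| * ∑ l, ∑ j, |Q l * Q j| * M q j l := by
          refine mul_le_mul (hρb' b) (Finset.sum_le_sum fun q _ =>
            mul_le_mul_of_nonneg_left (hρb' q) (abs_nonneg _))
            (Finset.sum_nonneg fun _ _ => by positivity) ?_
          exact Finset.sum_nonneg fun k _ => Finset.sum_nonneg fun s _ =>
            mul_nonneg (abs_nonneg _) (hM0 _ _ _)
      _ = _ := by
          rw [Finset.sum_mul]
          refine Finset.sum_congr rfl fun k _ => ?_
          rw [Finset.sum_mul]
          refine Finset.sum_congr rfl fun s _ => ?_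
          rw [Finset.mul_sum]
          refine Finset.sum_congr rfl fun q _ => ?_
          rw [Finset.mul_sum, Finset.mul_sum]
          refine Finset.sum_congr rfl fun l _ => ?_
          rw [Finset.mul_sum, Finset.mul_sum]
          exact Finset.sum_congr rfl fun j _ => by simp only [abs_mul]; ring
  calc _ ≤ |Q ⬝ᵥ y| + 2 * |E| + c⁻¹ * |y ⬝ᵥ J *ᵥ y| + c⁻¹ * |y ⬝ᵥ J *ᵥ ρ|
        + c⁻¹ / 4 * |ρ ⬝ᵥ J *ᵥ ρ| := by
        refine (abs_sub _ _).trans (add_le_add ((abs_sub _ _).trans (add_le_add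
          ((abs_sub _ _).trans (add_le_add ((abs_add_le _ _).trans ?_) ?_)) ?_)) ?_)
        · rw [abs_mul, abs_two]
        · rw [abs_mul, abs_of_nonneg hci]
        · rw [abs_mul, abs_of_nonneg hci]
        · rw [abs_mul, abs_of_nonneg (by positivity)]
    _ ≤ _ := by
        have hpos : 0 ≤ ∑ j, ∑ k, ∑ l, |Q j * Q k * Q l| * M j k l :=
          Finset.sum_nonneg fun j _ => Finset.sum_nonneg fun k _ => Finset.sum_nonneg fun l _ =>
            mul_nonneg (abs_nonneg _) (hM0 _ _ _)
        -- Already `1/3` would do here, because the term `Q·ρ` has cancelled.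
        have hE3 : 2 * |E| ≤ 7 / 3 * ∑ j, ∑ k, ∑ l, |Q j * Q k * Q l| * M j k l := by linarith
        gcongr

end Taylor

/-! ### Hölder bounds for the terms of the expansion -/

section Holder

variable {α : Type*} [MeasurableSpace α]

theorem lintegral_mul_le_sqrt {μ : Measure α} {f g : α → ℝ≥0∞} (hf : AEMeasurable f μ)
    (hg : AEMeasurable g μ) :
    ∫⁻ a, f a * g a ∂μ
      ≤ (∫⁻ a, f a ^ 2 ∂μ) ^ (1 / 2 : ℝ) * (∫⁻ a, g a ^ 2 ∂μ) ^ (1 / 2 : ℝ) := by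
  have h := ENNReal.lintegral_mul_norm_pow_le (μ := μ) (f := fun a => f a ^ 2)
    (g := fun a => g a ^ 2) (p := 1 / 2) (q := 1 / 2) (by fun_prop) (by fun_prop) (by norm_num)
    (by norm_num) (by norm_num)
  refine le_trans (le_of_eq ?_) h
  refine lintegral_congr fun a => ?_
  simp only [← ENNReal.rpow_natCast, ← ENNReal.rpow_mul]
  norm_num

theorem lintegral_mul_mul_le {μ : Measure α} {f g k : α → ℝ≥0∞} (hf : AEMeasurable f μ)
    (hg : AEMeasurable g μ) (hk : AEMeasurable k μ) :
    ∫⁻ a, f a * g a * k a ∂μ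
      ≤ (∫⁻ a, f a ^ 2 ∂μ) ^ (1 / 2 : ℝ) * (∫⁻ a, g a ^ 4 ∂μ) ^ (1 / 4 : ℝ)
        * (∫⁻ a, k a ^ 4 ∂μ) ^ (1 / 4 : ℝ) := by
  have h := ENNReal.lintegral_mul_prod_norm_pow_le (μ := μ) (Finset.univ : Finset (Fin 2))
    (g := fun a => f a ^ 2) (f := ![fun a => g a ^ 4, fun a => k a ^ 4]) (q := 1 / 2)
    (p := ![1 / 4, 1 / 4]) (by fun_prop)
    (by intro i _; fin_cases i <;> simp <;> fun_prop) (by simp; norm_num) (by norm_num)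
    (by intro i _; fin_cases i <;> simp)
  simp only [Fin.prod_univ_two, Matrix.cons_val_zero, Matrix.cons_val_one] at h
  rw [mul_assoc]
  refine le_trans (le_of_eq ?_) h
  refine lintegral_congr fun a => ?_
  simp only [← ENNReal.rpow_natCast, ← ENNReal.rpow_mul]
  norm_num
  rw [mul_assoc]

theorem lintegral_mul_mul_mul_le {μ : Measure α} {f g k l : α → ℝ≥0∞} (hf : AEMeasurable f μ)
    (hg : AEMeasurable g μ) (hk : AEMeasurable k μ) (hl : AEMeasurable l μ) :
    ∫⁻ a, f a * (g a * k a * l a) ∂μ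
      ≤ (∫⁻ a, f a ^ 2 ∂μ) ^ (1 / 2 : ℝ) * ((∫⁻ a, g a ^ 6 ∂μ) * (∫⁻ a, k a ^ 6 ∂μ)
        * (∫⁻ a, l a ^ 6 ∂μ)) ^ (1 / 6 : ℝ) := by
  have h := ENNReal.lintegral_mul_prod_norm_pow_le (μ := μ) (Finset.univ : Finset (Fin 3))
    (g := fun a => f a ^ 2) (f := ![fun a => g a ^ 6, fun a => k a ^ 6, fun a => l a ^ 6])
    (q := 1 / 2) (p := ![1 / 6, 1 / 6, 1 / 6]) (by fun_prop)
    (by intro i _; fin_cases i <;> simp <;> fun_prop) (by simp [Fin.sum_univ_three]; norm_num)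
    (by norm_num) (by intro i _; fin_cases i <;> simp)
  simp only [Fin.prod_univ_three, Matrix.cons_val_zero, Matrix.cons_val_one,
    Matrix.cons_val_two, Matrix.tail_cons, Matrix.head_cons] at h
  rw [ENNReal.mul_rpow_of_nonneg _ _ (by norm_num), ENNReal.mul_rpow_of_nonneg _ _ (by norm_num)]
  refine le_trans (le_of_eq ?_) h
  refine lintegral_congr fun a => ?_
  simp only [← ENNReal.rpow_natCast, ← ENNReal.rpow_mul]
  norm_num

/-- Valid also for a null event, where the conditional measure is `0` and both sides vanish. -/
theorem measure_smul_cond (P : Measure α) [IsFiniteMeasure P] (A : Set α) :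
    P A • P[|A] = P.restrict A := by
  rcases eq_or_ne (P A) 0 with h | h
  · rw [h, zero_smul, Measure.restrict_eq_zero.2 h]
  · rw [ProbabilityTheory.cond, smul_smul, ENNReal.mul_inv_cancel h (measure_ne_top _ _), one_smul]

/-- Since `P A ≤ (P A)^{1/2}`, the probability of the event can be spent entirely on one conditional
factor of exponent `1/2`, making it unconditional. This is why the `Q` moments in `K₂` carry no
conditioning while those of `T` and `M` do. -/
theorem mul_rpow_lintegral_cond_le (P : Measure α) [IsProbabilityMeasure P] (A : Set α)
    (f : α → ℝ≥0∞) :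
    P A * (∫⁻ a, f a ∂P[|A]) ^ (1 / 2 : ℝ) ≤ (∫⁻ a, f a ∂P) ^ (1 / 2 : ℝ) := by
  have h1 : P A ≤ (P A) ^ (1 / 2 : ℝ) := by
    conv_lhs => rw [← ENNReal.rpow_one (P A)]
    exact ENNReal.rpow_le_rpow_of_exponent_ge prob_le_one (by norm_num)
  calc P A * (∫⁻ a, f a ∂P[|A]) ^ (1 / 2 : ℝ)
      ≤ (P A) ^ (1 / 2 : ℝ) * (∫⁻ a, f a ∂P[|A]) ^ (1 / 2 : ℝ) := by gcongr
    _ = (∫⁻ a, f a ∂P.restrict A) ^ (1 / 2 : ℝ) := by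
        rw [← ENNReal.mul_rpow_of_nonneg _ _ (by norm_num), ← measure_smul_cond,
          lintegral_smul_measure, smul_eq_mul]
    _ ≤ _ := by gcongr; exact Measure.restrict_le_self

theorem setLIntegral_mul_le_cond (P : Measure α) [IsProbabilityMeasure P] (A : Set α)
    {f g : α → ℝ≥0∞} (hf : AEMeasurable f P) (hg : AEMeasurable g P) :
    ∫⁻ a in A, f a * g a ∂P
      ≤ (∫⁻ a, f a ^ 2 ∂P) ^ (1 / 2 : ℝ) * (∫⁻ a, g a ^ 2 ∂P[|A]) ^ (1 / 2 : ℝ) := by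
  have hac : P[|A] ≪ P := cond_absolutelyContinuous
  rw [← measure_smul_cond, lintegral_smul_measure, smul_eq_mul]
  refine (mul_le_mul_right (lintegral_mul_le_sqrt (hf.mono_ac hac) (hg.mono_ac hac)) _).trans ?_
  rw [← mul_assoc]
  gcongr
  exact mul_rpow_lintegral_cond_le P A _

theorem setLIntegral_mul_mul_le_cond (P : Measure α) [IsProbabilityMeasure P] (A : Set α)
    {f g k : α → ℝ≥0∞} (hf : AEMeasurable f P) (hg : AEMeasurable g P) (hk : AEMeasurable k P) :
    ∫⁻ a in A, f a * g a * k a ∂P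
      ≤ (∫⁻ a, f a ^ 2 ∂P) ^ (1 / 2 : ℝ) * (∫⁻ a, g a ^ 4 ∂P[|A]) ^ (1 / 4 : ℝ)
        * (∫⁻ a, k a ^ 4 ∂P[|A]) ^ (1 / 4 : ℝ) := by
  have hac : P[|A] ≪ P := cond_absolutelyContinuous
  rw [← measure_smul_cond, lintegral_smul_measure, smul_eq_mul]
  refine (mul_le_mul_right (lintegral_mul_mul_le (hf.mono_ac hac) (hg.mono_ac hac)
    (hk.mono_ac hac)) _).trans ?_
  rw [← mul_assoc, ← mul_assoc]
  gcongr
  exact mul_rpow_lintegral_cond_le P A _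

theorem ofReal_pow_of_even (x : ℝ) {k : ℕ} (hk : Even k) : ENNReal.ofReal (x ^ k) = ‖x‖ₑ ^ k := by
  rw [Real.enorm_eq_ofReal_abs, ← ENNReal.ofReal_pow (abs_nonneg _), hk.pow_abs]

end Holder

/-! ### The integrated error of the quadratic approximation -/

namespace ErrData

variable {ι Ω : Type*} [Fintype ι] [MeasurableSpace Ω] {E : ErrData ι Ω} {P : Measure Ω}

/-- Pointwise bound for the error of the quadratic approximation to the log-likelihood ratio. -/
noncomputable def errBound (E : ErrData ι Ω) (n : ℕ) (ω : Ω) : ℝ :=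
  ∑ j, ∑ k, |E.Q j ω * E.Q k ω| * |E.T j k ω|
  + 7 / 3 * ∑ j, ∑ k, ∑ l, |E.Q j ω * E.Q k ω * E.Q l ω| * E.M j k l ω
  + (n : ℝ)⁻¹ * ∑ l, ∑ m, |E.J l m| * ∑ j, ∑ k,
      |E.T l j ω| * (|E.Q j ω| * |E.Q k ω| * |E.T m k ω|)
  + (n : ℝ)⁻¹ * ∑ q, ∑ k, |E.J k q| * ∑ j, ∑ l, ∑ s,
      |E.Q j ω * E.Q l ω * E.Q s ω| * |E.T k j ω| * E.M q s l ω
  + (n : ℝ)⁻¹ / 4 * ∑ b, ∑ k, ∑ s, ∑ q, ∑ l, ∑ j,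
      |E.J q b| * |E.Q k ω * E.Q s ω * E.Q j ω * E.Q l ω| * E.M b s k ω * E.M q j l ω

/-- The same bound in `[0, ∞]`, with absolute values of the dominating functions. -/
noncomputable def eErrBound (E : ErrData ι Ω) (n : ℕ) (ω : Ω) : ℝ≥0∞ :=
  ∑ j, ∑ k, ‖E.Q j ω * E.Q k ω‖ₑ * ‖E.T j k ω‖ₑ
  + ENNReal.ofReal (7 / 3) * ∑ j, ∑ k, ∑ l,
      ‖E.Q j ω * E.Q k ω * E.Q l ω‖ₑ * ‖E.M j k l ω‖ₑ
  + ENNReal.ofReal (n : ℝ)⁻¹ * ∑ l, ∑ m, ENNReal.ofReal |E.J l m| * ∑ j, ∑ k,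
      ‖E.T l j ω‖ₑ * (‖E.Q j ω‖ₑ * ‖E.Q k ω‖ₑ * ‖E.T m k ω‖ₑ)
  + ENNReal.ofReal (n : ℝ)⁻¹ * ∑ q, ∑ k, ENNReal.ofReal |E.J k q| * ∑ j, ∑ l, ∑ s,
      ‖E.Q j ω * E.Q l ω * E.Q s ω‖ₑ * ‖E.T k j ω‖ₑ * ‖E.M q s l ω‖ₑ
  + ENNReal.ofReal ((n : ℝ)⁻¹ / 4) * ∑ b, ∑ k, ∑ s, ∑ q, ∑ l, ∑ j,
      ENNReal.ofReal |E.J q b| * (‖E.Q k ω * E.Q s ω * E.Q j ω * E.Q l ω‖ₑ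
        * ‖E.M b s k ω‖ₑ * ‖E.M q j l ω‖ₑ)

theorem ofReal_errBound_le (E : ErrData ι Ω) (n : ℕ) (ω : Ω) :
    ENNReal.ofReal (E.errBound n ω) ≤ E.eErrBound n ω := by
  have hn : (0 : ℝ) ≤ (n : ℝ)⁻¹ := by positivity
  have hsum : ∀ {β : Type _} [Fintype β] (f : β → ℝ) (g : β → ℝ≥0∞),
      (∀ b, ENNReal.ofReal (f b) ≤ g b) → ENNReal.ofReal (∑ b, f b) ≤ ∑ b, g b := by
    intro β _ f g h
    exact (Finset.le_sum_of_subadditive ENNReal.ofReal ENNReal.ofReal_zero.le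
      (fun x y => ENNReal.ofReal_add_le) Finset.univ f).trans (Finset.sum_le_sum fun b _ => h b)
  have hM : ∀ x : ℝ, ENNReal.ofReal x ≤ ‖x‖ₑ := fun x => by
    rw [Real.enorm_eq_ofReal_abs]; exact ENNReal.ofReal_le_ofReal (le_abs_self x)
  have hA : ∀ x : ℝ, ENNReal.ofReal |x| = ‖x‖ₑ := fun x => (Real.enorm_eq_ofReal_abs x).symm
  unfold errBound eErrBound
  refine ENNReal.ofReal_add_le.trans (add_le_add (ENNReal.ofReal_add_le.trans (add_le_add
    (ENNReal.ofReal_add_le.trans (add_le_add (ENNReal.ofReal_add_le.trans (add_le_add ?_ ?_)) ?_))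
    ?_)) ?_)
  · refine hsum _ _ fun j => hsum _ _ fun k => ?_
    rw [ENNReal.ofReal_mul (abs_nonneg _), hA, hA]
  · rw [ENNReal.ofReal_mul (by norm_num)]
    gcongr
    refine hsum _ _ fun j => hsum _ _ fun k => hsum _ _ fun l => ?_
    rw [ENNReal.ofReal_mul (abs_nonneg _), hA]
    gcongr
    exact hM _
  · rw [ENNReal.ofReal_mul hn]
    gcongr
    refine hsum _ _ fun l => hsum _ _ fun m => ?_
    rw [ENNReal.ofReal_mul (abs_nonneg _)]
    gcongr
    refine hsum _ _ fun j => hsum _ _ fun k => ?_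
    rw [ENNReal.ofReal_mul (abs_nonneg _), ENNReal.ofReal_mul (by positivity),
      ENNReal.ofReal_mul (by positivity), hA, hA, hA, hA]
  · rw [ENNReal.ofReal_mul hn]
    gcongr
    refine hsum _ _ fun q => hsum _ _ fun k => ?_
    rw [ENNReal.ofReal_mul (abs_nonneg _)]
    gcongr
    refine hsum _ _ fun j => hsum _ _ fun l => hsum _ _ fun s => ?_
    rw [ENNReal.ofReal_mul (by positivity), ENNReal.ofReal_mul (by positivity), hA, hA]
    gcongr
    exact hM _
  · rw [ENNReal.ofReal_mul (by positivity)]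
    gcongr
    refine hsum _ _ fun b => hsum _ _ fun k => hsum _ _ fun s => hsum _ _ fun q =>
      hsum _ _ fun l => hsum _ _ fun j => ?_
    refine (hM _).trans_eq ?_
    rw [enorm_mul, enorm_mul, enorm_mul, ← hA |_|, ← hA |_|, abs_abs, abs_abs, hA (_ * _)]
    ring

/-- Terms free of `M` are integrated over the whole space; those with `M` stay on the event and
receive conditional moments. The Hölder exponents are `(1/2, 1/2)`, `(1/2, 1/4, 1/4)` or `(1/2, 1/6,
1/6, 1/6)`, and one second moment of `T` is replaced by `n V`, which supplies the factor `√n`. -/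
theorem lintegral_eErrBound_le [IsProbabilityMeasure P] {n : ℕ} (hn : 1 ≤ n)
    (hQ : ∀ j, Measurable (E.Q j)) (hT : ∀ l j, AEMeasurable (E.T l j) P)
    (hM : ∀ j k l, AEMeasurable (E.M j k l) P)
    (hV : ∀ l j, mean P (fun ω => E.T l j ω ^ 2) ≤ n * E.V l j) (A : Set Ω) :
    ∫⁻ ω in A, E.eErrBound n ω ∂P ≤
      ENNReal.ofReal √n * ∑ j, ∑ k,
        mean P (fun ω => E.Q j ω ^ 2 * E.Q k ω ^ 2) ^ (1 / 2 : ℝ) * E.V j k ^ (1 / 2 : ℝ)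
      + ENNReal.ofReal (7 / 3) * ∑ j, ∑ k, ∑ l,
        mean P (fun ω => E.Q j ω ^ 2 * E.Q k ω ^ 2 * E.Q l ω ^ 2) ^ (1 / 2 : ℝ) *
          mean P[|A] (fun ω => E.M j k l ω ^ 2) ^ (1 / 2 : ℝ)
      + ENNReal.ofReal (√n)⁻¹ * ∑ l, ∑ m, ENNReal.ofReal |E.J l m| * ∑ j, ∑ k,
        E.V l j ^ (1 / 2 : ℝ) *
          (mean P (fun ω => E.Q j ω ^ 6) * mean P (fun ω => E.Q k ω ^ 6)
            * mean P (fun ω => E.T m k ω ^ 6)) ^ (1 / 6 : ℝ)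
      + ENNReal.ofReal (n : ℝ)⁻¹ * ∑ q, ∑ k, ENNReal.ofReal |E.J k q| * ∑ j, ∑ l, ∑ s,
          mean P (fun ω => E.Q j ω ^ 2 * E.Q l ω ^ 2 * E.Q s ω ^ 2) ^ (1 / 2 : ℝ) *
            mean P[|A] (fun ω => E.T k j ω ^ 4) ^ (1 / 4 : ℝ) *
            mean P[|A] (fun ω => E.M q s l ω ^ 4) ^ (1 / 4 : ℝ)
      + ENNReal.ofReal ((n : ℝ)⁻¹ / 4) * ∑ b, ∑ k, ∑ s, ∑ q, ∑ l, ∑ j,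
          ENNReal.ofReal |E.J q b| *
            mean P (fun ω => E.Q k ω ^ 2 * E.Q s ω ^ 2 * E.Q j ω ^ 2 * E.Q l ω ^ 2) ^ (1 / 2 : ℝ) *
            mean P[|A] (fun ω => E.M b s k ω ^ 4) ^ (1 / 4 : ℝ) *
            mean P[|A] (fun ω => E.M q j l ω ^ 4) ^ (1 / 4 : ℝ) := by
  have hT' : ∀ l j, AEMeasurable (E.T l j) (P.restrict A) := fun l j => (hT l j).restrict
  have hM' : ∀ j k l, AEMeasurable (E.M j k l) (P.restrict A) := fun j k l => (hM j k l).restrict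
  have hn0 : (0 : ℝ) < n := by exact_mod_cast hn
  have hsn : 0 < √(n : ℝ) := Real.sqrt_pos.2 hn0
  have hpow : ∀ (x : Ω → ℝ) (μ : Measure Ω) (k : ℕ), Even k →
      mean μ (fun ω => x ω ^ k) = ∫⁻ ω, ‖x ω‖ₑ ^ k ∂μ := fun x μ k hk =>
    lintegral_congr fun ω => ofReal_pow_of_even _ hk
  have hsn2 : (n : ℝ≥0∞) ^ (1 / 2 : ℝ) = ENNReal.ofReal √n := by
    rw [Real.sqrt_eq_rpow, ← ENNReal.ofReal_rpow_of_pos hn0, ENNReal.ofReal_natCast]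
  have hVT : ∀ l j, (∫⁻ ω, ‖E.T l j ω‖ₑ ^ 2 ∂P) ^ (1 / 2 : ℝ)
      ≤ ENNReal.ofReal √n * E.V l j ^ (1 / 2 : ℝ) := by
    intro l j
    rw [← hpow _ _ _ even_two, ← hsn2, ← ENNReal.mul_rpow_of_nonneg _ _ (by norm_num)]
    exact ENNReal.rpow_le_rpow (hV l j) (by norm_num)
  have hQ2 : ∀ j k, ∫⁻ ω, ‖E.Q j ω * E.Q k ω‖ₑ ^ 2 ∂P
      = mean P (fun ω => E.Q j ω ^ 2 * E.Q k ω ^ 2) := by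
    intro j k
    rw [← hpow _ _ _ even_two]
    simp only [mul_pow]
  have hQ3 : ∀ j k l, ∫⁻ ω, ‖E.Q j ω * E.Q k ω * E.Q l ω‖ₑ ^ 2 ∂P
      = mean P (fun ω => E.Q j ω ^ 2 * E.Q k ω ^ 2 * E.Q l ω ^ 2) := by
    intro j k l
    rw [← hpow _ _ _ even_two]
    simp only [mul_pow]
  have hQ4 : ∀ j k l m, ∫⁻ ω, ‖E.Q j ω * E.Q k ω * E.Q l ω * E.Q m ω‖ₑ ^ 2 ∂P
      = mean P (fun ω => E.Q j ω ^ 2 * E.Q k ω ^ 2 * E.Q l ω ^ 2 * E.Q m ω ^ 2) := by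
    intro j k l m
    rw [← hpow _ _ _ even_two]
    simp only [mul_pow]
  have h6 : Even 6 := by decide
  have h4 : Even 4 := by decide
  unfold eErrBound
  rw [lintegral_add_left' (by fun_prop), lintegral_add_left' (by fun_prop),
    lintegral_add_left' (by fun_prop), lintegral_add_left' (by fun_prop)]
  refine add_le_add (add_le_add (add_le_add (add_le_add ?_ ?_) ?_) ?_) ?_
  · rw [lintegral_finsetSum' _ (by fun_prop), Finset.mul_sum]
    refine Finset.sum_le_sum fun j _ => ?_
    rw [lintegral_finsetSum' _ (by fun_prop), Finset.mul_sum]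
    refine Finset.sum_le_sum fun k _ => ?_
    refine (setLIntegral_le_lintegral _ _).trans ?_
    refine (lintegral_mul_le_sqrt (by fun_prop) (by fun_prop)).trans ?_
    rw [hQ2, mul_left_comm]
    gcongr
    exact hVT j k
  · rw [lintegral_const_mul'' _ (by fun_prop)]
    gcongr
    rw [lintegral_finsetSum' _ (by fun_prop)]
    refine Finset.sum_le_sum fun j _ => ?_
    rw [lintegral_finsetSum' _ (by fun_prop)]
    refine Finset.sum_le_sum fun k _ => ?_
    rw [lintegral_finsetSum' _ (by fun_prop)]
    refine Finset.sum_le_sum fun l _ => ?_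
    refine (setLIntegral_mul_le_cond P A (by fun_prop) (by fun_prop)).trans_eq ?_
    rw [hQ3, hpow _ _ _ even_two]
  · rw [lintegral_const_mul'' _ (by fun_prop), Finset.mul_sum]
    have hnn : ENNReal.ofReal (n : ℝ)⁻¹ * ENNReal.ofReal √n = ENNReal.ofReal (√n)⁻¹ := by
      rw [← ENNReal.ofReal_mul (by positivity)]
      congr 1
      rw [← Real.sq_sqrt hn0.le]
      field_simp
      rw [Real.sqrt_sq hsn.le]
    rw [lintegral_finsetSum' _ (by fun_prop), Finset.mul_sum]
    refine Finset.sum_le_sum fun l _ => ?_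
    rw [lintegral_finsetSum' _ (by fun_prop), Finset.mul_sum, Finset.mul_sum]
    refine Finset.sum_le_sum fun m _ => ?_
    rw [lintegral_const_mul'' _ (by fun_prop), mul_left_comm,
      mul_left_comm (ENNReal.ofReal (√n)⁻¹)]
    refine mul_le_mul_right ?_ _
    rw [lintegral_finsetSum' _ (by fun_prop), Finset.mul_sum, Finset.mul_sum]
    refine Finset.sum_le_sum fun j _ => ?_
    rw [lintegral_finsetSum' _ (by fun_prop), Finset.mul_sum, Finset.mul_sum]
    refine Finset.sum_le_sum fun k _ => ?_
    rw [← hnn, mul_assoc]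
    refine mul_le_mul_right ?_ _
    refine (setLIntegral_le_lintegral _ _).trans ?_
    refine (lintegral_mul_mul_mul_le (by fun_prop) (by fun_prop) (by fun_prop)
      (by fun_prop)).trans ?_
    rw [hpow _ _ _ h6, hpow _ _ _ h6, hpow _ _ _ h6, ← mul_assoc]
    gcongr
    exact hVT l j
  · rw [lintegral_const_mul'' _ (by fun_prop)]
    gcongr
    rw [lintegral_finsetSum' _ (by fun_prop)]
    refine Finset.sum_le_sum fun q _ => ?_
    rw [lintegral_finsetSum' _ (by fun_prop)]
    refine Finset.sum_le_sum fun k _ => ?_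
    rw [lintegral_const_mul'' _ (by fun_prop)]
    gcongr
    rw [lintegral_finsetSum' _ (by fun_prop)]
    refine Finset.sum_le_sum fun j _ => ?_
    rw [lintegral_finsetSum' _ (by fun_prop)]
    refine Finset.sum_le_sum fun l _ => ?_
    rw [lintegral_finsetSum' _ (by fun_prop)]
    refine Finset.sum_le_sum fun s _ => ?_
    refine (setLIntegral_mul_mul_le_cond P A (by fun_prop) (by fun_prop) (by fun_prop)).trans_eq ?_
    rw [hQ3, hpow _ _ _ h4, hpow _ _ _ h4]
  · rw [lintegral_const_mul'' _ (by fun_prop)]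
    gcongr
    rw [lintegral_finsetSum' _ (by fun_prop)]
    refine Finset.sum_le_sum fun b _ => ?_
    rw [lintegral_finsetSum' _ (by fun_prop)]
    refine Finset.sum_le_sum fun k _ => ?_
    rw [lintegral_finsetSum' _ (by fun_prop)]
    refine Finset.sum_le_sum fun s _ => ?_
    rw [lintegral_finsetSum' _ (by fun_prop)]
    refine Finset.sum_le_sum fun q _ => ?_
    rw [lintegral_finsetSum' _ (by fun_prop)]
    refine Finset.sum_le_sum fun l _ => ?_
    rw [lintegral_finsetSum' _ (by fun_prop)]
    refine Finset.sum_le_sum fun j _ => ?_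
    rw [lintegral_const_mul'' _ (by fun_prop)]
    refine (mul_le_mul_right (setLIntegral_mul_mul_le_cond P A (by fun_prop) (by fun_prop)
      (by fun_prop)) _).trans_eq ?_
    rw [hQ4, hpow _ _ _ h4, hpow _ _ _ h4]
    ring

/-- Markov's inequality: off the event a single `Q_j²`, hence the whole sum, is at least `ε²`. -/
theorem measure_compl_near_le {ε : ℝ} (hε : 0 < ε) (hQ : ∀ j, Measurable (E.Q j)) :
    P (E.near ε)ᶜ ≤ ENNReal.ofReal (1 / ε ^ 2) * mean P (fun ω => ∑ j, E.Q j ω ^ 2) := by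
  have hm : MeasurableSet (E.near ε)ᶜ := by
    refine MeasurableSet.compl ?_
    simp only [near, Set.ofPred_forall]
    exact MeasurableSet.iInter fun j => measurableSet_lt (hQ j).abs measurable_const
  rw [mean, ← lintegral_const_mul' _ _ ENNReal.ofReal_ne_top, ← lintegral_indicator_one hm]
  refine lintegral_mono fun ω => ?_
  by_cases hω : ω ∈ (E.near ε)ᶜ
  · rw [Set.indicator_of_mem hω, Pi.one_apply, ← ENNReal.ofReal_one,
      ← ENNReal.ofReal_mul (by positivity)]
    refine ENNReal.ofReal_le_ofReal ?_
    simp only [near, Set.mem_compl_iff, Set.mem_ofPred_eq, not_forall, not_lt] at hω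
    obtain ⟨j, hj⟩ := hω
    rw [one_div_mul_eq_div, one_le_div (by positivity)]
    refine le_trans ?_ (Finset.single_le_sum (f := fun j => E.Q j ω ^ 2)
      (fun i _ => sq_nonneg _) (Finset.mem_univ j))
    rw [← sq_abs (E.Q j ω)]
    gcongr
  · rw [Set.indicator_of_notMem hω]
    exact bot_le

/-- The expectation is split along the event. Inside, the pointwise error bound is integrated;
outside, `D` is bounded by `2 ‖h‖` and the probability by Markov's inequality. -/
theorem lintegral_abs_le_of_errBound [IsProbabilityMeasure P] {n : ℕ} (hn : 1 ≤ n)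
    (hQ : ∀ j, Measurable (E.Q j)) (hT : ∀ l j, AEMeasurable (E.T l j) P)
    (hM : ∀ j k l, AEMeasurable (E.M j k l) P)
    (hV : ∀ l j, mean P (fun ω => E.T l j ω ^ 2) ≤ n * E.V l j) {h : ℝ → ℝ} {ε : ℝ}
    (hε : 0 < ε) (h0 : 0 ≤ supNorm h) (h1 : 0 ≤ supNorm (deriv h)) {D : Ω → ℝ}
    (hD : ∀ ω, |D ω| ≤ 2 * supNorm h)
    (hnear : ∀ᵐ ω ∂P, ω ∈ E.near ε → |D ω| ≤ supNorm (deriv h) * E.errBound n ω) :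
    ∫⁻ ω, ENNReal.ofReal |D ω| ∂P ≤ ENNReal.ofReal (1 / √n) *
      (ENNReal.ofReal (supNorm (deriv h)) * E.K1 P n + E.K2 P n h ε) := by
  have hn0 : (0 : ℝ) < n := by exact_mod_cast hn
  have hsn : 0 < √(n : ℝ) := Real.sqrt_pos.2 hn0
  have hss : √(n : ℝ) * √(n : ℝ) = n := Real.mul_self_sqrt hn0.le
  have hm : MeasurableSet (E.near ε) := by
    simp only [near, Set.ofPred_forall]
    exact MeasurableSet.iInter fun j => measurableSet_lt (hQ j).abs measurable_const
  have hin : ∫⁻ ω in E.near ε, ENNReal.ofReal |D ω| ∂P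
      ≤ ENNReal.ofReal (supNorm (deriv h)) * ∫⁻ ω in E.near ε, E.eErrBound n ω ∂P := by
    rw [← lintegral_const_mul' _ _ ENNReal.ofReal_ne_top]
    refine lintegral_mono_ae ?_
    filter_upwards [(ae_restrict_iff' hm).2 hnear] with ω hω
    refine (ENNReal.ofReal_le_ofReal hω).trans ?_
    rw [ENNReal.ofReal_mul h1]
    gcongr
    exact E.ofReal_errBound_le n ω
  have hout : ∫⁻ ω in (E.near ε)ᶜ, ENNReal.ofReal |D ω| ∂P
      ≤ ENNReal.ofReal (1 / √n) * (ENNReal.ofReal (2 * √n * supNorm h / ε ^ 2)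
        * mean P (fun ω => ∑ j, E.Q j ω ^ 2)) := by
    calc ∫⁻ ω in (E.near ε)ᶜ, ENNReal.ofReal |D ω| ∂P
        ≤ ∫⁻ _ in (E.near ε)ᶜ, ENNReal.ofReal (2 * supNorm h) ∂P :=
          lintegral_mono fun ω => ENNReal.ofReal_le_ofReal (hD ω)
      _ = ENNReal.ofReal (2 * supNorm h) * P (E.near ε)ᶜ := by
          rw [lintegral_const, Measure.restrict_apply_univ]
      _ ≤ ENNReal.ofReal (2 * supNorm h) * (ENNReal.ofReal (1 / ε ^ 2)
            * mean P (fun ω => ∑ j, E.Q j ω ^ 2)) := by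
          gcongr; exact measure_compl_near_le hε hQ
      _ = _ := by
          rw [← mul_assoc, ← mul_assoc, ← ENNReal.ofReal_mul (by positivity),
            ← ENNReal.ofReal_mul (by positivity)]
          congr 2
          field_simp
  have hinv : (n : ℝ)⁻¹ = (√n)⁻¹ * (√n)⁻¹ := by rw [← mul_inv, hss]
  rw [← lintegral_add_compl _ hm, K1, K2]
  refine (add_le_add (hin.trans (mul_le_mul_right
    (lintegral_eErrBound_le hn hQ hT hM hV _) _)) hout).trans ?_
  simp only [mul_add, ← mul_assoc]
  simp only [← ENNReal.ofReal_mul h1, ← ENNReal.ofReal_mul (show 0 ≤ 1 / √(n : ℝ) by positivity)]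
  -- The argument yields the coefficient `√n`; the leading factor `3n` of `K₁`, divided by `√n`,
  -- leaves room by a factor `3`.
  have e1 : ENNReal.ofReal (supNorm (deriv h) * √n)
      ≤ ENNReal.ofReal (1 / √n * supNorm (deriv h)) * 3 * n := by
    rw [show (3 : ℝ≥0∞) = ENNReal.ofReal 3 by simp, ← ENNReal.ofReal_natCast n,
      ← ENNReal.ofReal_mul (by positivity), ← ENNReal.ofReal_mul (by positivity)]
    refine ENNReal.ofReal_le_ofReal ?_
    have : 1 / √(n : ℝ) * supNorm (deriv h) * 3 * n = 3 * (supNorm (deriv h) * √n) := by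
      rw [div_mul_eq_mul_div, div_mul_eq_mul_div, div_mul_eq_mul_div, div_eq_iff hsn.ne']
      linear_combination -3 * supNorm (deriv h) * hss
    rw [this]
    nlinarith [mul_nonneg h1 hsn.le]
  have e2 : 1 / √(n : ℝ) * (√n * supNorm (deriv h) * (7 / 3)) = supNorm (deriv h) * (7 / 3) := by
    field_simp
  have e3 : 1 / √(n : ℝ) * supNorm (deriv h) = supNorm (deriv h) * (√n)⁻¹ := by
    field_simp
  have e4 : 1 / √(n : ℝ) * (supNorm (deriv h) / √n) = supNorm (deriv h) * (n : ℝ)⁻¹ := by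
    rw [hinv]; field_simp
  have e5 : 1 / √(n : ℝ) * (supNorm (deriv h) / (4 * √n))
      = supNorm (deriv h) * ((n : ℝ)⁻¹ / 4) := by
    rw [hinv]; field_simp
  rw [e2, e4, e5]
  refine le_trans (add_le_add_left (add_le_add_left (add_le_add_left (add_le_add_left
    (add_le_add_left (mul_le_mul_left e1 _) _) _) _) _) _) (le_of_eq ?_)
  rw [e3]
  ring

end ErrData

/-! ### The log-likelihood of the sample -/

namespace Problem

variable {𝒳 Ω : Type*} [MeasurableSpace 𝒳] [MeasurableSpace Ω] {r q n : ℕ}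
  {S : Problem 𝒳 Ω r q n}

theorem Standing.θ₀_mem (hS : S.Standing) : S.θ₀ ∈ S.Θ := hS.true_mem.1

theorem Standing.ae_mem_supp (hS : S.Standing) : ∀ᵐ ω ∂S.P, ∀ i, S.sample ω i ∈ S.supp := by
  rw [ae_all_iff]
  intro i
  have h := hS.null_compl_supp _ hS.θ₀_mem
  rw [← hS.law_X i, Measure.map_apply (hS.measurable_X i) hS.measurable_supp.compl] at h
  exact h

theorem Standing.log_lik (hS : S.Standing) {x : Fin n → 𝒳} (hx : ∀ i, x i ∈ S.supp)
    {θ : Idx r q → ℝ} (hθ : θ ∈ S.Θ) : Real.log (S.lik θ x) = S.loglik x θ := by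
  rw [lik, Real.log_prod fun i _ => (hS.pos_f θ hθ _ (hx i)).ne', loglik]

theorem Standing.lik_pos (hS : S.Standing) {x : Fin n → 𝒳} (hx : ∀ i, x i ∈ S.supp)
    {θ : Idx r q → ℝ} (hθ : θ ∈ S.Θ) : 0 < S.lik θ x :=
  Finset.prod_pos fun i _ => hS.pos_f θ hθ _ (hx i)

theorem RC2.contDiffOn_loglik (h2 : S.RC2) {x : Fin n → 𝒳} (hx : ∀ i, x i ∈ S.supp) :
    ContDiffOn ℝ 3 (S.loglik x) S.Θ :=
  ContDiffOn.sum fun i _ => h2 _ (hx i)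

theorem pd_sum {κ ι : Type*} [Fintype κ] [DecidableEq κ] [Fintype ι] {F : ι → (κ → ℝ) → ℝ}
    {θ : κ → ℝ} (hF : ∀ i, DifferentiableAt ℝ (F i) θ) (k : κ) :
    pd k (fun θ => ∑ i, F i θ) θ = ∑ i, pd k (F i) θ := by
  rw [pd, fderiv_fun_sum fun i _ => hF i, sum_apply]
  rfl

theorem pd_loglik (hU : IsOpen S.Θ) (h2 : S.RC2) {x : Fin n → 𝒳} (hx : ∀ i, x i ∈ S.supp)
    (k : Idx r q) {θ : Idx r q → ℝ} (hθ : θ ∈ S.Θ) :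
    pd k (S.loglik x) θ = ∑ i, S.score k θ (x i) :=
  pd_sum (fun i => ((h2 _ (hx i)).contDiffAt (hU.mem_nhds hθ)).differentiableAt (by norm_num)) k

theorem pd_pd_loglik (hU : IsOpen S.Θ) (h2 : S.RC2) {x : Fin n → 𝒳} (hx : ∀ i, x i ∈ S.supp)
    (j k : Idx r q) {θ : Idx r q → ℝ} (hθ : θ ∈ S.Θ) :
    pd j (pd k (S.loglik x)) θ = ∑ i, S.hess j k θ (x i) := by
  rw [pd_congr hU (fun θ hθ => pd_loglik hU h2 hx k hθ) j θ hθ]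
  exact pd_sum (fun i => ((contDiffOn_pd (m := 2) hU (by norm_num; exact h2 _ (hx i)) k).contDiffAt
    (hU.mem_nhds hθ)).differentiableAt (by norm_num)) j

theorem Standing.llr_eq (hS : S.Standing) {ω : Ω} (hx : ∀ i, S.sample ω i ∈ S.supp)
    (h1 : S.θhat (S.sample ω) ∈ S.Θ) (h2 : S.θres (S.sample ω) ∈ S.Θ) :
    S.llr ω = 2 * (S.loglik (S.sample ω) (S.θhat (S.sample ω)) - S.loglik (S.sample ω) S.θ₀)
      - 2 * (S.loglik (S.sample ω) (S.θres (S.sample ω)) - S.loglik (S.sample ω) S.θ₀) := by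
  have p0 := hS.lik_pos hx hS.θ₀_mem
  have p1 := hS.lik_pos hx h1
  have p2 := hS.lik_pos hx h2
  rw [llr, Real.log_div (by positivity) (by positivity), Real.log_div p1.ne' p0.ne',
    Real.log_div p2.ne' p0.ne', hS.log_lik hx h1, hS.log_lik hx h2, hS.log_lik hx hS.θ₀_mem]
  ring

/-- Only the line through `θ` in direction `k` has to stay in `T`, not a full neighbourhood. Hence
it covers the null model too, whose parameter set has no interior but contains the relevant lines in
the last coordinates. -/
theorem Standing.pd_loglik_eq_zero (hS : S.Standing) (h2 : S.RC2) {x : Fin n → 𝒳}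
    (hx : ∀ i, x i ∈ S.supp) {T : Set (Idx r q → ℝ)} (hTΘ : T ⊆ S.Θ) {θ : Idx r q → ℝ}
    (hθ : S.IsUniqueMLE T x θ) (k : Idx r q)
    (hk : ∀ t : ℝ, θ + t • Pi.single k 1 ∈ S.Θ → θ + t • Pi.single k 1 ∈ T) :
    pd k (S.loglik x) θ = 0 := by
  have hθ' := hTΘ hθ.1
  have hd : DifferentiableAt ℝ (S.loglik x) θ :=
    ((h2.contDiffOn_loglik hx).contDiffAt (hS.isOpen.mem_nhds hθ')).differentiableAt (by norm_num)
  have hline : HasDerivAt (fun t : ℝ => θ + t • (Pi.single k 1 : Idx r q → ℝ))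
      (Pi.single k 1) 0 := by
    simpa using ((hasDerivAt_id (0 : ℝ)).smul_const (Pi.single k 1 : Idx r q → ℝ)).const_add θ
  have hder : HasDerivAt (fun t : ℝ => S.loglik x (θ + t • Pi.single k 1))
      (pd k (S.loglik x) θ) 0 := by
    have hd' : HasFDerivAt (S.loglik x) (fderiv ℝ (S.loglik x) θ)
        (θ + (0 : ℝ) • (Pi.single k 1 : Idx r q → ℝ)) := by simpa using hd.hasFDerivAt
    exact hd'.comp_hasDerivAt (0 : ℝ) hline
  refine IsLocalMax.hasDerivAt_eq_zero ?_ hder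
  have hev : ∀ᶠ t in nhds (0 : ℝ), θ + t • (Pi.single k 1 : Idx r q → ℝ) ∈ S.Θ :=
    hline.continuousAt.eventually_mem (by simpa using hS.isOpen.mem_nhds hθ')
  filter_upwards [hev] with t ht
  simp only [zero_smul, add_zero]
  by_cases he : θ + t • (Pi.single k 1 : Idx r q → ℝ) = θ
  · rw [he]
  · rw [← hS.log_lik hx ht, ← hS.log_lik hx hθ']
    exact Real.log_le_log (hS.lik_pos hx ht) (hθ.2 _ (hk t ht) he).le

theorem direction_id {κ : Type*} [Fintype κ] [DecidableEq κ] (v : κ → ℝ) : direction id v = v := by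
  ext i
  simp [direction, Finset.sum_apply, Pi.single_apply]

theorem direction_inr_inl (v : Fin q → ℝ) (i : Fin r) :
    direction (Sum.inr : Fin q → Idx r q) v (Sum.inl i) = 0 := by
  simp [direction, Finset.sum_apply]

theorem direction_inr_inr (v : Fin q → ℝ) (i : Fin q) :
    direction (Sum.inr : Fin q → Idx r q) v (Sum.inr i) = v i := by
  simp [direction, Finset.sum_apply, Pi.single_apply]

theorem θ₀_add_direction_Q (ω : Ω) :
    S.θ₀ + direction id (fun j => S.Q j ω) = S.θhat (S.sample ω) := by
  rw [direction_id]
  ext j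
  simp [Q]

theorem Standing.θ₀_add_direction_Qnull (hS : S.Standing) {ω : Ω}
    (h : S.θres (S.sample ω) ∈ S.Θnull) :
    S.θ₀ + direction Sum.inr (fun j => S.Qnull j ω) = S.θres (S.sample ω) := by
  ext j
  rcases j with j | j
  · rw [Pi.add_apply, direction_inr_inl, h.2 j, hS.true_mem.2 j, add_zero]
  · rw [Pi.add_apply, direction_inr_inr, Qnull]
    ring

/-! ### Measurability and second moments -/

theorem Standing.measurable_sample (hS : S.Standing) : Measurable S.sample :=
  measurable_pi_iff.2 hS.measurable_X

theorem Standing.aemeasurable_comp (hS : S.Standing) {g : 𝒳 → ℝ}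
    (hg : AEMeasurable g (S.law S.θ₀)) (i : Fin n) : AEMeasurable (fun ω => g (S.X i ω)) S.P := by
  rw [← hS.law_X i] at hg
  exact hg.comp_measurable (hS.measurable_X i)

theorem Standing.lintegral_comp (hS : S.Standing) {g : 𝒳 → ℝ≥0∞}
    (hg : AEMeasurable g (S.law S.θ₀)) (i : Fin n) :
    ∫⁻ ω, g (S.X i ω) ∂S.P = ∫⁻ x, g x ∂(S.law S.θ₀) := by
  rw [← hS.law_X i] at hg ⊢
  rw [lintegral_map' hg (hS.measurable_X i).aemeasurable]

theorem Standing.integral_comp (hS : S.Standing) {g : 𝒳 → ℝ}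
    (hg : AEStronglyMeasurable g (S.law S.θ₀)) (i : Fin n) :
    ∫ ω, g (S.X i ω) ∂S.P = ∫ x, g x ∂(S.law S.θ₀) := by
  rw [← hS.law_X i] at hg ⊢
  rw [integral_map (hS.measurable_X i).aemeasurable hg]

theorem Standing.integrable_comp (hS : S.Standing) {g : 𝒳 → ℝ}
    (hg : Integrable g (S.law S.θ₀)) (i : Fin n) : Integrable (fun ω => g (S.X i ω)) S.P := by
  rw [← hS.law_X i] at hg
  exact hg.comp_measurable (hS.measurable_X i)

theorem Standing.memLp_comp (hS : S.Standing) {g : 𝒳 → ℝ} {p : ℝ≥0∞}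
    (hg : MemLp g p (S.law S.θ₀)) (i : Fin n) : MemLp (fun ω => g (S.X i ω)) p S.P := by
  rw [← hS.law_X i] at hg
  exact hg.comp_of_map (hS.measurable_X i).aemeasurable

theorem Standing.mean_sq_sum_sub (hS : S.Standing) {g : 𝒳 → ℝ}
    (hL : MemLp g 2 (S.law S.θ₀)) :
    mean S.P (fun ω => (∑ i, g (S.X i ω) - n * ∫ x, g x ∂(S.law S.θ₀)) ^ 2)
      = n * evariance g (S.law S.θ₀) := by
  have := hS.prob
  have := hS.prob_law _ hS.θ₀_mem
  have hg : Integrable g (S.law S.θ₀) := hL.integrable (by norm_num)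
  have hLi : ∀ i, MemLp (fun ω => g (S.X i ω)) 2 S.P := fun i => hS.memLp_comp hL i
  have hmean : ∫ ω, (∑ i, fun ω => g (S.X i ω)) ω ∂S.P = n * ∫ x, g x ∂(S.law S.θ₀) := by
    simp only [Finset.sum_apply]
    rw [integral_finsetSum _ fun i _ => hS.integrable_comp hg i]
    simp [hS.integral_comp hg.aestronglyMeasurable]
  have hind : iIndepFun (fun i ω => g (S.X i ω)) S.P :=
    hS.indep.comp₀ (fun _ => g) (fun i => (hS.measurable_X i).aemeasurable)
      (fun i => by rw [hS.law_X i]; exact hg.aemeasurable)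
  have hev := evariance_eq_lintegral_ofReal (∑ i, fun ω => g (S.X i ω)) S.P
  rw [hmean] at hev
  have hmean' : mean S.P (fun ω => (∑ i, g (S.X i ω) - n * ∫ x, g x ∂(S.law S.θ₀)) ^ 2)
      = evariance (∑ i, fun ω => g (S.X i ω)) S.P := by
    rw [hev, mean]
    simp
  rw [hmean', ← MemLp.ofReal_variance_eq (memLp_finsetSum' _ fun i _ => hLi i),
    IndepFun.variance_sum (fun i _ => hLi i) (fun i _ j _ hij => hind.indepFun hij)]
  have hvar : ∀ i : Fin n, Var[fun ω => g (S.X i ω); S.P] = Var[g; S.law S.θ₀] := by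
    intro i
    have := variance_map (X := g) (Y := S.X i) (μ := S.P)
      (by rw [hS.law_X i]; exact hg.aemeasurable) (hS.measurable_X i).aemeasurable
    rw [hS.law_X i] at this
    exact this.symm
  rw [Finset.sum_congr rfl fun i _ => hvar i, Finset.sum_const, Finset.card_univ, Fintype.card_fin,
    nsmul_eq_mul, ENNReal.ofReal_mul (by positivity), MemLp.ofReal_variance_eq hL,
    ENNReal.ofReal_natCast]

/-- The second derivatives are only assumed integrable. If their variance is infinite, the
right-hand side is infinite because `n ≥ 1`. -/
theorem Standing.mean_sq_sum_sub_le (hS : S.Standing) (hn : 1 ≤ n) {g : 𝒳 → ℝ}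
    (hg : Integrable g (S.law S.θ₀)) :
    mean S.P (fun ω => (∑ i, g (S.X i ω) - n * ∫ x, g x ∂(S.law S.θ₀)) ^ 2)
      ≤ n * evariance g (S.law S.θ₀) := by
  have := hS.prob_law _ hS.θ₀_mem
  rcases eq_or_ne (evariance g (S.law S.θ₀)) ∞ with htop | htop
  · rw [htop, ENNReal.mul_top (by exact_mod_cast (by omega : n ≠ 0))]
    exact le_top
  · exact (hS.mean_sq_sum_sub
      ((evariance_lt_top_iff_memLp hg.aestronglyMeasurable).1 htop.lt_top)).le

/-- The information identity makes `T` a centred sum of i.i.d. terms, so its second moment is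
governed by the variance of one summand. -/
theorem Regular.T_ae_eq (h : S.Regular) (l j : Idx r q) :
    S.T l j =ᵐ[S.P] fun ω => ∑ i, S.hess l j S.θ₀ (S.X i ω)
      - n * ∫ x, S.hess l j S.θ₀ x ∂(S.law S.θ₀) := by
  filter_upwards [h.standing.ae_mem_supp] with ω hω
  rw [T, pd_pd_loglik h.standing.isOpen h.rc2 hω l j h.standing.θ₀_mem,
    h.rc5.eq_hess _ h.standing.θ₀_mem]
  simp only [sample]
  ring

theorem Regular.aemeasurable_T (h : S.Regular) (l j : Idx r q) : AEMeasurable (S.T l j) S.P := by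
  refine AEMeasurable.congr ?_ (h.T_ae_eq l j).symm
  refine AEMeasurable.sub ?_ aemeasurable_const
  exact Finset.aemeasurable_fun_sum _ fun i _ => h.standing.aemeasurable_comp
    (h.rc5.integrable_hess _ h.standing.θ₀_mem l j).aemeasurable i

theorem Regular.mean_T_sq_le (h : S.Regular) (hn : 1 ≤ n) (l j : Idx r q) :
    mean S.P (fun ω => S.T l j ω ^ 2) ≤ n * evariance (S.hess l j S.θ₀) (S.law S.θ₀) := by
  refine le_trans (le_of_eq ?_) (h.standing.mean_sq_sum_sub_le hn
    (h.rc5.integrable_hess _ h.standing.θ₀_mem l j))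
  refine lintegral_congr_ae ?_
  filter_upwards [h.T_ae_eq l j] with ω hω
  rw [hω]

theorem Standing.measurable_Q (hS : S.Standing) (j : Idx r q) : Measurable (S.Q j) :=
  (((measurable_pi_apply j).comp (hS.measurable_θhat.comp hS.measurable_sample)).sub_const _)

theorem Standing.measurable_Qnull (hS : S.Standing) (j : Fin q) : Measurable (S.Qnull j) :=
  (((measurable_pi_apply (Sum.inr j)).comp
    (hS.measurable_θres.comp hS.measurable_sample)).sub_const _)

/-- A jointly measurable function is plugged in: the log-likelihood at a measurable estimator. -/
theorem Regular.aemeasurable_loglik (h : S.Regular) {τ : Ω → Idx r q → ℝ} (hτ : Measurable τ)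
    (hτΘ : ∀ᵐ ω ∂S.P, τ ω ∈ S.Θ) : AEMeasurable (fun ω => S.loglik (S.sample ω) (τ ω)) S.P := by
  classical
  have hS := h.standing
  let u : S.Θ → 𝒳 → ℝ := fun θ => S.supp.indicator fun x => Real.log (S.f x θ)
  have hu : Measurable (Function.uncurry u) := by
    -- A Carathéodory function, continuous in the parameter and measurable in the observation, is
    -- jointly measurable. The indicator of the support secures continuity for every observation.
    refine measurable_uncurry_of_continuous_of_measurable (fun x => ?_) (fun θ => ?_)
    · by_cases hx : x ∈ S.supp
      · simp only [u, Set.indicator_of_mem hx]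
        exact continuousOn_iff_continuous_domRestrict.1 (h.rc2 x hx).continuousOn
      · simp only [u, Set.indicator_of_notMem hx]
        exact continuous_const
    · exact (Real.measurable_log.comp (hS.measurable_f θ θ.2)).indicator hS.measurable_supp
  -- The estimator is known to lie in `Θ` only almost surely; the default value `θ₀` makes it a map
  -- into the subtype.
  let σ : Ω → S.Θ := fun ω => if hω : τ ω ∈ S.Θ then ⟨τ ω, hω⟩ else ⟨S.θ₀, hS.θ₀_mem⟩
  have hσ : Measurable σ := by
    refine Measurable.dite (s := τ ⁻¹' S.Θ) (f := fun ω => (⟨τ ω, ω.2⟩ : S.Θ))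
      (g := fun _ => (⟨S.θ₀, hS.θ₀_mem⟩ : S.Θ)) ?_ measurable_const (hτ hS.isOpen.measurableSet)
    exact (hτ.comp measurable_subtype_coe).subtype_mk
  refine AEMeasurable.congr (f := fun ω => ∑ i, Function.uncurry u (σ ω, S.X i ω)) ?_ ?_
  · exact (Finset.measurable_fun_sum _ fun i _ =>
      hu.comp (hσ.prodMk (hS.measurable_X i))).aemeasurable
  · filter_upwards [hS.ae_mem_supp, hτΘ] with ω hω hτω
    refine Finset.sum_congr rfl fun i _ => ?_
    have : S.X i ω ∈ S.supp := hω i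
    simp only [Function.uncurry, u, σ, dif_pos hτω, Set.indicator_of_mem this]
    rfl

theorem Regular.aemeasurable_llr (h : S.Regular) : AEMeasurable S.llr S.P := by
  have hS := h.standing
  have h0 := h.aemeasurable_loglik (τ := fun _ => S.θ₀) measurable_const (by simp [hS.θ₀_mem])
  have h1 := h.aemeasurable_loglik (hS.measurable_θhat.comp hS.measurable_sample)
    (hS.mle.mono fun ω hω => hω.1)
  have h2 := h.aemeasurable_loglik (hS.measurable_θres.comp hS.measurable_sample)
    (hS.mle_null.mono fun ω hω => hω.1.1)
  refine AEMeasurable.congr (((h1.sub h0).const_mul 2).sub ((h2.sub h0).const_mul 2)) ?_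
  filter_upwards [hS.ae_mem_supp, hS.mle, hS.mle_null] with ω hω h1 h2
  rw [hS.llr_eq hω h1.1 h2.1.1]
  rfl

end Problem

/-! ### The quadratic approximation to the log-likelihood ratio -/

namespace IsCb2

variable {h : ℝ → ℝ}

theorem abs_le (hh : IsCb2 h) (x : ℝ) : |h x| ≤ supNorm h :=
  le_ciSup (f := fun x => |h x|) (hh.bdd.imp fun _ hc => Set.forall_mem_range.2 hc) x

theorem abs_deriv_le (hh : IsCb2 h) (x : ℝ) : |deriv h x| ≤ supNorm (deriv h) :=
  le_ciSup (f := fun x => |deriv h x|) (hh.bdd_deriv.imp fun _ hc => Set.forall_mem_range.2 hc) x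

theorem abs_deriv2_le (hh : IsCb2 h) (x : ℝ) : |deriv (deriv h) x| ≤ supNorm (deriv (deriv h)) :=
  le_ciSup (f := fun x => |deriv (deriv h) x|)
    (hh.bdd_deriv2.imp fun _ hc => Set.forall_mem_range.2 hc) x

theorem derivBounds (hh : IsCb2 h) :
    DerivBounds h (supNorm (deriv h)) (supNorm (deriv (deriv h))) :=
  ⟨hh.contDiff, hh.abs_deriv_le, hh.abs_deriv2_le⟩

theorem supNorm_nonneg (hh : IsCb2 h) : 0 ≤ supNorm h := (abs_nonneg _).trans (hh.abs_le 0)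

theorem abs_sub_le (hh : IsCb2 h) (x y : ℝ) : |h x - h y| ≤ 2 * supNorm h := by
  have h1 := abs_sub (h x) (h y)
  have h2 := hh.abs_le x
  have h3 := hh.abs_le y
  linarith

theorem deriv_comp_neg' (h : ℝ → ℝ) : deriv (fun x => h (-x)) = fun x => -deriv h (-x) :=
  funext fun x => deriv_comp_neg h x

theorem deriv2_comp_neg (h : ℝ → ℝ) :
    deriv (deriv fun x => h (-x)) = fun x => deriv (deriv h) (-x) := by
  funext x
  rw [deriv_comp_neg', deriv.fun_neg, deriv_comp_neg, neg_neg]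

theorem supNorm_comp_neg (g : ℝ → ℝ) : supNorm (fun x => g (-x)) = supNorm g :=
  (Equiv.neg ℝ).iSup_congr fun _ => rfl

theorem supNorm_deriv_comp_neg (h : ℝ → ℝ) :
    supNorm (deriv fun x => h (-x)) = supNorm (deriv h) := by
  rw [deriv_comp_neg', ← supNorm_comp_neg (deriv h)]
  simp only [supNorm, abs_neg]

/-- The likelihood ratio of the null model enters the statistic with a minus sign, so its
approximation is applied to `x ↦ h (-x)`, which has the same three norms. -/
theorem comp_neg (hh : IsCb2 h) : IsCb2 fun x => h (-x) where
  contDiff := hh.contDiff.comp contDiff_neg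
  bdd := hh.bdd.imp fun _ hc x => hc _
  bdd_deriv := hh.bdd_deriv.imp fun _ hc x => by
    rw [deriv_comp_neg', abs_neg]; exact hc _
  bdd_deriv2 := hh.bdd_deriv2.imp fun _ hc x => by
    rw [deriv2_comp_neg]; exact hc _

end IsCb2

namespace Problem

open Matrix

variable {𝒳 Ω : Type*} [MeasurableSpace 𝒳] [MeasurableSpace Ω] {r q n : ℕ}
  {S : Problem 𝒳 Ω r q n}

/-- The quadratic form with matrix `J` in the components `e` of the normalised score `W`. -/
noncomputable def scoreForm (S : Problem 𝒳 Ω r q n) {ι : Type*} [Fintype ι] (e : ι → Idx r q)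
    (J : Matrix ι ι ℝ) (ω : Ω) : ℝ :=
  (fun k => S.W (e k) ω) ⬝ᵥ J *ᵥ fun k => S.W (e k) ω

theorem scoreForm_eq {ι : Type*} [Fintype ι] (e : ι → Idx r q) (J : Matrix ι ι ℝ) (ω : Ω) :
    S.scoreForm e J ω = (n : ℝ)⁻¹ *
      ((fun k => ∑ i, S.Y (e k) i ω) ⬝ᵥ J *ᵥ fun k => ∑ i, S.Y (e k) i ω) := by
  have hW : (fun k => S.W (e k) ω) = (√(n : ℝ))⁻¹ • fun k => ∑ i, S.Y (e k) i ω := rfl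
  rw [scoreForm, hW, mulVec_smul, dotProduct_smul, smul_dotProduct, smul_eq_mul, smul_eq_mul,
    ← mul_assoc, ← mul_inv, Real.mul_self_sqrt (by positivity)]

/-- Common to both models: `e` embeds the free coordinates. The arbitrary offset `b` holds the other
statistic fixed, so the two likelihood ratios can be replaced one after the other. -/
theorem Regular.lintegral_abs_sub_scoreForm_le (hR : S.Regular) (hn : 1 ≤ n) {ι : Type*}
    [Fintype ι] [DecidableEq ι] {E : ErrData ι Ω} {e : ι → Idx r q}
    (hJ : E.J * (S.fisher S.θ₀).submatrix e e = 1) (hJs : E.J.IsSymm)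
    (hTE : ∀ l j, E.T l j = S.T (e l) (e j))
    (hVE : ∀ l j, E.V l j = evariance (S.hess (e l) (e j) S.θ₀) (S.law S.θ₀))
    (hQ : ∀ j, Measurable (E.Q j)) (hM : ∀ j k l, AEMeasurable (E.M j k l) S.P)
    {θmax : Ω → Idx r q → ℝ}
    (hθ : ∀ᵐ ω ∂S.P, S.θ₀ + direction e (fun j => E.Q j ω) = θmax ω)
    (hcrit : ∀ᵐ ω ∂S.P, ∀ k, pd (e k) (S.loglik (S.sample ω)) (θmax ω) = 0) {ε : ℝ} (hε : 0 < ε)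
    (hseg : ∀ ω ∈ E.near ε, ∀ t ∈ Set.Icc (0 : ℝ) 1,
      S.θ₀ + t • direction e (fun j => E.Q j ω) ∈ S.Θ)
    (hle : ∀ ω ∈ E.near ε, (∀ i, S.sample ω i ∈ S.supp) → ∀ t ∈ Set.Icc (0 : ℝ) 1, ∀ j k l,
      |S.third (e j) (e k) (e l) (S.θ₀ + t • direction e (fun j => E.Q j ω)) (S.sample ω)|
        ≤ E.M j k l ω)
    {h : ℝ → ℝ} (hh : IsCb2 h) (b : Ω → ℝ) :
    ∫⁻ ω, ENNReal.ofReal |h (2 * (S.loglik (S.sample ω) (θmax ω) - S.loglik (S.sample ω) S.θ₀)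
        - b ω) - h (S.scoreForm e E.J ω - b ω)| ∂S.P
      ≤ ENNReal.ofReal (1 / √n) *
        (ENNReal.ofReal (supNorm (deriv h)) * E.K1 S.P n + E.K2 S.P n h ε) := by
  have := hR.standing.prob
  have hn0 : (0 : ℝ) < n := by exact_mod_cast hn
  refine ErrData.lintegral_abs_le_of_errBound hn hQ
    (fun l j => by rw [hTE]; exact hR.aemeasurable_T _ _) hM
    (fun l j => by rw [hTE, hVE]; exact hR.mean_T_sq_le hn _ _) hε hh.supNorm_nonneg
    hh.derivBounds.nonneg_fst (fun ω => hh.abs_sub_le _ _) ?_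
  filter_upwards [hR.standing.ae_mem_supp, hθ, hcrit] with ω hω hθω hcritω hnear
  refine (hh.derivBounds.abs_sub_le _ _).trans
    (mul_le_mul_of_nonneg_left ?_ hh.derivBounds.nonneg_fst)
  rw [sub_sub_sub_cancel_right, ← hθω, scoreForm_eq]
  exact abs_likelihood_ratio_sub_le hR.standing.isOpen (hR.rc2.contDiffOn_loglik hω)
    (hseg ω hnear) (M := fun j k l => E.M j k l ω) (hle ω hnear hω)
    (fun k => by rw [hθω]; exact hcritω k) hJ hJs hn0 (T := fun l j => E.T l j ω)
    (fun l j => by rw [hTE]; rfl)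
    (fun k => (pd_loglik hR.standing.isOpen hR.rc2 hω _ hR.standing.θ₀_mem).symm)

theorem Regular.lintegral_full_le (hR : S.Regular) (hn : 1 ≤ n) {ε : ℝ} (hε : 0 < ε)
    (hε₀ : ε ≤ S.ε₀) {h : ℝ → ℝ} (hh : IsCb2 h) (b : Ω → ℝ) :
    ∫⁻ ω, ENNReal.ofReal |h (2 * (S.loglik (S.sample ω) (S.θhat (S.sample ω))
        - S.loglik (S.sample ω) S.θ₀) - b ω) - h (S.scoreForm id (S.fisher S.θ₀)⁻¹ ω - b ω)| ∂S.P
      ≤ ENNReal.ofReal (1 / √n) * (ENNReal.ofReal (supNorm (deriv h)) * S.full.K1 S.P n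
        + S.full.K2 S.P n h ε) := by
  have hS := hR.standing
  have hpd := hR.rc5.posDef _ hS.θ₀_mem
  have hbox : ∀ ω ∈ S.full.near ε, ∀ t ∈ Set.Icc (0 : ℝ) 1, ∀ j,
      |(S.θ₀ + t • direction id (fun j => S.full.Q j ω)) j - S.θ₀ j| < S.ε₀ := by
    intro ω hω t ht j
    have : (S.θ₀ + t • direction id (fun j => S.full.Q j ω)) j - S.θ₀ j = t * S.full.Q j ω := by
      rw [direction_id]; simp
    rw [this, abs_mul, abs_of_nonneg ht.1]
    have h1 := hω j
    have h2 := mul_le_of_le_one_left (abs_nonneg (S.full.Q j ω)) ht.2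
    linarith
  refine hR.lintegral_abs_sub_scoreForm_le hn (E := S.full) (e := id) ?_ ?_ (fun _ _ => rfl)
    (fun _ _ => rfl) hS.measurable_Q (fun j k l => (hR.rc3.integrable j k l).aemeasurable)
    (ae_of_all _ fun ω => θ₀_add_direction_Q ω) ?_ hε
    (fun ω hω t ht => hR.rc3.box _ (hbox ω hω t ht))
    (fun ω hω hx t ht j k l => hR.rc3.le _ hx _ (hbox ω hω t ht) j k l) hh b
  · rw [submatrix_id_id]
    exact nonsing_inv_mul _ ((isUnit_iff_isUnit_det _).1 hpd.isUnit)
  · exact (conjTranspose_eq_transpose_of_trivial (S.fisher S.θ₀)⁻¹).symm.trans hpd.isHermitian.inv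
  · filter_upwards [hS.ae_mem_supp, hS.mle] with ω hω hm k
    exact hS.pd_loglik_eq_zero hR.rc2 hω subset_rfl hm k fun t ht => ht

theorem Regular.lintegral_null_le (hR : S.Regular) (hn : 1 ≤ n) {ε : ℝ} (hε : 0 < ε)
    (hε₀ : ε ≤ S.ε₀) {h : ℝ → ℝ} (hh : IsCb2 h) (b : Ω → ℝ) :
    ∫⁻ ω, ENNReal.ofReal |h (2 * (S.loglik (S.sample ω) (S.θres (S.sample ω))
        - S.loglik (S.sample ω) S.θ₀) - b ω) - h (S.scoreForm Sum.inr S.C⁻¹ ω - b ω)| ∂S.P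
      ≤ ENNReal.ofReal (1 / √n) * (ENNReal.ofReal (supNorm (deriv h)) * S.null.K1 S.P n
        + S.null.K2 S.P n h ε) := by
  have hS := hR.standing
  have hpd : S.C.PosDef := (hR.rc5.posDef _ hS.θ₀_mem).submatrix Sum.inr_injective
  have hinl : ∀ ω, ∀ t : ℝ, ∀ j,
      (S.θ₀ + t • direction (Sum.inr : Fin q → Idx r q) (fun j => S.null.Q j ω)) (Sum.inl j)
        = 0 := by
    intro ω t j
    rw [Pi.add_apply, Pi.smul_apply, direction_inr_inl, hS.true_mem.2, smul_zero, add_zero]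
  have hinr : ∀ ω ∈ S.null.near ε, ∀ t ∈ Set.Icc (0 : ℝ) 1, ∀ j,
      |(S.θ₀ + t • direction (Sum.inr : Fin q → Idx r q) (fun j => S.null.Q j ω)) (Sum.inr j)
        - S.θ₀ (Sum.inr j)|
        < S.ε₀ := by
    intro ω hω t ht j
    rw [Pi.add_apply, Pi.smul_apply, direction_inr_inr, add_sub_cancel_left, smul_eq_mul, abs_mul,
      abs_of_nonneg ht.1]
    have h1 := hω j
    have h2 := mul_le_of_le_one_left (abs_nonneg (S.null.Q j ω)) ht.2
    linarith
  refine hR.lintegral_abs_sub_scoreForm_le hn (E := S.null) (e := Sum.inr) ?_ ?_ (fun _ _ => rfl)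
    (fun _ _ => rfl) hS.measurable_Qnull hR.o1.measurable
    (hS.mle_null.mono fun ω hω => hS.θ₀_add_direction_Qnull hω.1) ?_ hε
    (fun ω hω t ht => hR.rc3.box _ ?_)
    (fun ω hω hx t ht j k l => hR.o1.le _ hx _ (hinl ω t) (hinr ω hω t ht) j k l) hh b
  · exact nonsing_inv_mul _ ((isUnit_iff_isUnit_det _).1 hpd.isUnit)
  · exact (conjTranspose_eq_transpose_of_trivial S.C⁻¹).symm.trans hpd.isHermitian.inv
  · filter_upwards [hS.ae_mem_supp, hS.mle_null] with ω hω hm k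
    refine hS.pd_loglik_eq_zero hR.rc2 hω (fun θ hθ => hθ.1) hm _ fun t ht => ⟨ht, fun i => ?_⟩
    rw [Pi.add_apply, hm.1.2 i]
    simp
  · rintro (j | j)
    · rw [hinl, hS.true_mem.2, sub_zero, abs_zero]
      exact hR.rc3.pos
    · exact hinr ω hω t ht j

theorem Regular.aemeasurable_Y (hR : S.Regular) (j : Idx r q) (i : Fin n) :
    AEMeasurable (S.Y j i) S.P :=
  hR.standing.aemeasurable_comp (hR.o3 j).aestronglyMeasurable.aemeasurable i

theorem Regular.aemeasurable_W (hR : S.Regular) (j : Idx r q) : AEMeasurable (S.W j) S.P :=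
  (Finset.aemeasurable_fun_sum _ fun i _ => hR.aemeasurable_Y j i).const_mul _

theorem Regular.aemeasurable_scoreForm (hR : S.Regular) {ι : Type*} [Fintype ι]
    (e : ι → Idx r q) (J : Matrix ι ι ℝ) : AEMeasurable (S.scoreForm e J) S.P := by
  unfold scoreForm
  simp only [dotProduct, mulVec]
  have := hR.aemeasurable_W
  fun_prop

/-- In expectation, `h(-2 log Λ)` is close to `h` of the difference of the two quadratic forms in
the normalised score. -/
theorem Regular.lintegral_llr_le (hR : S.Regular) (hn : 1 ≤ n) {ε : ℝ} (hε : 0 < ε)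
    (hε₀ : ε ≤ S.ε₀) {h : ℝ → ℝ} (hh : IsCb2 h) :
    ∫⁻ ω, ENNReal.ofReal |h (S.llr ω)
        - h (S.scoreForm id (S.fisher S.θ₀)⁻¹ ω - S.scoreForm Sum.inr S.C⁻¹ ω)| ∂S.P
      ≤ ENNReal.ofReal (1 / √n) *
      (ENNReal.ofReal (supNorm (deriv h)) * (S.full.K1 S.P n + S.null.K1 S.P n)
        + S.full.K2 S.P n h ε + S.null.K2 S.P n h ε) := by
  have hS := hR.standing
  have hc := hh.contDiff.continuous
  -- First exchange: the full likelihood ratio gives way to its score form, while the null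
  -- likelihood ratio serves as offset.
  have h1 := hR.lintegral_full_le hn hε hε₀ hh fun ω =>
    2 * (S.loglik (S.sample ω) (S.θres (S.sample ω)) - S.loglik (S.sample ω) S.θ₀)
  -- Second exchange: the null likelihood ratio is replaced, with the score form of the full model
  -- as offset and the sign reversed.
  have h2 := hR.lintegral_null_le hn hε hε₀ hh.comp_neg (S.scoreForm id (S.fisher S.θ₀)⁻¹)
  have hK2 : S.null.K2 S.P n (fun x => h (-x)) ε = S.null.K2 S.P n h ε := by
    rw [ErrData.K2, ErrData.K2, IsCb2.supNorm_comp_neg h, IsCb2.supNorm_deriv_comp_neg]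
  rw [hK2, IsCb2.supNorm_deriv_comp_neg] at h2
  simp only [neg_sub] at h2
  have m0 := hR.aemeasurable_loglik (τ := fun _ => S.θ₀) measurable_const (by simp [hS.θ₀_mem])
  have m1 := hR.aemeasurable_loglik (hS.measurable_θhat.comp hS.measurable_sample)
    (hS.mle.mono fun ω hω => hω.1)
  have m2 := hR.aemeasurable_loglik (hS.measurable_θres.comp hS.measurable_sample)
    (hS.mle_null.mono fun ω hω => hω.1.1)
  have mF := hR.aemeasurable_scoreForm id (S.fisher S.θ₀)⁻¹
  have hmeas : AEMeasurable (fun ω => ENNReal.ofReal |h (2 * (S.loglik (S.sample ω)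
      (S.θhat (S.sample ω)) - S.loglik (S.sample ω) S.θ₀) - 2 * (S.loglik (S.sample ω)
      (S.θres (S.sample ω)) - S.loglik (S.sample ω) S.θ₀)) - h (S.scoreForm id (S.fisher S.θ₀)⁻¹ ω
      - 2 * (S.loglik (S.sample ω) (S.θres (S.sample ω)) - S.loglik (S.sample ω) S.θ₀))|) S.P := by
    have m3 := hc.measurable.comp_aemeasurable
      (((m1.sub m0).const_mul 2).sub ((m2.sub m0).const_mul 2))
    have m4 := hc.measurable.comp_aemeasurable (mF.sub ((m2.sub m0).const_mul 2))
    exact (m3.sub m4).norm.ennreal_ofReal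
  refine le_trans ?_ ((add_le_add h1 h2).trans_eq ?_)
  · rw [← lintegral_add_left' hmeas]
    refine lintegral_mono_ae ?_
    filter_upwards [hS.ae_mem_supp, hS.mle, hS.mle_null] with ω hω hm1 hm2
    rw [hS.llr_eq hω hm1.1 hm2.1.1, ← ENNReal.ofReal_add (abs_nonneg _) (abs_nonneg _)]
    exact ENNReal.ofReal_le_ofReal (abs_sub_le _ _ _)
  · ring

end Problem

/-! ### Block inverses -/

section Schur

open Matrix

variable {α β : Type*} [Fintype α] [Fintype β] [DecidableEq α] [DecidableEq β]

theorem transpose_eq_of_isHermitian {ι : Type*} {M : Matrix ι ι ℝ} (h : M.IsHermitian) :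
    Mᵀ = M := by
  rw [← conjTranspose_eq_transpose_of_trivial]
  exact h

theorem toBlocks₂₁_eq {I : Matrix (α ⊕ β) (α ⊕ β) ℝ} (hI : I.PosDef) :
    I.toBlocks₂₁ = I.toBlocks₁₂ᵀ := by
  ext i j
  have := congrFun (congrFun (transpose_eq_of_isHermitian hI.isHermitian) (Sum.inr i)) (Sum.inl j)
  exact this.symm

theorem posDef_toBlocks₂₂ {I : Matrix (α ⊕ β) (α ⊕ β) ℝ} (hI : I.PosDef) : I.toBlocks₂₂.PosDef :=
  hI.submatrix Sum.inr_injective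

/-- Semidefiniteness comes from the block criterion; the determinant of `I` is that of `C` times
that of the Schur complement, which excludes degeneracy. -/
theorem posDef_schur {I : Matrix (α ⊕ β) (α ⊕ β) ℝ} (hI : I.PosDef) :
    (I.toBlocks₁₁ - I.toBlocks₁₂ * I.toBlocks₂₂⁻¹ * I.toBlocks₁₂ᵀ).PosDef := by
  have hC := posDef_toBlocks₂₂ hI
  have hCu := hC.isUnit
  let := hCu.invertible
  have hb : fromBlocks I.toBlocks₁₁ I.toBlocks₁₂ I.toBlocks₁₂ᵀ I.toBlocks₂₂ = I := by
    rw [← toBlocks₂₁_eq hI, fromBlocks_toBlocks]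
  have hps : (I.toBlocks₁₁ - I.toBlocks₁₂ * I.toBlocks₂₂⁻¹ * I.toBlocks₁₂ᵀ).PosSemidef := by
    have := (PosDef.fromBlocks₂₂ I.toBlocks₁₁ I.toBlocks₁₂ hC).1
      (by rw [conjTranspose_eq_transpose_of_trivial, hb]; exact hI.posSemidef)
    rwa [conjTranspose_eq_transpose_of_trivial] at this
  refine hps.posDef_iff_det_ne_zero.2 fun h0 => ?_
  have hdet := det_fromBlocks₂₂ I.toBlocks₁₁ I.toBlocks₁₂ I.toBlocks₁₂ᵀ I.toBlocks₂₂
  rw [hb, invOf_eq_nonsing_inv, h0, mul_zero] at hdet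
  exact hI.det_pos.ne' hdet

/-- Written so that subtracting `C⁻¹` from the lower right block leaves `[1, -D]ᵀ U [1, -D]`, of
rank at most the size of the first block. This is where the `r` degrees of freedom appear. -/
theorem inv_eq_fromBlocks {I : Matrix (α ⊕ β) (α ⊕ β) ℝ} (hI : I.PosDef) {U : Matrix α α ℝ}
    {D : Matrix α β ℝ}
    (hU : U = (I.toBlocks₁₁ - I.toBlocks₁₂ * I.toBlocks₂₂⁻¹ * I.toBlocks₁₂ᵀ)⁻¹)
    (hD : D = I.toBlocks₁₂ * I.toBlocks₂₂⁻¹) :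
    I⁻¹ = fromBlocks U (-(U * D)) (-(Dᵀ * U)) (Dᵀ * U * D + I.toBlocks₂₂⁻¹) := by
  have hC := posDef_toBlocks₂₂ hI
  have hCd := (isUnit_iff_isUnit_det _).1 hC.isUnit
  have hS := posDef_schur hI
  have hUS : U * (I.toBlocks₁₁ - D * I.toBlocks₁₂ᵀ) = 1 := by
    rw [hU, hD]
    exact nonsing_inv_mul _ ((isUnit_iff_isUnit_det _).1 hS.isUnit)
  have hDC : D * I.toBlocks₂₂ = I.toBlocks₁₂ := by
    rw [hD, Matrix.mul_assoc, nonsing_inv_mul _ hCd, Matrix.mul_one]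
  have hCD : I.toBlocks₂₂⁻¹ * I.toBlocks₁₂ᵀ = Dᵀ := by
    rw [hD, transpose_mul, transpose_eq_of_isHermitian hC.isHermitian.inv]
  refine inv_eq_left_inv ?_
  have hb : fromBlocks I.toBlocks₁₁ I.toBlocks₁₂ I.toBlocks₁₂ᵀ I.toBlocks₂₂ = I := by
    rw [← toBlocks₂₁_eq hI, fromBlocks_toBlocks]
  suffices h : fromBlocks U (-(U * D)) (-(Dᵀ * U)) (Dᵀ * U * D + I.toBlocks₂₂⁻¹) *
      fromBlocks I.toBlocks₁₁ I.toBlocks₁₂ I.toBlocks₁₂ᵀ I.toBlocks₂₂ = 1 by rwa [hb] at h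
  rw [fromBlocks_multiply, ← fromBlocks_one]
  have h1 : U * I.toBlocks₁₁ + -(U * D) * I.toBlocks₁₂ᵀ = 1 := by
    rw [← hUS, Matrix.mul_sub, Matrix.neg_mul, Matrix.mul_assoc, sub_eq_add_neg]
  have h2 : U * I.toBlocks₁₂ + -(U * D) * I.toBlocks₂₂ = 0 := by
    rw [Matrix.neg_mul, Matrix.mul_assoc, hDC, add_neg_cancel]
  congr 1
  · calc -(Dᵀ * U) * I.toBlocks₁₁ + (Dᵀ * U * D + I.toBlocks₂₂⁻¹) * I.toBlocks₁₂ᵀ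
        = -(Dᵀ * (U * I.toBlocks₁₁ + -(U * D) * I.toBlocks₁₂ᵀ))
          + I.toBlocks₂₂⁻¹ * I.toBlocks₁₂ᵀ := by
          simp only [Matrix.mul_assoc, Matrix.neg_mul, Matrix.mul_neg, Matrix.mul_add,
            Matrix.add_mul, neg_add, neg_neg]
          abel
      _ = 0 := by rw [h1, hCD, Matrix.mul_one, neg_add_cancel]
  · calc -(Dᵀ * U) * I.toBlocks₁₂ + (Dᵀ * U * D + I.toBlocks₂₂⁻¹) * I.toBlocks₂₂
        = -(Dᵀ * (U * I.toBlocks₁₂ + -(U * D) * I.toBlocks₂₂))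
          + I.toBlocks₂₂⁻¹ * I.toBlocks₂₂ := by
          simp only [Matrix.mul_assoc, Matrix.neg_mul, Matrix.mul_neg, Matrix.mul_add,
            Matrix.add_mul, neg_add, neg_neg]
          abel
      _ = 1 := by rw [h2, nonsing_inv_mul _ hCd, Matrix.mul_zero, neg_zero, zero_add]

theorem sqrt_mul_sqrt {ι : Type*} [Fintype ι] [DecidableEq ι] {M : Matrix ι ι ℝ}
    (hM : M.PosSemidef) : CFC.sqrt M * CFC.sqrt M = M :=
  CFC.sqrt_mul_sqrt_self M (nonneg_iff_posSemidef.2 hM)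

theorem transpose_sqrt {ι : Type*} [Fintype ι] [DecidableEq ι] (M : Matrix ι ι ℝ) :
    (CFC.sqrt M)ᵀ = CFC.sqrt M :=
  transpose_eq_of_isHermitian (nonneg_iff_posSemidef.1 (CFC.sqrt_nonneg M)).isHermitian

/-- A matrix `L` of `r` rows which whitens the component of the score that matters for the test. -/
theorem exists_whitening {I : Matrix (α ⊕ β) (α ⊕ β) ℝ} (hI : I.PosDef) {U : Matrix α α ℝ}
    {D : Matrix α β ℝ}
    (hU : U = (I.toBlocks₁₁ - I.toBlocks₁₂ * I.toBlocks₂₂⁻¹ * I.toBlocks₁₂ᵀ)⁻¹)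
    (hD : D = I.toBlocks₁₂ * I.toBlocks₂₂⁻¹) :
    ∃ L : Matrix α (α ⊕ β) ℝ, L * I * Lᵀ = 1 ∧
      Lᵀ * L = fromBlocks U (-(U * D)) (-(Dᵀ * U)) (Dᵀ * U * D) := by
  have hC := posDef_toBlocks₂₂ hI
  have hCd := (isUnit_iff_isUnit_det _).1 hC.isUnit
  have hS := posDef_schur hI
  have hUS : U * (I.toBlocks₁₁ - D * I.toBlocks₁₂ᵀ) = 1 := by
    rw [hU, hD]
    exact nonsing_inv_mul _ ((isUnit_iff_isUnit_det _).1 hS.isUnit)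
  have hDC : D * I.toBlocks₂₂ = I.toBlocks₁₂ := by
    rw [hD, Matrix.mul_assoc, nonsing_inv_mul _ hCd, Matrix.mul_one]
  have hUps : U.PosSemidef := by rw [hU]; exact hS.inv.posSemidef
  have hR := sqrt_mul_sqrt hUps
  have hRt := transpose_sqrt U
  set R := CFC.sqrt U
  have hb : fromBlocks I.toBlocks₁₁ I.toBlocks₁₂ I.toBlocks₁₂ᵀ I.toBlocks₂₂ = I := by
    rw [← toBlocks₂₁_eq hI, fromBlocks_toBlocks]
  -- Applied to a score vector `(ξ, η)`, this gives `U^{1/2} (ξ - D η)`: the residual of `ξ` after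
  -- regression on `η`, standardised.
  refine ⟨fromCols R (-(R * D)), ?_, ?_⟩
  · rw [transpose_fromCols, hRt, transpose_neg, transpose_mul, hRt]
    nth_rw 1 [← hb]
    rw [fromCols_mul_fromBlocks, fromCols_mul_fromRows]
    have h2 : R * I.toBlocks₁₂ + -(R * D) * I.toBlocks₂₂ = 0 := by
      rw [Matrix.neg_mul, Matrix.mul_assoc, hDC, add_neg_cancel]
    rw [h2, Matrix.zero_mul, add_zero]
    refine mul_eq_one_comm.1 ?_
    rw [← hUS, ← hR]
    simp only [Matrix.mul_assoc, Matrix.neg_mul, Matrix.mul_add, Matrix.mul_neg,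
      sub_eq_add_neg]
  · rw [transpose_fromCols, hRt, transpose_neg, transpose_mul, hRt, fromRows_mul_fromCols, ← hR]
    congr 1 <;> simp only [Matrix.mul_assoc, Matrix.neg_mul, Matrix.mul_neg, neg_neg]

/-- `J_ss I_ss ≥ 1` for mutually inverse positive definite matrices. -/
theorem one_le_inv_mul_diag {ι : Type*} [Fintype ι] [DecidableEq ι] {I : Matrix ι ι ℝ}
    (hI : I.PosDef) (s : ι) : 1 ≤ I⁻¹ s s * I s s := by
  have hJ := hI.inv
  have hJs : 0 < I⁻¹ s s := hJ.diag_pos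
  have hmul : I *ᵥ (I⁻¹ *ᵥ Pi.single s 1) = Pi.single s 1 := by
    rw [mulVec_mulVec, mul_nonsing_inv _ ((isUnit_iff_isUnit_det _).1 hI.isUnit), one_mulVec]
  set x := I⁻¹ *ᵥ (Pi.single s 1 : ι → ℝ) with hx
  have hxs : x s = I⁻¹ s s := by simp [hx]
  have hsym : x ⬝ᵥ I *ᵥ Pi.single s 1 = 1 := by
    rw [dotProduct_mulVec, ← mulVec_transpose, transpose_eq_of_isHermitian hI.isHermitian, hmul]
    simp
  have hIs : (Pi.single s 1 : ι → ℝ) ⬝ᵥ I *ᵥ Pi.single s 1 = I s s := by simp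
  have hxx : x ⬝ᵥ I *ᵥ x = I⁻¹ s s := by rw [hmul]; simp [hxs]
  have hsx : (Pi.single s 1 : ι → ℝ) ⬝ᵥ I *ᵥ x = 1 := by rw [hmul]; simp
  -- The quadratic form of `I` at `J_ss e_s - J e_s` equals `J_ss (J_ss I_ss - 1)`.
  have h0 := hI.posSemidef.dotProduct_mulVec_nonneg (I⁻¹ s s • Pi.single s 1 - x)
  rw [star_trivial] at h0
  simp only [mulVec_sub, mulVec_smul, dotProduct_sub, sub_dotProduct, smul_dotProduct,
    dotProduct_smul, hIs, hxx, hsx, hsym, smul_eq_mul] at h0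
  have h1 : 0 ≤ I⁻¹ s s * (I⁻¹ s s * I s s - 1) := by linarith
  have h2 := nonneg_of_mul_nonneg_right h1 hJs
  linarith

theorem abs_apply_le_rowSumNorm {κ₁ κ₂ : Type*} [Fintype κ₁] [Fintype κ₂] (M : Matrix κ₁ κ₂ ℝ)
    (i : κ₁) (j : κ₂) : |M i j| ≤ rowSumNorm M := by
  have h1 : ‖M i j‖₊ ≤ ∑ j, ‖M i j‖₊ :=
    Finset.single_le_sum (f := fun j => ‖M i j‖₊) (fun _ _ => zero_le) (Finset.mem_univ j)
  have h2 : ∑ j, ‖M i j‖₊ ≤ rowSumNorm M :=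
    Finset.le_sup (f := fun i => ∑ j, ‖M i j‖₊) (Finset.mem_univ i)
  exact_mod_cast h1.trans h2

/-- The upper right block is the transpose of the lower left one, since `U` is symmetric; therefore
three norms suffice for four blocks. -/
theorem abs_fromBlocks_le_cConst {r q : ℕ} {U : Matrix (Fin r) (Fin r) ℝ} (hU : Uᵀ = U)
    (D : Matrix (Fin r) (Fin q) ℝ) (j k : Idx r q) :
    |fromBlocks U (-(U * D)) (-(Dᵀ * U)) (Dᵀ * U * D) j k| ≤ cConst U D := by
  have h1 : (rowSumNorm U : ℝ) ≤ cConst U D := by exact_mod_cast le_max_left _ _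
  have h2 : (rowSumNorm (Dᵀ * U * D) : ℝ) ≤ cConst U D := by
    exact_mod_cast (le_max_left _ _).trans (le_max_right _ _)
  have h3 : (rowSumNorm (Dᵀ * U) : ℝ) ≤ cConst U D := by
    exact_mod_cast (le_max_right _ _).trans (le_max_right _ _)
  rcases j with j | j <;> rcases k with k | k
  · exact (abs_apply_le_rowSumNorm U j k).trans h1
  · have e : (U * D) j k = (Dᵀ * U) k j := by
      rw [← transpose_apply (U * D), transpose_mul, hU]
    rw [fromBlocks_apply₁₂, neg_apply, abs_neg, e]
    exact (abs_apply_le_rowSumNorm _ k j).trans h3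
  · rw [fromBlocks_apply₂₁, neg_apply, abs_neg]
    exact (abs_apply_le_rowSumNorm _ j k).trans h3
  · exact (abs_apply_le_rowSumNorm _ j k).trans h2

/-- The squared length of the whitened vector is bounded by the entries of the Gram matrix. -/
theorem sum_sq_mulVec_le {ι κ : Type*} [Fintype ι] [Fintype κ] (L : Matrix κ ι ℝ) {c : ℝ}
    (hL : ∀ j k, |(Lᵀ * L) j k| ≤ c) (y : ι → ℝ) :
    ∑ i, (L *ᵥ y) i ^ 2 ≤ c * (∑ j, |y j|) ^ 2 := by
  have e : ∑ i, (L *ᵥ y) i ^ 2 = y ⬝ᵥ (Lᵀ * L) *ᵥ y := by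
    rw [← mulVec_mulVec, dotProduct_mulVec, vecMul_transpose, dotProduct]
    simp only [sq]
  rw [e]
  refine (le_abs_self _).trans ((abs_dotProduct_mulVec_le _ _ _).trans ?_)
  rw [sq, Finset.sum_mul_sum, Finset.mul_sum]
  refine Finset.sum_le_sum fun l _ => ?_
  rw [Finset.mul_sum]
  exact Finset.sum_le_sum fun m _ => mul_le_mul_of_nonneg_right (hL l m) (by positivity)

/-- The quadratic form is evaluated at `e_j + e_k` and `e_j - e_k`. -/
theorem abs_apply_le_of_posSemidef {ι : Type*} [Fintype ι] {I : Matrix ι ι ℝ}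
    (hI : I.PosSemidef) (j k : ι) : |I j k| ≤ (I j j + I k k) / 2 := by
  classical
  have hs : I k j = I j k := by
    have := congrFun (congrFun (transpose_eq_of_isHermitian hI.isHermitian) j) k
    exact this
  have q1 := hI.dotProduct_mulVec_nonneg (Pi.single j 1 + Pi.single k 1)
  have q2 := hI.dotProduct_mulVec_nonneg (Pi.single j 1 - Pi.single k 1)
  rw [star_trivial] at q1 q2
  simp only [mulVec_add, mulVec_sub, dotProduct_add, add_dotProduct, dotProduct_sub,
    sub_dotProduct, mulVec_single_one, single_dotProduct, one_mul, col_apply, hs] at q1 q2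
  rw [abs_le]
  constructor <;> linarith

/-- Cyclicity of the trace: the number of rows is `tr(L I Lᵀ) = tr(LᵀL I)`, whose entries are
controlled by `c` and the diagonal of `I`. It keeps `c` from being too small in the lower bound for
`R`. -/
theorem card_le_of_whitening {ι κ : Type*} [Fintype ι] [Fintype κ] [DecidableEq κ]
    {L : Matrix κ ι ℝ} {I : Matrix ι ι ℝ} (hI : I.PosSemidef) (h1 : L * I * Lᵀ = 1) {c : ℝ}
    (hc : 0 ≤ c) (hL : ∀ j k, |(Lᵀ * L) j k| ≤ c) :
    (Fintype.card κ : ℝ) ≤ c * (Fintype.card ι * ∑ j, I j j) := by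
  have htr : (Lᵀ * L * I).trace = Fintype.card κ := by
    rw [← trace_one (n := κ) (R := ℝ), ← h1, trace_mul_cycle L I Lᵀ]
  calc (Fintype.card κ : ℝ) = ∑ j, ∑ k, (Lᵀ * L) j k * I k j := by
        rw [← htr, trace]; rfl
    _ ≤ ∑ j, ∑ k, c * ((I j j + I k k) / 2) := by
        refine Finset.sum_le_sum fun j _ => Finset.sum_le_sum fun k _ => ?_
        refine (le_abs_self _).trans ?_
        rw [abs_mul]
        have := abs_apply_le_of_posSemidef hI k j
        rw [add_comm] at this
        exact mul_le_mul (hL j k) this (abs_nonneg _) hc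
    _ = c * (Fintype.card ι * ∑ j, I j j) := by
        simp only [← Finset.mul_sum, ← Finset.sum_div, Finset.sum_add_distrib, Finset.sum_const,
          Finset.card_univ, nsmul_eq_mul]
        ring

end Schur

/-! ### Gaussian quantities -/

section GaussianAbs

theorem stdNormal_map_sum_mul {ι : Type*} [Fintype ι] (a : ι → ℝ) :
    (stdNormal ι).map (fun z => ∑ t, a t * z t)
      = gaussianReal 0 (∑ t, a t ^ 2).toNNReal := by
  have h := stdGaussian_map_inner (WithLp.toLp 2 a : EuclideanSpace ℝ ι)
  rw [← map_pi_eq_stdGaussian, Measure.map_map (by fun_prop) (by fun_prop)] at h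
  have hv : ‖(WithLp.toLp 2 a : EuclideanSpace ℝ ι)‖₊ ^ 2 = (∑ t, a t ^ 2).toNNReal := by
    apply NNReal.coe_injective
    rw [NNReal.coe_pow, coe_nnnorm, EuclideanSpace.real_norm_sq_eq,
      Real.coe_toNNReal _ (Finset.sum_nonneg fun t _ => sq_nonneg _)]
  rw [hv] at h
  rw [← h, stdNormal]
  congr 1
  funext z
  simp [PiLp.inner_apply, mul_comm]

/-- The even polynomial `3x²/(2w) - x⁴/(2w³)` lies below `|x|` and touches it at `|x| = w`. With `w²
= 3v` its expectation is `w/3`. -/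
theorem sqrt_div_three_le_integral_abs_gaussianReal (v : ℝ≥0) :
    √(v / 3) ≤ ∫ x, |x| ∂gaussianReal 0 v := by
  rcases eq_or_ne v 0 with rfl | hv
  · simp
  have hv0 : (0 : ℝ) < v := by positivity
  set w := √(3 * (v : ℝ)) with hw
  have hw0 : 0 < w := Real.sqrt_pos.2 (by positivity)
  have hw2 : w ^ 2 = 3 * v := Real.sq_sqrt (by positivity)
  have hpt : ∀ x : ℝ, 3 / (2 * w) * x ^ 2 - 1 / (2 * w ^ 3) * x ^ 4 ≤ |x| := by
    intro x
    have hx : 0 ≤ |x| := abs_nonneg x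
    have h4 : x ^ 4 = |x| ^ 4 := by rw [← Even.pow_abs (by decide)]
    rw [← sq_abs x, h4]
    have key : |x| - (3 / (2 * w) * |x| ^ 2 - 1 / (2 * w ^ 3) * |x| ^ 4)
        = |x| * (|x| + 2 * w) * (|x| - w) ^ 2 / (2 * w ^ 3) := by
      field_simp
      ring
    have : 0 ≤ |x| * (|x| + 2 * w) * (|x| - w) ^ 2 / (2 * w ^ 3) := by positivity
    linarith
  have h2 := (integrable_pow_gaussianReal v 2).const_mul (3 / (2 * w))
  have h4 := (integrable_pow_gaussianReal v 4).const_mul (1 / (2 * w ^ 3))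
  have hI : Integrable (fun x : ℝ => |x|) (gaussianReal 0 v) := by
    simpa using (integrable_pow_gaussianReal v 1).abs
  have := integral_mono (h2.sub h4) hI hpt
  refine le_trans (le_of_eq ?_) this
  simp only [Pi.sub_apply]
  rw [integral_sub h2 h4, integral_const_mul, integral_const_mul, integral_sq_gaussianReal,
    integral_pow_four_gaussianReal]
  have e : (v : ℝ) = w ^ 2 / 3 := by rw [hw2]; ring
  rw [e, show w ^ 2 / 3 / 3 = (w / 3) ^ 2 by ring, Real.sqrt_sq (by positivity)]
  field_simp
  norm_num

theorem integral_abs_gaussianReal_le (v : ℝ≥0) : ∫ x, |x| ∂gaussianReal 0 v ≤ √v := by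
  have hI : Integrable (fun x : ℝ => |x|) (gaussianReal 0 v) := by
    simpa using (integrable_pow_gaussianReal v 1).abs
  have hL : MemLp (fun x : ℝ => |x|) 2 (gaussianReal 0 v) := by
    refine (memLp_two_iff_integrable_sq (by fun_prop)).2 ?_
    simpa using integrable_pow_gaussianReal v 2
  have h := variance_nonneg (fun x : ℝ => |x|) (gaussianReal 0 v)
  rw [variance_eq_sub hL] at h
  refine Real.le_sqrt_of_sq_le ?_
  have e : ∫ x, ((fun x : ℝ => |x|) ^ 2) x ∂gaussianReal 0 v = v := by
    simp only [Pi.pow_apply, sq_abs]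
    exact integral_sq_gaussianReal v
  rw [e] at h
  linarith

theorem mean_stdNormal_eq {ι : Type*} [Fintype ι] (a : ι → ℝ) :
    mean (stdNormal ι) (fun z => |∑ t, a t * z t|)
      = ENNReal.ofReal (∫ x, |x| ∂gaussianReal 0 (∑ t, a t ^ 2).toNNReal) := by
  have hI : Integrable (fun x : ℝ => |x|) (gaussianReal 0 (∑ t, a t ^ 2).toNNReal) := by
    simpa using (integrable_pow_gaussianReal _ 1).abs
  rw [ofReal_integral_eq_lintegral_ofReal hI (ae_of_all _ fun x => abs_nonneg x), mean,
    ← stdNormal_map_sum_mul, lintegral_map (by fun_prop) (by fun_prop)]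

end GaussianAbs

/-! ### Lower bound for `R` by the third moment of the scores -/

namespace Problem

open Matrix

variable {𝒳 Ω : Type*} [MeasurableSpace 𝒳] [MeasurableSpace Ω] {r q n : ℕ}
  {S : Problem 𝒳 Ω r q n}

theorem Regular.posDef (hR : S.Regular) : (S.fisher S.θ₀).PosDef :=
  hR.rc5.posDef _ hR.standing.θ₀_mem

theorem Regular.sum_sqrt_sq (hR : S.Regular) (s : Idx r q) :
    ∑ t, CFC.sqrt (S.fisher S.θ₀)⁻¹ s t ^ 2 = (S.fisher S.θ₀)⁻¹ s s := by
  have h := congrFun (congrFun (sqrt_mul_sqrt hR.posDef.inv.posSemidef) s) s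
  rw [← h, Matrix.mul_apply]
  refine Finset.sum_congr rfl fun t _ => ?_
  have := congrFun (congrFun (transpose_sqrt (S.fisher S.θ₀)⁻¹) s) t
  rw [transpose_apply] at this
  rw [this, sq]

theorem Regular.gaussAbs_eq (hR : S.Regular) (s : Idx r q) :
    S.gaussAbs s = ENNReal.ofReal (∫ x, |x| ∂gaussianReal 0 ((S.fisher S.θ₀)⁻¹ s s).toNNReal) := by
  rw [← hR.sum_sqrt_sq s, ← mean_stdNormal_eq]
  rfl

theorem Regular.le_gaussAbs (hR : S.Regular) (s : Idx r q) :
    ENNReal.ofReal √((S.fisher S.θ₀)⁻¹ s s / 3) ≤ S.gaussAbs s := by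
  rw [hR.gaussAbs_eq]
  refine ENNReal.ofReal_le_ofReal ((le_of_eq ?_).trans
    (sqrt_div_three_le_integral_abs_gaussianReal _))
  rw [Real.coe_toNNReal _ hR.posDef.inv.diag_pos.le]

theorem Regular.gaussAbs_le (hR : S.Regular) (s : Idx r q) :
    S.gaussAbs s ≤ ENNReal.ofReal √((S.fisher S.θ₀)⁻¹ s s) := by
  rw [hR.gaussAbs_eq]
  refine ENNReal.ofReal_le_ofReal ((integral_abs_gaussianReal_le _).trans_eq ?_)
  rw [Real.coe_toNNReal _ hR.posDef.inv.diag_pos.le]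

theorem Regular.memLp_two_score (hR : S.Regular) (j : Idx r q) :
    MemLp (S.score j S.θ₀) 2 (S.law S.θ₀) := by
  have := hR.standing.prob_law _ hR.standing.θ₀_mem
  exact (hR.o3 j).mono_exponent (by norm_num)

theorem Regular.mean_W_sq (hR : S.Regular) (hn : 1 ≤ n) (t : Idx r q) :
    mean S.P (fun ω => S.W t ω ^ 2) = ENNReal.ofReal (S.fisher S.θ₀ t t) := by
  have hS := hR.standing
  have := hS.prob_law _ hS.θ₀_mem
  have hn0 : (0 : ℝ) < n := by exact_mod_cast hn
  have h0 := (hR.rc4 _ hS.θ₀_mem t).2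
  have hL := hR.memLp_two_score t
  have h := hS.mean_sq_sum_sub hL
  simp only [h0, mul_zero, sub_zero] at h
  have hV : evariance (S.score t S.θ₀) (S.law S.θ₀) = ENNReal.ofReal (S.fisher S.θ₀ t t) := by
    rw [← hL.ofReal_variance_eq,
      variance_of_integral_eq_zero hL.aestronglyMeasurable.aemeasurable h0]
    simp only [fisher, of_apply, sq]
  rw [hV] at h
  calc mean S.P (fun ω => S.W t ω ^ 2)
      = ENNReal.ofReal (n : ℝ)⁻¹ * mean S.P (fun ω => (∑ i, S.score t S.θ₀ (S.X i ω)) ^ 2) := by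
        rw [mean, mean, ← lintegral_const_mul' _ _ ENNReal.ofReal_ne_top]
        refine lintegral_congr fun ω => ?_
        rw [← ENNReal.ofReal_mul (by positivity), W, mul_pow, inv_pow, Real.sq_sqrt hn0.le]
        rfl
    _ = _ := by
        rw [h, ← mul_assoc, ← ENNReal.ofReal_natCast n, ← ENNReal.ofReal_mul (by positivity),
          inv_mul_cancel₀ hn0.ne', ENNReal.ofReal_one, one_mul]

/-- The third moment of the sum of the absolute values of the scores. -/
noncomputable def scoreCube (S : Problem 𝒳 Ω r q n) : ℝ≥0∞ :=
  ∫⁻ x, (∑ j, ‖S.score j S.θ₀ x‖ₑ) ^ 3 ∂(S.law S.θ₀)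

theorem Regular.sum_mean_triple (hR : S.Regular) (i : Fin n) :
    ∑ j, ∑ k, ∑ l, mean S.P (fun ω => |S.Y j i ω * S.Y k i ω * S.Y l i ω|) = S.scoreCube := by
  have hm : ∀ j, AEMeasurable (S.score j S.θ₀) (S.law S.θ₀) := fun j =>
    (hR.o3 j).aestronglyMeasurable.aemeasurable
  have h1 : ∀ j k l, mean S.P (fun ω => |S.Y j i ω * S.Y k i ω * S.Y l i ω|)
      = ∫⁻ x, ‖S.score j S.θ₀ x‖ₑ * ‖S.score k S.θ₀ x‖ₑ * ‖S.score l S.θ₀ x‖ₑ ∂(S.law S.θ₀) := by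
    intro j k l
    rw [← hR.standing.lintegral_comp (by fun_prop) i]
    refine lintegral_congr fun ω => ?_
    rw [← Real.enorm_eq_ofReal_abs, enorm_mul, enorm_mul]
    rfl
  simp only [h1]
  have h2 : ∀ j k, ∑ l, ∫⁻ x, ‖S.score j S.θ₀ x‖ₑ * ‖S.score k S.θ₀ x‖ₑ * ‖S.score l S.θ₀ x‖ₑ
      ∂(S.law S.θ₀) = ∫⁻ x, ∑ l, ‖S.score j S.θ₀ x‖ₑ * ‖S.score k S.θ₀ x‖ₑ * ‖S.score l S.θ₀ x‖ₑ
      ∂(S.law S.θ₀) := fun j k => (lintegral_finsetSum' _ fun l _ => by fun_prop).symm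
  simp only [h2]
  have h3 : ∀ j, ∑ k, ∫⁻ x, ∑ l, ‖S.score j S.θ₀ x‖ₑ * ‖S.score k S.θ₀ x‖ₑ * ‖S.score l S.θ₀ x‖ₑ
      ∂(S.law S.θ₀) = ∫⁻ x, ∑ k, ∑ l, ‖S.score j S.θ₀ x‖ₑ * ‖S.score k S.θ₀ x‖ₑ
        * ‖S.score l S.θ₀ x‖ₑ ∂(S.law S.θ₀) :=
    fun j => (lintegral_finsetSum' _ fun k _ => by fun_prop).symm
  simp only [h3]
  rw [← lintegral_finsetSum' _ fun j _ => by fun_prop, scoreCube]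
  refine lintegral_congr fun x => ?_
  rw [pow_three', Finset.sum_mul_sum, Finset.sum_mul_sum]
  refine Finset.sum_congr rfl fun j _ => ?_
  simp only [Finset.sum_mul]
  rw [Finset.sum_comm]

/-- All summands of `R` are nonnegative, and only `8cd ∑_t 4 E|Y_j Y_k Y_l| E W_t²` is kept. As `∑_t
E W_t² = tr I`, it totals `32 c² d E|G_s| tr I` times the third moment of the summed absolute
scores. It remains to compare with `r c^{3/2}`, uniformly in `s`. -/
theorem Regular.le_R (hR : S.Regular) (hn : 1 ≤ n) (U : Matrix (Fin r) (Fin r) ℝ)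
    (D : Matrix (Fin r) (Fin q) ℝ)
    (hcard : (r : ℝ) ≤ cConst U D * ((r + q : ℕ) * ∑ j, S.fisher S.θ₀ j j)) :
    ENNReal.ofReal (32 / √3 * r * √(cConst U D) ^ 3) * S.scoreCube ≤ S.R U D := by
  rw [R]
  refine le_iInf fun s => ?_
  set c : ℝ≥0 := cConst U D with hc
  set tr : ℝ := ∑ j, S.fisher S.θ₀ j j with htr
  have hn0 : (n : ℝ≥0∞) ≠ 0 := by exact_mod_cast (by omega : n ≠ 0)
  have hdiag : ∀ j, 0 < S.fisher S.θ₀ j j := fun j => hR.posDef.diag_pos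
  have hW : ∑ t, mean S.P (fun ω => S.W t ω ^ 2) = ENNReal.ofReal tr := by
    rw [htr, ENNReal.ofReal_sum_of_nonneg fun j _ => (hdiag j).le]
    exact Finset.sum_congr rfl fun t _ => hR.mean_W_sq hn t
  have hsum : ∀ i : Fin n, (8 * c * ((r + q : ℕ) : ℝ≥0∞) * (4 * ENNReal.ofReal tr)) * S.scoreCube
      ≤ ∑ j : Idx r q, ∑ k : Idx r q, ∑ l : Idx r q,
        8 * c * ((r + q : ℕ) : ℝ≥0∞) * ∑ t : Idx r q,
          (4 * mean S.P (fun ω => |S.Y j i ω * S.Y k i ω * S.Y l i ω|)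
            * mean S.P (fun ω => S.W t ω ^ 2)) := by
    intro i
    rw [← hR.sum_mean_triple i]
    simp only [Finset.mul_sum]
    refine Finset.sum_le_sum fun j _ => Finset.sum_le_sum fun k _ => Finset.sum_le_sum fun l _ => ?_
    rw [← hW]
    simp only [Finset.mul_sum, Finset.sum_mul]
    exact Finset.sum_le_sum fun t _ => le_of_eq (by ring)
  have hreal : 32 / √3 * r * √(c : ℝ) ^ 3
      ≤ c * √((S.fisher S.θ₀)⁻¹ s s / 3) * (8 * c * (r + q : ℕ) * (4 * tr)) := by
    have hJ0 : 0 < (S.fisher S.θ₀)⁻¹ s s := hR.posDef.inv.diag_pos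
    have htr0 : S.fisher S.θ₀ s s ≤ tr :=
      Finset.single_le_sum (f := fun j => S.fisher S.θ₀ j j) (fun j _ => (hdiag j).le)
        (Finset.mem_univ s)
    have htrp : 0 < tr := (hdiag s).trans_le htr0
    have hJt : 1 ≤ (S.fisher S.θ₀)⁻¹ s s * tr :=
      (one_le_inv_mul_diag hR.posDef s).trans (mul_le_mul_of_nonneg_left htr0 hJ0.le)
    set u := √(c : ℝ) with hu
    have hu0 : 0 ≤ u := Real.sqrt_nonneg _
    have hu2 : u ^ 2 = c := Real.sq_sqrt c.2
    rw [Real.sqrt_div hJ0.le, ← hu2]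
    set a := √((S.fisher S.θ₀)⁻¹ s s) with ha
    have ha0 : 0 ≤ a := Real.sqrt_nonneg _
    have ha2 : a ^ 2 = (S.fisher S.θ₀)⁻¹ s s := Real.sq_sqrt hJ0.le
    rw [← ha2] at hJt
    rw [← hu2] at hcard
    have hd : (r : ℝ) ≤ (r + q : ℕ) := by exact_mod_cast Nat.le_add_right r q
    set d : ℝ := ((r + q : ℕ) : ℝ) with hdd
    have hr0 : (0 : ℝ) ≤ r := by positivity
    -- In squared form: `r ≤ d` and `r ≤ c d tr I` give `r² ≤ c d² tr I`, and a further factor `J_ss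
    -- tr I ≥ 1` is inserted.
    have hkey : (r : ℝ) ≤ u * d * (a * tr) := by
      refine le_of_sq_le_sq ?_ (by positivity)
      have h1 : (r : ℝ) * r ≤ d * (u ^ 2 * (d * tr)) := mul_le_mul hd hcard hr0 (by positivity)
      have h2 : d * (u ^ 2 * (d * tr)) * 1 ≤ d * (u ^ 2 * (d * tr)) * (a ^ 2 * tr) := by gcongr
      nlinarith [h1, h2]
    have h3 : (0 : ℝ) < √3 := by positivity
    have : u ^ 2 * (a / √3) * (8 * u ^ 2 * d * (4 * tr))
        = 32 / √3 * (u * d * (a * tr)) * u ^ 3 := by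
      field_simp
      ring
    rw [this]
    gcongr
  have hE : ENNReal.ofReal (32 / √3 * r * √(c : ℝ) ^ 3)
      ≤ c * S.gaussAbs s * (8 * c * ((r + q : ℕ) : ℝ≥0∞) * (4 * ENNReal.ofReal tr)) := by
    have htr0 : 0 ≤ tr := Finset.sum_nonneg fun j _ => (hdiag j).le
    refine (ENNReal.ofReal_le_ofReal hreal).trans ?_
    rw [ENNReal.ofReal_mul (by positivity), ENNReal.ofReal_mul (by positivity),
      ENNReal.ofReal_mul (by positivity), ENNReal.ofReal_mul (by positivity),
      ENNReal.ofReal_mul (by positivity), ENNReal.ofReal_mul (by positivity),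
      ENNReal.ofReal_natCast, ENNReal.ofReal_coe_nnreal,
      show ENNReal.ofReal 8 = 8 by simp, show ENNReal.ofReal 4 = 4 by simp]
    gcongr
    exact hR.le_gaussAbs s
  calc ENNReal.ofReal (32 / √3 * r * √(c : ℝ) ^ 3) * S.scoreCube
      ≤ c * S.gaussAbs s * (8 * c * ((r + q : ℕ) : ℝ≥0∞) * (4 * ENNReal.ofReal tr))
          * S.scoreCube := by
        gcongr
    _ = c / n * S.gaussAbs s * ∑ _i : Fin n,
          (8 * c * ((r + q : ℕ) : ℝ≥0∞) * (4 * ENNReal.ofReal tr)) * S.scoreCube := by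
        rw [Finset.sum_const, Finset.card_univ, Fintype.card_fin, nsmul_eq_mul]
        calc _ = (c * ((n : ℝ≥0∞)⁻¹ * n)) * S.gaussAbs s
              * ((8 * c * ((r + q : ℕ) : ℝ≥0∞) * (4 * ENNReal.ofReal tr)) * S.scoreCube) := by
              rw [ENNReal.inv_mul_cancel hn0 (ENNReal.natCast_ne_top n)]; ring
          _ = _ := by rw [div_eq_mul_inv]; ring
    _ ≤ _ := by
        refine mul_le_mul_right (Finset.sum_le_sum fun i _ => (hsum i).trans ?_) _
        refine Finset.sum_le_sum fun j _ => Finset.sum_le_sum fun k _ =>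
          Finset.sum_le_sum fun l _ => ?_
        refine le_trans ?_ le_self_add
        refine le_trans ?_ le_add_self
        refine mul_le_mul_right (Finset.sum_le_sum fun t _ => ?_) _
        rw [add_assoc]
        exact le_self_add

end Problem

/-! ### The chi-square approximation for the quadratic form in the score -/

theorem integral_chiSq (r : ℕ) {h : ℝ → ℝ} (hh : Continuous h) :
    ∫ y, h y ∂chiSq r
      = ∫ x : EuclideanSpace ℝ (Fin r), h (‖x‖ ^ 2) ∂stdGaussian (EuclideanSpace ℝ (Fin r)) := by
  have hm : Measurable fun z : Fin r → ℝ => ∑ i, z i ^ 2 := by fun_prop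
  rw [chiSq, integral_map hm.aemeasurable (by fun_prop), ← map_pi_eq_stdGaussian,
    integral_map (by fun_prop) (by fun_prop), stdNormal]
  simp only [EuclideanSpace.real_norm_sq_eq]

namespace Problem

open Matrix

variable {𝒳 Ω : Type*} [MeasurableSpace 𝒳] [MeasurableSpace Ω] {r q n : ℕ}
  {S : Problem 𝒳 Ω r q n}

/-- A measurable version of the score at the true parameter. -/
noncomputable def Regular.scoreMk (hR : S.Regular) (x : 𝒳) (j : Idx r q) : ℝ :=
  (hR.o3 j).aestronglyMeasurable.aemeasurable.mk _ x

theorem Regular.measurable_scoreMk (hR : S.Regular) (j : Idx r q) :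
    Measurable fun x => hR.scoreMk x j :=
  (hR.o3 j).aestronglyMeasurable.aemeasurable.measurable_mk

theorem Regular.scoreMk_ae_eq (hR : S.Regular) :
    ∀ᵐ x ∂(S.law S.θ₀), hR.scoreMk x = fun j => S.score j S.θ₀ x := by
  have : ∀ᵐ x ∂(S.law S.θ₀), ∀ j, S.score j S.θ₀ x = hR.scoreMk x j :=
    ae_all_iff.2 fun j => (hR.o3 j).aestronglyMeasurable.aemeasurable.ae_eq_mk
  filter_upwards [this] with x hx
  exact funext fun j => (hx j).symm

/-- The whitened score, divided by the square root of the sample size. -/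
noncomputable def Regular.whiteScore (hR : S.Regular) (L : Matrix (Fin r) (Idx r q) ℝ) (x : 𝒳) :
    EuclideanSpace ℝ (Fin r) :=
  (√(n : ℝ))⁻¹ • WithLp.toLp 2 (L *ᵥ hR.scoreMk x)

theorem Regular.measurable_whiteScore (hR : S.Regular) (L : Matrix (Fin r) (Idx r q) ℝ) :
    Measurable (hR.whiteScore L) := by
  have := hR.measurable_scoreMk
  have hm : Measurable fun x => L *ᵥ hR.scoreMk x := by
    refine measurable_pi_iff.2 fun i => ?_
    simp only [mulVec, dotProduct]
    fun_prop
  unfold whiteScore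
  fun_prop

theorem Regular.norm_whiteScore_pow_le (hR : S.Regular) {L : Matrix (Fin r) (Idx r q) ℝ} {c : ℝ}
    (hL : ∀ j k, |(Lᵀ * L) j k| ≤ c) (hc : 0 ≤ c) (x : 𝒳) :
    ‖hR.whiteScore L x‖ ^ 3 ≤ ((√(n : ℝ))⁻¹ * √c) ^ 3 * (∑ j, |hR.scoreMk x j|) ^ 3 := by
  rw [← mul_pow]
  refine pow_le_pow_left₀ (norm_nonneg _) ?_ 3
  rw [whiteScore, norm_smul, Real.norm_of_nonneg (by positivity), mul_assoc]
  gcongr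
  rw [← Real.sqrt_sq (show 0 ≤ ∑ j, |hR.scoreMk x j| from
      Finset.sum_nonneg fun _ _ => abs_nonneg _),
    ← Real.sqrt_mul hc, EuclideanSpace.norm_eq]
  refine Real.sqrt_le_sqrt ?_
  simp only [Real.norm_eq_abs, sq_abs]
  exact sum_sq_mulVec_le L hL _

theorem Regular.memLp_scoreMk (hR : S.Regular) (j : Idx r q) :
    MemLp (fun x => hR.scoreMk x j) 5 (S.law S.θ₀) :=
  (memLp_congr_ae (hR.scoreMk_ae_eq.mono fun _ hx => congrFun hx j)).2 (hR.o3 j)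

theorem Regular.integrable_sum_abs_pow (hR : S.Regular) :
    Integrable (fun x => (∑ j, |hR.scoreMk x j|) ^ 3) (S.law S.θ₀) := by
  have := hR.standing.prob_law _ hR.standing.θ₀_mem
  have h : MemLp (fun x => ∑ j, |hR.scoreMk x j|) 3 (S.law S.θ₀) :=
    memLp_finsetSum _ fun j _ => ((hR.memLp_scoreMk j).mono_exponent (by norm_num)).abs
  have := h.integrable_norm_pow (by norm_num)
  refine this.congr (ae_of_all _ fun x => ?_)
  beta_reduce
  rw [Real.norm_of_nonneg (Finset.sum_nonneg fun _ _ => abs_nonneg _)]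

theorem Regular.ofReal_integral_sum_abs_pow (hR : S.Regular) :
    ENNReal.ofReal (∫ x, (∑ j, |hR.scoreMk x j|) ^ 3 ∂(S.law S.θ₀)) = S.scoreCube := by
  rw [ofReal_integral_eq_lintegral_ofReal hR.integrable_sum_abs_pow
    (ae_of_all _ fun x => pow_nonneg (Finset.sum_nonneg fun _ _ => abs_nonneg _) 3), scoreCube]
  refine lintegral_congr_ae ?_
  filter_upwards [hR.scoreMk_ae_eq] with x hx
  rw [hx, ENNReal.ofReal_pow (Finset.sum_nonneg fun _ _ => abs_nonneg _),
    ENNReal.ofReal_sum_of_nonneg fun _ _ => abs_nonneg _]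
  simp only [Real.enorm_eq_ofReal_abs]

theorem Regular.inner_whiteScore (hR : S.Regular) (L : Matrix (Fin r) (Idx r q) ℝ)
    (a : EuclideanSpace ℝ (Fin r)) (x : 𝒳) :
    inner ℝ a (hR.whiteScore L x) = (√(n : ℝ))⁻¹ * ∑ j, (a.ofLp ᵥ* L) j * hR.scoreMk x j := by
  rw [whiteScore, inner_smul_right]
  congr 1
  change _ = (a.ofLp ᵥ* L) ⬝ᵥ hR.scoreMk x
  rw [← dotProduct_mulVec]
  simp [PiLp.inner_apply, dotProduct, mul_comm]

theorem Regular.isIsotropic_whiteScore (hR : S.Regular) {L : Matrix (Fin r) (Idx r q) ℝ}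
    (h1 : L * S.fisher S.θ₀ * Lᵀ = 1) {c : ℝ} (hL : ∀ j k, |(Lᵀ * L) j k| ≤ c) (hc : 0 ≤ c) :
    IsIsotropic ((S.law S.θ₀).map (hR.whiteScore L)) ((√(n : ℝ))⁻¹ ^ 2) where
  prob := by
    have := hR.standing.prob_law _ hR.standing.θ₀_mem
    exact Measure.isProbabilityMeasure_map (hR.measurable_whiteScore L).aemeasurable
  integrable := by
    rw [integrable_map_measure (by fun_prop) (hR.measurable_whiteScore L).aemeasurable]
    refine (hR.integrable_sum_abs_pow.const_mul (((√(n : ℝ))⁻¹ * √c) ^ 3)).mono'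
      ((hR.measurable_whiteScore L).norm.pow_const 3).aestronglyMeasurable
      (ae_of_all _ fun x => ?_)
    simp only [Function.comp_apply]
    rw [Real.norm_of_nonneg (by positivity)]
    exact hR.norm_whiteScore_pow_le hL hc x
  mean a := by
    rw [integral_map (hR.measurable_whiteScore L).aemeasurable (by fun_prop)]
    simp only [hR.inner_whiteScore]
    have := hR.standing.prob_law _ hR.standing.θ₀_mem
    have hi : ∀ j, Integrable (fun x => hR.scoreMk x j) (S.law S.θ₀) := fun j =>
      (hR.memLp_scoreMk j).integrable (by norm_num)
    rw [integral_const_mul, integral_finsetSum _ fun j _ => (hi j).const_mul _]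
    have h0 : ∀ j, ∫ x, hR.scoreMk x j ∂(S.law S.θ₀) = 0 := fun j =>
      (integral_congr_ae (hR.scoreMk_ae_eq.mono fun x hx => congrFun hx j)).trans
        (hR.rc4 _ hR.standing.θ₀_mem j).2
    simp [integral_const_mul, h0]
  cov a := by
    rw [integral_map (hR.measurable_whiteScore L).aemeasurable (by fun_prop)]
    simp only [hR.inner_whiteScore]
    have hae : ∀ j k, (fun x => hR.scoreMk x j * hR.scoreMk x k) =ᵐ[S.law S.θ₀]
        fun x => S.score j S.θ₀ x * S.score k S.θ₀ x := fun j k =>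
      hR.scoreMk_ae_eq.mono fun x hx => by simp only [hx]
    have hi : ∀ j k, Integrable (fun x => hR.scoreMk x j * hR.scoreMk x k) (S.law S.θ₀) :=
      fun j k => (hR.rc5.integrable _ hR.standing.θ₀_mem j k).congr (hae j k).symm
    have hI : ∀ j k, ∫ x, hR.scoreMk x j * hR.scoreMk x k ∂(S.law S.θ₀) = S.fisher S.θ₀ j k :=
      fun j k => integral_congr_ae (hae j k)
    set b := a.ofLp ᵥ* L with hb
    have e : ∀ x, ((√(n : ℝ))⁻¹ * ∑ j, b j * hR.scoreMk x j) ^ 2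
        = (√(n : ℝ))⁻¹ ^ 2 * ∑ j, ∑ k, b j * b k * (hR.scoreMk x j * hR.scoreMk x k) := by
      intro x
      rw [mul_pow, sq (∑ j, b j * hR.scoreMk x j), Finset.sum_mul_sum]
      congr 1
      exact Finset.sum_congr rfl fun j _ => Finset.sum_congr rfl fun k _ => by ring
    simp only [e]
    rw [integral_const_mul, integral_finsetSum _ fun j _ =>
      integrable_finsetSum _ fun k _ => (hi j k).const_mul _]
    congr 1
    have e2 : ∀ j, ∫ x, ∑ k, b j * b k * (hR.scoreMk x j * hR.scoreMk x k) ∂(S.law S.θ₀)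
        = b j * ∑ k, S.fisher S.θ₀ j k * b k := by
      intro j
      rw [integral_finsetSum _ fun k _ => (hi j k).const_mul _, Finset.mul_sum]
      exact Finset.sum_congr rfl fun k _ => by rw [integral_const_mul, hI]; ring
    rw [Finset.sum_congr rfl fun j _ => e2 j]
    change b ⬝ᵥ S.fisher S.θ₀ *ᵥ b = _
    have hb' : b = Lᵀ *ᵥ a.ofLp := by rw [mulVec_transpose]
    rw [dotProduct_mulVec, hb, vecMul_vecMul, ← hb, hb', dotProduct_mulVec, vecMul_vecMul, h1,
      vecMul_one, EuclideanSpace.real_norm_sq_eq]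
    simp only [dotProduct, sq]

theorem Regular.norm_sq_sum_whiteScore (hR : S.Regular) (L : Matrix (Fin r) (Idx r q) ℝ) :
    ∀ᵐ ω ∂S.P, ‖(∑ i, fun ω => hR.whiteScore L (S.X i ω)) ω‖ ^ 2
      = (fun j => S.W j ω) ⬝ᵥ (Lᵀ * L) *ᵥ fun j => S.W j ω := by
  have : ∀ᵐ ω ∂S.P, ∀ i, hR.scoreMk (S.X i ω) = fun j => S.score j S.θ₀ (S.X i ω) := by
    refine ae_all_iff.2 fun i => ?_
    have h := hR.scoreMk_ae_eq
    rw [← hR.standing.law_X i] at h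
    exact ae_of_ae_map (hR.standing.measurable_X i).aemeasurable h
  filter_upwards [this] with ω hω
  have e : (∑ i, fun ω => hR.whiteScore L (S.X i ω)) ω
      = WithLp.toLp 2 (L *ᵥ fun j => S.W j ω) := by
    have hW : (fun j => S.W j ω) = (√(n : ℝ))⁻¹ • ∑ i, fun j => S.score j S.θ₀ (S.X i ω) := by
      ext j
      simp [W, Y]
    rw [Finset.sum_apply, hW, mulVec_smul, mulVec_sum, WithLp.toLp_smul, WithLp.toLp_sum,
      Finset.smul_sum]
    exact Finset.sum_congr rfl fun i _ => by rw [whiteScore, hω i]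
  rw [e, EuclideanSpace.real_norm_sq_eq, ← mulVec_mulVec, dotProduct_mulVec, vecMul_transpose]
  simp only [dotProduct, sq]

/-- The chi-square approximation for the quadratic form. -/
theorem Regular.abs_integral_scoreForm_sub_le (hR : S.Regular) (hr : 1 ≤ r) (hn : 1 ≤ n)
    {h : ℝ → ℝ} (hh : IsCb2 h) :
    ENNReal.ofReal |∫ ω, h (S.scoreForm id (S.fisher S.θ₀)⁻¹ ω - S.scoreForm Sum.inr S.C⁻¹ ω) ∂S.P
        - ∫ y, h y ∂chiSq r|
      ≤ ENNReal.ofReal (2 * (supNorm (deriv h) + supNorm (deriv (deriv h))) / √n) *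
        S.R (S.A - S.B * S.C⁻¹ * S.B.transpose)⁻¹ (S.B * S.C⁻¹) := by
  have hS := hR.standing
  set U := (S.A - S.B * S.C⁻¹ * S.B.transpose)⁻¹ with hU
  set D := S.B * S.C⁻¹ with hD
  have hn0 : (0 : ℝ) < n := by exact_mod_cast hn
  have hsn : 0 < √(n : ℝ) := Real.sqrt_pos.2 hn0
  obtain ⟨L, hL1, hL2⟩ := exists_whitening hR.posDef hU hD
  have hUt : Uᵀ = U := transpose_eq_of_isHermitian (posDef_schur hR.posDef).isHermitian.inv
  have hLc : ∀ j k, |(Lᵀ * L) j k| ≤ cConst U D := fun j k => by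
    rw [hL2]; exact abs_fromBlocks_le_cConst hUt D j k
  have hcard : (r : ℝ) ≤ cConst U D * ((r + q : ℕ) * ∑ j, S.fisher S.θ₀ j j) := by
    have := card_le_of_whitening hR.posDef.posSemidef hL1 (cConst U D).2 hLc
    simpa using this
  -- The difference of the two score forms is a squared norm, `‖L w‖²`.
  have hform : ∀ w : Idx r q → ℝ, w ⬝ᵥ (Lᵀ * L) *ᵥ w = w ⬝ᵥ (S.fisher S.θ₀)⁻¹ *ᵥ w
      - (fun k => w (Sum.inr k)) ⬝ᵥ S.C⁻¹ *ᵥ fun k => w (Sum.inr k) := by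
    intro w
    have e : (S.fisher S.θ₀)⁻¹ = Lᵀ * L + fromBlocks 0 0 0 S.C⁻¹ := by
      rw [inv_eq_fromBlocks hR.posDef hU hD, hL2, fromBlocks_add, add_zero, add_zero, add_zero]
      rfl
    have e2 : w ⬝ᵥ fromBlocks 0 0 0 S.C⁻¹ *ᵥ w
        = (fun k => w (Sum.inr k)) ⬝ᵥ S.C⁻¹ *ᵥ fun k => w (Sum.inr k) := by
      rw [fromBlocks_mulVec]
      simp only [dotProduct, Fintype.sum_sum_type, Sum.elim_inl, Sum.elim_inr, zero_mulVec,
        zero_add, add_zero, Pi.zero_apply, mul_zero, Finset.sum_const_zero]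
      rfl
    rw [e, add_mulVec, dotProduct_add, e2, add_sub_cancel_right]
  set ρ := (S.law S.θ₀).map (hR.whiteScore L) with hρ
  have hiso := hR.isIsotropic_whiteScore hL1 hLc (cConst U D).2
  have hmeas : ∀ i, Measurable fun ω => hR.whiteScore L (S.X i ω) := fun i =>
    (hR.measurable_whiteScore L).comp (hS.measurable_X i)
  have hconv : S.P.map (∑ i, fun ω => hR.whiteScore L (S.X i ω)) = convPow ρ n := by
    have := map_sum_eq_convPow hmeas
      (hS.indep.comp (fun _ => hR.whiteScore L) fun _ => hR.measurable_whiteScore L) (ρ := ρ)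
      (fun i => by
        rw [hρ, ← hS.law_X i, Measure.map_map (hR.measurable_whiteScore L) (hS.measurable_X i)]
        rfl) Finset.univ
    simpa using this
  have hint : ∫ ω, h (S.scoreForm id (S.fisher S.θ₀)⁻¹ ω - S.scoreForm Sum.inr S.C⁻¹ ω) ∂S.P
      = ∫ x, h (‖x‖ ^ 2) ∂convPow ρ n := by
    have hc := hh.contDiff.continuous
    have hm : Measurable (∑ i, fun ω => hR.whiteScore L (S.X i ω)) := by
      rw [Finset.sum_fn]
      exact Finset.measurable_sum _ fun i _ => hmeas i
    rw [← hconv, integral_map hm.aemeasurable (by fun_prop)]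
    refine integral_congr_ae ?_
    filter_upwards [hR.norm_sq_sum_whiteScore L] with ω hω
    rw [hω, hform]
    rfl
  have hmain := hh.derivBounds.abs_integral_convPow_sub_le hh.bdd
    (E := EuclideanSpace ℝ (Fin r)) (by simpa using hr) hn hiso
  rw [hint, integral_chiSq r hh.contDiff.continuous]
  refine (ENNReal.ofReal_le_ofReal hmain).trans ?_
  refine le_trans ?_ (mul_le_mul_right (hR.le_R hn U D hcard) _)
  have hH : 0 ≤ supNorm (deriv h) + supNorm (deriv (deriv h)) :=
    add_nonneg hh.derivBounds.nonneg_fst hh.derivBounds.nonneg_snd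
  set H := supNorm (deriv h) + supNorm (deriv (deriv h))
  set β := ∫ x, (∑ j, |hR.scoreMk x j|) ^ 3 ∂(S.law S.θ₀) with hβ
  have hβ0 : 0 ≤ β :=
    integral_nonneg fun x => pow_nonneg (Finset.sum_nonneg fun _ _ => abs_nonneg _) 3
  rw [← hR.ofReal_integral_sum_abs_pow, ← ENNReal.ofReal_mul (by positivity),
    ← ENNReal.ofReal_mul (by positivity)]
  refine ENNReal.ofReal_le_ofReal ?_
  have hρ3 : ∫ v, ‖v‖ ^ 3 ∂ρ ≤ ((√(n : ℝ))⁻¹ * √(cConst U D : ℝ)) ^ 3 * β := by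
    rw [hρ, integral_map (hR.measurable_whiteScore L).aemeasurable (by fun_prop), hβ,
      ← integral_const_mul]
    refine integral_mono_of_nonneg (ae_of_all _ fun x => by positivity)
      (hR.integrable_sum_abs_pow.const_mul _)
      (ae_of_all _ fun x => hR.norm_whiteScore_pow_le hLc (cConst U D).2 x)
  have h3 : √(3 : ℝ) ^ 2 = 3 := Real.sq_sqrt (by norm_num)
  have h30 : 0 < √(3 : ℝ) := by positivity
  -- Numerically `13√3 + 39 < 61.6`. The value `64` is twice the `32` of the lower bound for `R`,
  -- the factor `2` being that in front of `R` in the theorem.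
  have hnum : 13 * (1 + √(3 : ℝ)) ≤ 64 / √3 := by
    rw [le_div_iff₀ h30]
    nlinarith [h3, h30]
  rw [finrank_euclideanSpace_fin]
  calc 13 * (1 + √3) * r * H * (n * ∫ v, ‖v‖ ^ 3 ∂ρ)
      ≤ 64 / √3 * r * H * (n * (((√(n : ℝ))⁻¹ * √(cConst U D : ℝ)) ^ 3 * β)) := by gcongr
    _ = 2 * H / √n * (32 / √3 * r * √(cConst U D : ℝ) ^ 3 * β) := by
        have e : (n : ℝ) = √n ^ 2 := (Real.sq_sqrt hn0.le).symm
        set w := √(n : ℝ)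
        rw [e]
        field_simp
        ring

/-- The bound on the distance to the chi-square distribution. -/
theorem Regular.abs_integral_llr_sub_le (hR : S.Regular) (hr : 1 ≤ r) (hn : 1 ≤ n) {ε : ℝ}
    (hε : 0 < ε) (hε₀ : ε ≤ S.ε₀) {h : ℝ → ℝ} (hh : IsCb2 h) :
    ENNReal.ofReal |∫ ω, h (S.llr ω) ∂S.P - ∫ y, h y ∂chiSq r| ≤ S.bound h ε := by
  have := hR.standing.prob
  have hc := hh.contDiff.continuous
  have hint : ∀ {g : Ω → ℝ}, AEMeasurable g S.P → Integrable (fun ω => h (g ω)) S.P := fun hg =>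
    Integrable.of_bound (hc.measurable.comp_aemeasurable hg).aestronglyMeasurable (supNorm h)
      (ae_of_all _ fun ω => hh.abs_le _)
  have i1 := hint hR.aemeasurable_llr
  have i2 := hint ((hR.aemeasurable_scoreForm id (S.fisher S.θ₀)⁻¹).sub
    (hR.aemeasurable_scoreForm Sum.inr S.C⁻¹))
  refine (ENNReal.ofReal_le_ofReal (abs_sub_le _ (∫ ω, h (S.scoreForm id (S.fisher S.θ₀)⁻¹ ω
    - S.scoreForm Sum.inr S.C⁻¹ ω) ∂S.P) _)).trans (ENNReal.ofReal_add_le.trans ?_)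
  rw [bound, add_comm]
  refine add_le_add (hR.abs_integral_scoreForm_sub_le hr hn hh) ?_
  refine le_trans ?_ (hR.lintegral_llr_le hn hε hε₀ hh)
  have e := integral_sub i1 i2
  simp only [Pi.sub_apply] at e
  rw [← e]
  refine (ENNReal.ofReal_le_ofReal abs_integral_le_integral_abs).trans_eq ?_
  exact ofReal_integral_eq_lintegral_ofReal (i1.sub i2).abs (ae_of_all _ fun ω => abs_nonneg _)

end Problem

/-! ### Orders of magnitude -/

section Moments

/-- If some factor exceeds `1`, the product is at most the `m`-th, hence the `p`-th, power of the
largest. This replaces Hölder's inequality where constants do not matter. -/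
theorem prod_le_one_add_sum_pow {m p : ℕ} (hmp : m ≤ p) (x : Fin m → ℝ≥0∞) :
    ∏ i, x i ≤ 1 + ∑ i, x i ^ p := by
  by_cases h : ∀ i, x i ≤ 1
  · exact (Finset.prod_le_one' fun i _ => h i).trans le_self_add
  · push Not at h
    obtain ⟨i₁, hi₁⟩ := h
    obtain ⟨i₀, -, hi₀⟩ := Finset.exists_max_image Finset.univ x ⟨i₁, Finset.mem_univ i₁⟩
    have h1 : 1 ≤ x i₀ := hi₁.le.trans (hi₀ i₁ (Finset.mem_univ _))
    calc ∏ i, x i ≤ ∏ _i : Fin m, x i₀ := Finset.prod_le_prod' fun i hi => hi₀ i hi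
      _ = x i₀ ^ m := by simp
      _ ≤ x i₀ ^ p := pow_le_pow_right₀ h1 hmp
      _ ≤ ∑ i, x i ^ p :=
          Finset.single_le_sum (f := fun i => x i ^ p) (fun _ _ => zero_le) (Finset.mem_univ i₀)
      _ ≤ _ := le_add_self

/-- Each factor is divided by its natural size `b` before the pointwise inequality is applied. Total
mass at most `1`, rather than equal to `1`, admits conditioning on a null event. -/
theorem lintegral_prod_le {α : Type*} [MeasurableSpace α] {μ : Measure α} (hμ : μ Set.univ ≤ 1)
    {m p : ℕ} (hmp : m ≤ p) {x : Fin m → α → ℝ≥0∞} (hx : ∀ i, AEMeasurable (x i) μ) {b B : ℝ≥0∞}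
    (hb : b ≠ 0) (hb' : b ≠ ∞) (hB : ∀ i, ∫⁻ a, x i a ^ p ∂μ ≤ B * b ^ p) :
    ∫⁻ a, ∏ i, x i a ∂μ ≤ (1 + m * B) * b ^ m := by
  have h1 : ∀ a, ∏ i, x i a = b ^ m * ∏ i, (b⁻¹ * x i a) := by
    intro a
    rw [Finset.prod_mul_distrib, Finset.prod_const, Finset.card_univ, Fintype.card_fin, ← mul_assoc,
      ← mul_pow, ENNReal.mul_inv_cancel hb hb', one_pow, one_mul]
  simp only [h1]
  rw [lintegral_const_mul' _ _ (ENNReal.pow_ne_top hb'), mul_comm]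
  gcongr
  calc ∫⁻ a, ∏ i, (b⁻¹ * x i a) ∂μ ≤ ∫⁻ a, (1 + ∑ i, (b⁻¹ * x i a) ^ p) ∂μ :=
        lintegral_mono fun a => prod_le_one_add_sum_pow hmp _
    _ = μ Set.univ + ∑ i, b⁻¹ ^ p * ∫⁻ a, x i a ^ p ∂μ := by
        rw [lintegral_add_left measurable_const, lintegral_one,
          lintegral_finsetSum' _ (by fun_prop)]
        congr 1
        refine Finset.sum_congr rfl fun i _ => ?_
        rw [← lintegral_const_mul'' _ (by fun_prop)]
        simp only [mul_pow]
    _ ≤ 1 + ∑ _i : Fin m, B := by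
        refine add_le_add hμ (Finset.sum_le_sum fun i _ => ?_)
        refine (mul_le_mul_right (hB i) _).trans_eq ?_
        rw [mul_left_comm, ← mul_pow, ENNReal.inv_mul_cancel hb hb', one_pow, mul_one]
    _ = 1 + m * B := by simp

/-- The order in `b` is kept exactly; the constant is simply not reduced, which is allowed because
`B ≥ 1`. -/
theorem rpow_inv_le {x B b : ℝ≥0∞} (hB : 1 ≤ B) {p : ℕ} (hp : p ≠ 0) (m : ℕ)
    (hx : x ≤ B * b ^ (m * p)) : x ^ (1 / (p : ℝ)) ≤ B * b ^ m := by
  have hp1 : (1 : ℝ) ≤ p := by exact_mod_cast Nat.one_le_iff_ne_zero.2 hp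
  have hp0 : (0 : ℝ) ≤ 1 / (p : ℝ) := by positivity
  refine (ENNReal.rpow_le_rpow hx hp0).trans ?_
  rw [ENNReal.mul_rpow_of_nonneg _ _ hp0, pow_mul]
  gcongr
  · calc B ^ (1 / (p : ℝ)) ≤ B ^ (1 : ℝ) :=
        ENNReal.rpow_le_rpow_of_exponent_le hB (by rw [div_le_one (by linarith)]; exact hp1)
      _ = B := ENNReal.rpow_one B
  · rw [one_div, ENNReal.pow_rpow_inv_natCast hp]

theorem sum_le_mul {ι : Type*} [Fintype ι] {e B : ℝ≥0∞} (he : (Fintype.card ι : ℝ≥0∞) ≤ e)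
    {f : ι → ℝ≥0∞} (hf : ∀ j, f j ≤ B) : ∑ j, f j ≤ e * B := by
  refine (Finset.sum_le_sum fun j _ => hf j).trans ?_
  rw [Finset.sum_const, Finset.card_univ, nsmul_eq_mul]
  gcongr

end Moments

/-! ### The orders of `K1` and `K2` -/

namespace ErrData

variable {ι Ω : Type*} [Fintype ι] [MeasurableSpace Ω] {E : ErrData ι Ω} {P : Measure Ω}
  {k w e : ℝ≥0∞}

theorem mean_prod_Q_le (hP : P Set.univ ≤ 1) (hQ : ∀ j, Measurable (E.Q j)) (hk : 1 ≤ k)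
    (hw : 1 ≤ w) (hw' : w ≠ ∞) (hQ8 : ∀ j, mean P (fun ω => E.Q j ω ^ 8) ≤ k * w⁻¹ ^ 8) {m : ℕ}
    (hm : m ≤ 8) (j : Fin m → ι) :
    ∫⁻ ω, ∏ i, ‖E.Q (j i) ω‖ₑ ∂P ≤ 9 * k * w⁻¹ ^ m := by
  have hw0 : w ≠ 0 := (zero_lt_one.trans_le hw).ne'
  refine (lintegral_prod_le hP hm (x := fun i ω => ‖E.Q (j i) ω‖ₑ) (B := k)
    (fun i => (hQ _).enorm.aemeasurable)
    (ENNReal.inv_ne_zero.2 hw') (ENNReal.inv_ne_top.2 hw0) (fun i => ?_)).trans ?_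
  · refine le_trans (le_of_eq ?_) (hQ8 (j i))
    exact lintegral_congr fun ω => (ofReal_pow_of_even _ (by decide)).symm
  · gcongr
    have : (m : ℝ≥0∞) ≤ 8 := by exact_mod_cast hm
    calc 1 + m * k ≤ k + 8 * k := by gcongr
      _ = 9 * k := by ring

/-- Here `w` stands for `√n`, `k` for the common constant and `e` for the dimension. In the first
sum `n` cancels `w⁻²`; in the second the three sixth moments combine to `w⁻¹ ≤ 1`. The weaker power
`e⁷` is used to match the order of `R`. -/
theorem K1_le (hP : P Set.univ ≤ 1) (hQ : ∀ j, Measurable (E.Q j)) {n : ℕ} (hk : 1 ≤ k)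
    (hw : 1 ≤ w) (hw' : w ≠ ∞) (hn : (n : ℝ≥0∞) = w ^ 2) (he : (Fintype.card ι : ℝ≥0∞) ≤ e)
    (he1 : 1 ≤ e) (hQ8 : ∀ j, mean P (fun ω => E.Q j ω ^ 8) ≤ k * w⁻¹ ^ 8)
    (hV : ∀ j l, E.V j l ≤ k) (hT : ∀ j l, mean P (fun ω => E.T j l ω ^ 6) ≤ k * w ^ 6)
    (hJ : ∀ j l, ENNReal.ofReal |E.J j l| ≤ k) : E.K1 P n ≤ 108 * k ^ 5 * e ^ 7 := by
  have hw0 : w ≠ 0 := (zero_lt_one.trans_le hw).ne'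
  have hww : w * w⁻¹ = 1 := ENNReal.mul_inv_cancel hw0 hw'
  have hwi : w⁻¹ ≤ 1 := ENNReal.inv_le_one.2 hw
  have hVh : ∀ j l, E.V j l ^ (1 / 2 : ℝ) ≤ k := fun j l => by
    simpa using rpow_inv_le hk two_ne_zero 0 (b := 1) (by simpa using hV j l)
  have hk9 : 1 ≤ 9 * k := hk.trans (le_mul_of_one_le_left zero_le (by norm_num))
  have h1 : ∀ j l, mean P (fun ω => E.Q j ω ^ 2 * E.Q l ω ^ 2) ^ (1 / 2 : ℝ) ≤ 9 * k * w⁻¹ ^ 2 := by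
    intro j l
    refine rpow_inv_le hk9 two_ne_zero 2 ?_
    refine le_trans (le_of_eq (lintegral_congr fun ω => ?_))
      (mean_prod_Q_le hP hQ hk hw hw' hQ8 (m := 4) (by norm_num) ![j, j, l, l])
    beta_reduce
    rw [← mul_pow, ofReal_pow_of_even _ even_two, enorm_mul, Fin.prod_univ_four]
    simp; ring
  have h6 : ∀ j, mean P (fun ω => E.Q j ω ^ 6) ≤ 9 * k * w⁻¹ ^ 6 := by
    intro j
    refine le_trans (le_of_eq (lintegral_congr fun ω => ?_))
      (mean_prod_Q_le hP hQ hk hw hw' hQ8 (m := 6) (by norm_num) fun _ => j)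
    rw [ofReal_pow_of_even _ (by decide)]
    simp
  have h2 : ∀ j l m, (mean P (fun ω => E.Q j ω ^ 6) * mean P (fun ω => E.Q l ω ^ 6)
      * mean P (fun ω => E.T m l ω ^ 6)) ^ (1 / 6 : ℝ) ≤ 81 * k ^ 3 := by
    intro j l m
    have hB : 1 ≤ 81 * k ^ 3 :=
      (one_le_pow₀ hk).trans (le_mul_of_one_le_left zero_le (by norm_num))
    have := rpow_inv_le (x := mean P (fun ω => E.Q j ω ^ 6) * mean P (fun ω => E.Q l ω ^ 6)
      * mean P (fun ω => E.T m l ω ^ 6)) hB (p := 6) (by norm_num) 1 (b := w⁻¹) (by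
        calc _ ≤ 9 * k * w⁻¹ ^ 6 * (9 * k * w⁻¹ ^ 6) * (k * w ^ 6) := by
              gcongr
              · exact h6 j
              · exact h6 l
              · exact hT m l
          _ = 81 * k ^ 3 * w⁻¹ ^ 6 * (w * w⁻¹) ^ 6 := by ring
          _ = 81 * k ^ 3 * w⁻¹ ^ (1 * 6) := by rw [hww]; simp)
    refine le_trans (by simpa using this) ?_
    exact mul_le_of_le_one_right zero_le hwi
  calc E.K1 P n
      ≤ 3 * (n : ℝ≥0∞) * (e * (e * (9 * k * w⁻¹ ^ 2 * k)))
        + e * (e * (k * (e * (e * (k * (81 * k ^ 3)))))) := by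
        unfold K1
        refine add_le_add (mul_le_mul_right (sum_le_mul he fun j => sum_le_mul he fun l =>
          mul_le_mul' (h1 j l) (hVh j l)) _) ?_
        exact sum_le_mul he fun l => sum_le_mul he fun m => mul_le_mul' (hJ l m)
          (sum_le_mul he fun j => sum_le_mul he fun i => mul_le_mul' (hVh l j) (h2 j i m))
    _ = 27 * k ^ 2 * e ^ 2 * (w * w⁻¹) ^ 2 + 81 * k ^ 5 * e ^ 4 := by rw [hn]; ring
    _ ≤ 27 * k ^ 5 * e ^ 7 * 1 + 81 * k ^ 5 * e ^ 7 := by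
        rw [hww, one_pow]
        have a1 : k ^ 2 ≤ k ^ 5 := pow_le_pow_right₀ hk (by norm_num)
        have a2 : e ^ 2 ≤ e ^ 7 := pow_le_pow_right₀ he1 (by norm_num)
        have a3 : e ^ 4 ≤ e ^ 7 := pow_le_pow_right₀ he1 (by norm_num)
        gcongr
    _ = 108 * k ^ 5 * e ^ 7 := by ring

/-- In each of the four terms the powers of `w` multiply to `w⁻¹` or to `1`; the order-one term is
the one with a single `M`. The sixfold sum gives the highest power of the dimension, `e⁶`. -/
theorem K2_le [IsProbabilityMeasure P] (hQ : ∀ j, Measurable (E.Q j))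
    (hM : ∀ j l m, AEMeasurable (E.M j l m) P) {n : ℕ} (hk : 1 ≤ k)
    (hw : 1 ≤ w) (hw' : w ≠ ∞) (hn : ENNReal.ofReal √n = w) (he : (Fintype.card ι : ℝ≥0∞) ≤ e)
    (he1 : 1 ≤ e) (hQ8 : ∀ j, mean P (fun ω => E.Q j ω ^ 8) ≤ k * w⁻¹ ^ 8) {ε : ℝ} (hε : 0 < ε)
    (hεk : ENNReal.ofReal (1 / ε) ≤ k)
    (hT : ∀ j l, mean P[|E.near ε] (fun ω => E.T j l ω ^ 4) ≤ k * w ^ 4)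
    (hM4 : ∀ j l m, mean P[|E.near ε] (fun ω => E.M j l m ω ^ 4) ≤ k * w ^ 8)
    (hJ : ∀ j l, ENNReal.ofReal |E.J j l| ≤ k) {h : ℝ → ℝ} (h0 : 0 ≤ supNorm h)
    (h1 : 0 ≤ supNorm (deriv h)) :
    E.K2 P n h ε ≤ 279 * k ^ 5 * e ^ 7 * ENNReal.ofReal (supNorm h + supNorm (deriv h)) := by
  have hP : P Set.univ ≤ 1 := prob_le_one
  have hw0 : w ≠ 0 := (zero_lt_one.trans_le hw).ne'
  have hww : w * w⁻¹ = 1 := ENNReal.mul_inv_cancel hw0 hw'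
  have hwi : w⁻¹ ≤ 1 := ENNReal.inv_le_one.2 hw
  have hk9 : 1 ≤ 9 * k := hk.trans (le_mul_of_one_le_left zero_le (by norm_num))
  have hsn : 0 < √(n : ℝ) := ENNReal.ofReal_pos.1 (hn ▸ hw0.bot_lt)
  set a := ENNReal.ofReal (supNorm h) with ha
  set b := ENNReal.ofReal (supNorm (deriv h)) with hb
  have hcond : P[|E.near ε] Set.univ ≤ 1 := by
    have : P[|E.near ε] Set.univ = (P (E.near ε))⁻¹ * P (E.near ε) := by
      rw [ProbabilityTheory.cond, Measure.smul_apply, Measure.restrict_apply_univ, smul_eq_mul]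
    rw [this]
    exact ENNReal.inv_mul_le_one _
  have q1 : mean P (fun ω => ∑ j, E.Q j ω ^ 2) ≤ e * (9 * k * w⁻¹ ^ 2) := by
    have : mean P (fun ω => ∑ j, E.Q j ω ^ 2) = ∑ j, mean P (fun ω => E.Q j ω ^ 2) := by
      unfold mean
      rw [← lintegral_finsetSum _ fun j _ => by have := hQ j; fun_prop]
      exact lintegral_congr fun ω => ENNReal.ofReal_sum_of_nonneg fun j _ => sq_nonneg _
    rw [this]
    refine sum_le_mul he fun j => ?_
    refine le_trans (le_of_eq (lintegral_congr fun ω => ?_))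
      (mean_prod_Q_le hP hQ hk hw hw' hQ8 (m := 2) (by norm_num) fun _ => j)
    rw [ofReal_pow_of_even _ even_two]
    simp
  have q3 : ∀ j l m, mean P (fun ω => E.Q j ω ^ 2 * E.Q l ω ^ 2 * E.Q m ω ^ 2) ^ (1 / 2 : ℝ)
      ≤ 9 * k * w⁻¹ ^ 3 := by
    intro j l m
    refine rpow_inv_le hk9 two_ne_zero 3 ?_
    refine le_trans (le_of_eq (lintegral_congr fun ω => ?_))
      (mean_prod_Q_le hP hQ hk hw hw' hQ8 (m := 6) (by norm_num) ![j, j, l, l, m, m])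
    beta_reduce
    rw [← mul_pow, ← mul_pow, ofReal_pow_of_even _ even_two, enorm_mul, enorm_mul,
      Fin.prod_univ_six]
    change _ = ‖E.Q j ω‖ₑ * ‖E.Q j ω‖ₑ * ‖E.Q l ω‖ₑ * ‖E.Q l ω‖ₑ * ‖E.Q m ω‖ₑ * ‖E.Q m ω‖ₑ
    ring
  have q4 : ∀ j l m i, mean P (fun ω => E.Q j ω ^ 2 * E.Q l ω ^ 2 * E.Q m ω ^ 2 * E.Q i ω ^ 2)
      ^ (1 / 2 : ℝ) ≤ 9 * k * w⁻¹ ^ 4 := by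
    intro j l m i
    refine rpow_inv_le hk9 two_ne_zero 4 ?_
    refine le_trans (le_of_eq (lintegral_congr fun ω => ?_))
      (mean_prod_Q_le hP hQ hk hw hw' hQ8 (m := 8) (by norm_num) ![j, j, l, l, m, m, i, i])
    beta_reduce
    rw [← mul_pow, ← mul_pow, ← mul_pow, ofReal_pow_of_even _ even_two, enorm_mul, enorm_mul,
      enorm_mul, Fin.prod_univ_eight]
    change _ = ‖E.Q j ω‖ₑ * ‖E.Q j ω‖ₑ * ‖E.Q l ω‖ₑ * ‖E.Q l ω‖ₑ * ‖E.Q m ω‖ₑ * ‖E.Q m ω‖ₑ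
      * ‖E.Q i ω‖ₑ * ‖E.Q i ω‖ₑ
    ring
  have m2 : ∀ j l m, mean P[|E.near ε] (fun ω => E.M j l m ω ^ 2) ^ (1 / 2 : ℝ)
      ≤ 9 * k * w ^ 2 := by
    intro j l m
    refine rpow_inv_le hk9 two_ne_zero 2 ?_
    have hac : P[|E.near ε] ≪ P := cond_absolutelyContinuous
    have := lintegral_prod_le hcond (m := 2) (p := 4) (by norm_num)
      (x := fun _ ω => ‖E.M j l m ω‖ₑ) (B := k) (b := w ^ 2)
      (fun i => ((hM j l m).mono_ac hac).enorm) (pow_ne_zero 2 hw0) (ENNReal.pow_ne_top hw')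
      (fun i => by
        rw [← pow_mul]
        refine le_trans (le_of_eq ?_) (hM4 j l m)
        exact lintegral_congr fun ω => (ofReal_pow_of_even _ (by decide)).symm)
    refine le_trans (le_of_eq (lintegral_congr fun ω => ?_)) (this.trans ?_)
    · rw [ofReal_pow_of_even _ even_two]; simp
    · rw [← pow_mul]
      gcongr
      calc 1 + ((2 : ℕ) : ℝ≥0∞) * k ≤ k + 8 * k := by gcongr; norm_num
        _ = 9 * k := by ring
  have t4 : ∀ j l, mean P[|E.near ε] (fun ω => E.T j l ω ^ 4) ^ (1 / 4 : ℝ) ≤ k * w := by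
    intro j l
    simpa using rpow_inv_le hk (p := 4) (by norm_num) 1 (hT j l)
  have m4 : ∀ j l m, mean P[|E.near ε] (fun ω => E.M j l m ω ^ 4) ^ (1 / 4 : ℝ) ≤ k * w ^ 2 := by
    intro j l m
    simpa using rpow_inv_le hk (p := 4) (by norm_num) 2 (hM4 j l m)
  have c1 : ENNReal.ofReal (2 * √n * supNorm h / ε ^ 2) ≤ 2 * w * a * k ^ 2 := by
    have : 2 * √n * supNorm h / ε ^ 2 = 2 * √n * supNorm h * (1 / ε) ^ 2 := by field_simp
    rw [this, ENNReal.ofReal_mul (by positivity), ENNReal.ofReal_mul (by positivity),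
      ENNReal.ofReal_mul (by positivity), hn, ENNReal.ofReal_pow (by positivity),
      ENNReal.ofReal_ofNat]
    gcongr
  have c2 : ENNReal.ofReal (√n * supNorm (deriv h) * (7 / 3)) ≤ w * b * 3 := by
    rw [ENNReal.ofReal_mul (by positivity), ENNReal.ofReal_mul (by positivity), hn,
      ← ENNReal.ofReal_ofNat 3]
    gcongr
    norm_num
  have hwinv : ENNReal.ofReal (√(n : ℝ))⁻¹ = w⁻¹ := by
    rw [ENNReal.ofReal_inv_of_pos hsn, hn]
  have c3 : ENNReal.ofReal (supNorm (deriv h) / √n) = b * w⁻¹ := by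
    rw [div_eq_mul_inv, ENNReal.ofReal_mul h1, hwinv]
  have c4 : ENNReal.ofReal (supNorm (deriv h) / (4 * √n)) ≤ b * w⁻¹ := by
    rw [← c3]
    refine ENNReal.ofReal_le_ofReal ?_
    gcongr
    linarith
  calc E.K2 P n h ε
      ≤ 2 * w * a * k ^ 2 * (e * (9 * k * w⁻¹ ^ 2))
        + w * b * 3 * (e * (e * (e * (9 * k * w⁻¹ ^ 3 * (9 * k * w ^ 2)))))
        + b * w⁻¹ * (e * (e * (k * (e * (e * (e * (9 * k * w⁻¹ ^ 3 * (k * w) * (k * w ^ 2))))))))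
        + b * w⁻¹ * (e * (e * (e * (e * (e * (e *
            (k * (9 * k * w⁻¹ ^ 4) * (k * w ^ 2) * (k * w ^ 2)))))))) := by
        unfold K2
        refine add_le_add (add_le_add (add_le_add (mul_le_mul' c1 q1) (mul_le_mul' c2 ?_))
          (mul_le_mul' c3.le ?_)) (mul_le_mul' c4 ?_)
        · exact sum_le_mul he fun j => sum_le_mul he fun l => sum_le_mul he fun m =>
            mul_le_mul' (q3 j l m) (m2 j l m)
        · exact sum_le_mul he fun i => sum_le_mul he fun m => mul_le_mul' (hJ m i)
            (sum_le_mul he fun j => sum_le_mul he fun l => sum_le_mul he fun s =>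
              mul_le_mul' (mul_le_mul' (q3 j l s) (t4 m j)) (m4 i s l))
        · exact sum_le_mul he fun i => sum_le_mul he fun m => sum_le_mul he fun s =>
            sum_le_mul he fun t => sum_le_mul he fun l => sum_le_mul he fun j =>
              mul_le_mul' (mul_le_mul' (mul_le_mul' (hJ t i) (q4 m s j l)) (m4 i s m)) (m4 t j l)
    _ = 18 * a * k ^ 3 * e * w⁻¹ * (w * w⁻¹) + 243 * b * k ^ 2 * e ^ 3 * (w * w⁻¹) ^ 3
        + 9 * b * k ^ 4 * e ^ 5 * w⁻¹ * (w * w⁻¹) ^ 3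
        + 9 * b * k ^ 4 * e ^ 6 * w⁻¹ * (w * w⁻¹) ^ 4 := by ring
    _ ≤ 18 * a * k ^ 5 * e ^ 7 * 1 * 1 + 243 * b * k ^ 5 * e ^ 7 * 1
        + 9 * b * k ^ 5 * e ^ 7 * 1 * 1 + 9 * b * k ^ 5 * e ^ 7 * 1 * 1 := by
        rw [hww, one_pow, one_pow]
        have a1 : k ^ 2 ≤ k ^ 5 := pow_le_pow_right₀ hk (by norm_num)
        have a2 : k ^ 3 ≤ k ^ 5 := pow_le_pow_right₀ hk (by norm_num)
        have a3 : k ^ 4 ≤ k ^ 5 := pow_le_pow_right₀ hk (by norm_num)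
        have b1 : e ≤ e ^ 7 := le_self_pow₀ he1 (by norm_num)
        have b2 : e ^ 3 ≤ e ^ 7 := pow_le_pow_right₀ he1 (by norm_num)
        have b3 : e ^ 5 ≤ e ^ 7 := pow_le_pow_right₀ he1 (by norm_num)
        have b4 : e ^ 6 ≤ e ^ 7 := pow_le_pow_right₀ he1 (by norm_num)
        gcongr
    _ ≤ 279 * k ^ 5 * e ^ 7 * a + 279 * k ^ 5 * e ^ 7 * b := by
        calc _ = 18 * k ^ 5 * e ^ 7 * a + 261 * k ^ 5 * e ^ 7 * b := by ring
          _ ≤ _ := by gcongr <;> norm_num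
    _ = _ := by rw [← mul_add, ha, hb, ENNReal.ofReal_add h0 h1]

end ErrData

/-! ### The order of the bound -/

section Gaussian

theorem mean_stdNormal_pow_eq {ι : Type*} [Fintype ι] (a : ι → ℝ) {m : ℕ} (hm : Even m) :
    ∫⁻ z, ‖∑ t, a t * z t‖ₑ ^ m ∂stdNormal ι
      = ENNReal.ofReal (∫ x, x ^ m ∂gaussianReal 0 (∑ t, a t ^ 2).toNNReal) := by
  rw [ofReal_integral_eq_lintegral_ofReal (integrable_pow_gaussianReal _ m)
    (ae_of_all _ fun x => hm.pow_nonneg x),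
    ← stdNormal_map_sum_mul, lintegral_map (by fun_prop) (by fun_prop)]
  exact lintegral_congr fun z => (ofReal_pow_of_even _ hm).symm

end Gaussian

section RowSums

theorem rowSumNorm_le {κ₁ κ₂ : Type*} [Fintype κ₁] [Fintype κ₂] {M : Matrix κ₁ κ₂ ℝ} {c : ℝ≥0}
    (hM : ∀ i j, |M i j| ≤ c) : rowSumNorm M ≤ Fintype.card κ₂ * c := by
  refine Finset.sup_le fun i _ => ?_
  refine (Finset.sum_le_sum fun j _ => (show ‖M i j‖₊ ≤ c from hM i j)).trans_eq ?_
  rw [Finset.sum_const, Finset.card_univ, nsmul_eq_mul]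

end RowSums

namespace Problem

open Matrix

variable {𝒳 Ω : Type*} [MeasurableSpace 𝒳] [MeasurableSpace Ω] {r q n : ℕ}
  {S : Problem 𝒳 Ω r q n}

/-- Only the sum `Dᵀ U D + C⁻¹` is a block of `I⁻¹`. Both summands are positive semidefinite, so
each diagonal is bounded by that of the sum, and the diagonal controls the other entries. -/
theorem Regular.abs_blocks_le (hR : S.Regular) {K : ℝ}
    (hK : ∀ j k, |(S.fisher S.θ₀)⁻¹ j k| ≤ K) {U : Matrix (Fin r) (Fin r) ℝ}
    {D : Matrix (Fin r) (Fin q) ℝ} (hU : U = (S.A - S.B * S.C⁻¹ * S.B.transpose)⁻¹)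
    (hD : D = S.B * S.C⁻¹) :
    (∀ i j, |U i j| ≤ K) ∧ (∀ i j, |(Dᵀ * U) i j| ≤ K) ∧ (∀ i j, |(Dᵀ * U * D) i j| ≤ K) ∧
      ∀ i j, |S.C⁻¹ i j| ≤ K := by
  have hJ : (S.fisher S.θ₀)⁻¹ = _ := inv_eq_fromBlocks hR.posDef hU hD
  have hUps : U.PosSemidef := by
    rw [hU]; exact (posDef_schur hR.posDef).inv.posSemidef
  have hDps : (Dᵀ * U * D).PosSemidef := by
    rw [← conjTranspose_eq_transpose_of_trivial]
    exact hUps.conjTranspose_mul_mul_same D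
  have hCps : S.C⁻¹.PosSemidef := (posDef_toBlocks₂₂ hR.posDef).inv.posSemidef
  have hdiag : ∀ j, (Dᵀ * U * D) j j + S.C⁻¹ j j ≤ K := by
    intro j
    have := (le_abs_self _).trans (hK (Sum.inr j) (Sum.inr j))
    rw [hJ] at this
    exact this
  refine ⟨fun i j => ?_, fun i j => ?_, fun i j => ?_, fun i j => ?_⟩
  · have := hK (Sum.inl i) (Sum.inl j)
    rw [hJ] at this
    exact this
  · have := hK (Sum.inr i) (Sum.inl j)
    rw [hJ, fromBlocks_apply₂₁, neg_apply, abs_neg] at this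
    exact this
  · have h1 := hdiag i
    have h2 := hdiag j
    have h3 : 0 ≤ S.C⁻¹ i i := hCps.diag_nonneg
    have h4 : 0 ≤ S.C⁻¹ j j := hCps.diag_nonneg
    have h5 := abs_apply_le_of_posSemidef hDps i j
    linarith
  · have h1 := hdiag i
    have h2 := hdiag j
    have h3 : 0 ≤ (Dᵀ * U * D) i i := hDps.diag_nonneg
    have h4 : 0 ≤ (Dᵀ * U * D) j j := hDps.diag_nonneg
    have h5 := abs_apply_le_of_posSemidef hCps i j
    linarith

theorem cConst_le {U : Matrix (Fin r) (Fin r) ℝ} {D : Matrix (Fin r) (Fin q) ℝ} {K : ℝ≥0}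
    (h1 : ∀ i j, |U i j| ≤ K) (h2 : ∀ i j, |(Dᵀ * U) i j| ≤ K)
    (h3 : ∀ i j, |(Dᵀ * U * D) i j| ≤ K) : cConst U D ≤ (r + q : ℕ) * K := by
  have hr : ((r : ℕ) : ℝ≥0) ≤ (r + q : ℕ) := by exact_mod_cast Nat.le_add_right r q
  have hq : ((q : ℕ) : ℝ≥0) ≤ (r + q : ℕ) := by exact_mod_cast Nat.le_add_left q r
  refine max_le ((rowSumNorm_le h1).trans ?_) (max_le ((rowSumNorm_le h3).trans ?_)
    ((rowSumNorm_le h2).trans ?_)) <;> rw [Fintype.card_fin] <;> gcongr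

/-- Cauchy-Schwarz bounds the numerator by `√J_ss √3 = 3 √(J_ss/3)`, and the lower bound for
`E|G_s|` applies to the denominator. -/
theorem Regular.gaussAbsSq_div_le (hR : S.Regular) (s t : Idx r q) :
    S.gaussAbsSq s t / S.gaussAbs s ≤ 3 := by
  have hJ0 : 0 < (S.fisher S.θ₀)⁻¹ s s := hR.posDef.inv.diag_pos
  refine ENNReal.div_le_of_le_mul ?_
  have h1 : ∫⁻ z, ‖S.rootInv s z‖ₑ ^ 2 ∂stdNormal (Idx r q)
      = ENNReal.ofReal ((S.fisher S.θ₀)⁻¹ s s) := by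
    have := mean_stdNormal_pow_eq (CFC.sqrt (S.fisher S.θ₀)⁻¹ s) even_two
    rw [hR.sum_sqrt_sq, integral_sq_gaussianReal, Real.coe_toNNReal _ hJ0.le] at this
    exact this
  have h2 : ∫⁻ z, ‖z t ^ 2‖ₑ ^ 2 ∂stdNormal (Idx r q) = ENNReal.ofReal 3 := by
    have := mean_stdNormal_pow_eq (Pi.single t 1 : Idx r q → ℝ) (m := 4) (by decide)
    rw [integral_pow_four_gaussianReal] at this
    have e1 : ∑ i, (Pi.single t 1 : Idx r q → ℝ) i ^ 2 = 1 := by simp [Pi.single_apply]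
    rw [e1] at this
    simp only [Real.toNNReal_one, NNReal.coe_one, one_pow, mul_one] at this
    rw [← this]
    refine lintegral_congr fun z => ?_
    rw [enorm_pow, ← pow_mul]
    simp [Pi.single_apply]
  have hm : Measurable (S.rootInv s) := by
    unfold rootInv
    simp only [mulVec, dotProduct]
    fun_prop
  have hz : Measurable fun z : Idx r q → ℝ => z t ^ 2 := by fun_prop
  calc S.gaussAbsSq s t
      = ∫⁻ z, ‖S.rootInv s z‖ₑ * ‖z t ^ 2‖ₑ ∂stdNormal (Idx r q) := by
        refine lintegral_congr fun z => ?_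
        rw [← Real.enorm_eq_ofReal_abs, enorm_mul]
    _ ≤ ENNReal.ofReal ((S.fisher S.θ₀)⁻¹ s s) ^ (1 / 2 : ℝ) * ENNReal.ofReal 3 ^ (1 / 2 : ℝ) := by
        rw [← h1, ← h2]
        exact lintegral_mul_le_sqrt hm.enorm.aemeasurable hz.enorm.aemeasurable
    _ = 3 * ENNReal.ofReal √((S.fisher S.θ₀)⁻¹ s s / 3) := by
        rw [ENNReal.ofReal_rpow_of_pos hJ0, ENNReal.ofReal_rpow_of_pos (by norm_num),
          ← Real.sqrt_eq_rpow, ← Real.sqrt_eq_rpow, ← ENNReal.ofReal_mul (by positivity),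
          ← ENNReal.ofReal_ofNat 3, ← ENNReal.ofReal_mul (by norm_num), Real.sqrt_div hJ0.le]
        congr 1
        have h3 : √(3 : ℝ) * √3 = 3 := Real.mul_self_sqrt (by norm_num)
        rw [mul_div_assoc', eq_div_iff (by positivity), mul_assoc, h3, mul_comm]
    _ ≤ 3 * S.gaussAbs s := by
        gcongr
        exact hR.le_gaussAbs s

theorem Regular.lintegral_prod_score_le (hR : S.Regular) {k : ℝ≥0∞} (hk : 1 ≤ k)
    (hs : ∀ j, mean (S.law S.θ₀) (fun x => |S.score j S.θ₀ x| ^ 5) ≤ k) {m : ℕ} (hm : m ≤ 5)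
    (j : Fin m → Idx r q) : ∫⁻ x, ∏ i, ‖S.score (j i) S.θ₀ x‖ₑ ∂(S.law S.θ₀) ≤ 6 * k := by
  have := hR.standing.prob_law _ hR.standing.θ₀_mem
  refine (lintegral_prod_le prob_le_one hm (x := fun i x => ‖S.score (j i) S.θ₀ x‖ₑ) (B := k)
    (b := 1) (fun i => (hR.o3 _).aestronglyMeasurable.enorm) one_ne_zero ENNReal.one_ne_top
    (fun i => ?_)).trans ?_
  · rw [one_pow, mul_one]
    refine le_trans (le_of_eq ?_) (hs (j i))
    refine lintegral_congr fun x => ?_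
    rw [ENNReal.ofReal_pow (abs_nonneg _), Real.enorm_eq_ofReal_abs]
  · rw [one_pow, mul_one]
    have : (m : ℝ≥0∞) ≤ 5 := by exact_mod_cast hm
    calc 1 + m * k ≤ k + 5 * k := by gcongr
      _ = 6 * k := by ring

theorem Regular.mean_prod_Y_le (hR : S.Regular) {k : ℝ≥0∞} (hk : 1 ≤ k)
    (hs : ∀ j, mean (S.law S.θ₀) (fun x => |S.score j S.θ₀ x| ^ 5) ≤ k) {m : ℕ} (hm : m ≤ 5)
    (j : Fin m → Idx r q) (i : Fin n) : mean S.P (fun ω => |∏ l, S.Y (j l) i ω|) ≤ 6 * k := by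
  refine le_trans (le_of_eq ?_) (hR.lintegral_prod_score_le hk hs hm j)
  have hm : ∀ j, AEMeasurable (S.score j S.θ₀) (S.law S.θ₀) := fun j =>
    (hR.o3 j).aestronglyMeasurable.aemeasurable
  rw [← hR.standing.lintegral_comp (Finset.aemeasurable_fun_prod _ fun l _ => (hm _).enorm) i]
  refine lintegral_congr fun ω => ?_
  beta_reduce
  rw [Finset.abs_prod, ENNReal.ofReal_prod_of_nonneg fun _ _ => abs_nonneg _]
  simp only [← Real.enorm_eq_ofReal_abs]
  rfl

/-- The count of `d⁷`: the prefactor `c ≤ d k` gives one power, the sums over `j, k, l` three, and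
inside `c d ∑_t` three more. The moments of order up to five enter through `Y_j Y_k Y_l Y_t²`. -/
theorem Regular.R_le (hR : S.Regular) (hr : 1 ≤ r) (hn : 1 ≤ n) {k : ℝ≥0∞} (hk : 1 ≤ k)
    (hs : ∀ j, mean (S.law S.θ₀) (fun x => |S.score j S.θ₀ x| ^ 5) ≤ k)
    (hJ : ∀ s, ENNReal.ofReal ((S.fisher S.θ₀)⁻¹ s s) ≤ k) {U : Matrix (Fin r) (Fin r) ℝ}
    {D : Matrix (Fin r) (Fin q) ℝ} (hc : (cConst U D : ℝ≥0∞) ≤ (r + q : ℕ) * k) :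
    S.R U D ≤ 37278 * k ^ 6 * ((r + q : ℕ) : ℝ≥0∞) ^ 7 := by
  have := hR.standing.prob
  set e : ℝ≥0∞ := ((r + q : ℕ) : ℝ≥0∞) with he
  have he1 : 1 ≤ e := by rw [he]; exact_mod_cast (by omega : 1 ≤ r + q)
  have hcard : (Fintype.card (Idx r q) : ℝ≥0∞) ≤ e := by simp [he]
  have hn1 : (1 : ℝ≥0∞) ≤ n := by exact_mod_cast hn
  have y3 : ∀ j l m i, mean S.P (fun ω => |S.Y j i ω * S.Y l i ω * S.Y m i ω|) ≤ 6 * k := by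
    intro j l m i
    have := hR.mean_prod_Y_le hk hs (m := 3) (by norm_num) ![j, l, m] i
    simpa [Fin.prod_univ_three] using this
  have y5 : ∀ j l m t i, mean S.P (fun ω => |S.Y j i ω * S.Y l i ω * S.Y m i ω * S.Y t i ω ^ 2|)
      ≤ 6 * k := by
    intro j l m t i
    have := hR.mean_prod_Y_le hk hs (m := 5) (by norm_num) ![j, l, m, t, t] i
    refine le_trans (le_of_eq (congrArg _ (funext fun ω => congrArg _ ?_))) this
    rw [Fin.prod_univ_five]
    change _ = S.Y j i ω * S.Y l i ω * S.Y m i ω * S.Y t i ω * S.Y t i ω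
    ring
  have y1 : ∀ l i, mean S.P (fun ω => |S.Y l i ω|) ≤ 6 * k := by
    intro l i
    have := hR.mean_prod_Y_le hk hs (m := 1) (by norm_num) ![l] i
    simpa using this
  have y13 : ∀ l t i, mean S.P (fun ω => |S.Y l i ω * S.Y t i ω ^ 2|) ≤ 6 * k := by
    intro l t i
    have := hR.mean_prod_Y_le hk hs (m := 3) (by norm_num) ![l, t, t] i
    refine le_trans (le_of_eq (congrArg _ (funext fun ω => congrArg _ ?_))) this
    rw [Fin.prod_univ_three]
    change _ = S.Y l i ω * S.Y t i ω * S.Y t i ω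
    ring
  have y2 : ∀ j l i, ENNReal.ofReal |∫ ω, S.Y j i ω * S.Y l i ω ∂S.P| ≤ 6 * k := by
    intro j l i
    have := hR.mean_prod_Y_le hk hs (m := 2) (by norm_num) ![j, l] i
    simp only [Fin.prod_univ_two, Matrix.cons_val_zero, Matrix.cons_val_one] at this
    refine le_trans ?_ this
    rw [← Real.enorm_eq_ofReal_abs]
    refine (enorm_integral_le_lintegral_enorm _).trans_eq ?_
    exact lintegral_congr fun ω => Real.enorm_eq_ofReal_abs _
  have hW : ∀ t, mean S.P (fun ω => S.W t ω ^ 2) ≤ 6 * k := by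
    intro t
    rw [hR.mean_W_sq hn]
    have := hR.lintegral_prod_score_le hk hs (m := 2) (by norm_num) ![t, t]
    simp only [Fin.prod_univ_two, Matrix.cons_val_zero, Matrix.cons_val_one] at this
    refine le_trans ?_ this
    rw [fisher, of_apply, ofReal_integral_eq_lintegral_ofReal
      (hR.rc5.integrable _ hR.standing.θ₀_mem t t) (ae_of_all _ fun x => mul_self_nonneg _)]
    refine lintegral_mono fun x => ?_
    rw [← enorm_mul, Real.enorm_eq_ofReal_abs]
    exact ENNReal.ofReal_le_ofReal (le_abs_self _)
  have h4n : 4 / (n : ℝ≥0∞) ≤ 4 := ENNReal.div_le_of_le_mul (le_mul_of_one_le_right zero_le hn1)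
  have hin : 4 * (6 * k) * (6 * k) + 4 * (6 * k) + 3 * (6 * k) ≤ 186 * k ^ 2 := by
    have hkk : k ≤ k ^ 2 := le_self_pow₀ hk two_ne_zero
    calc _ = 144 * k ^ 2 + 42 * k := by ring
      _ ≤ 144 * k ^ 2 + 42 * k ^ 2 := by gcongr
      _ = _ := by ring
  have hG : ∀ s, S.gaussAbs s ≤ k := by
    intro s
    refine (hR.gaussAbs_le s).trans ?_
    have hJ0 : 0 < (S.fisher S.θ₀)⁻¹ s s := hR.posDef.inv.diag_pos
    rw [Real.sqrt_eq_rpow, ← ENNReal.ofReal_rpow_of_pos hJ0]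
    simpa using rpow_inv_le hk two_ne_zero 0 (b := 1) (by simpa using hJ s)
  rw [R]
  -- Any coordinate bounds the minimum from above; the first one exists because `r ≥ 1`.
  refine (iInf_le _ (Sum.inl ⟨0, hr⟩)).trans ?_
  set s : Idx r q := Sum.inl ⟨0, hr⟩
  have hterm : ∀ (i : Fin n) (j l m : Idx r q),
      (mean S.P (fun ω => |S.Y j i ω * S.Y l i ω * S.Y m i ω|)
          + 8 * (cConst U D : ℝ≥0∞) * e *
            ∑ t : Idx r q,
              (4 * mean S.P (fun ω => |S.Y j i ω * S.Y l i ω * S.Y m i ω|)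
                  * mean S.P (fun ω => S.W t ω ^ 2)
                + 4 / (n : ℝ≥0∞)
                  * mean S.P (fun ω => |S.Y j i ω * S.Y l i ω * S.Y m i ω * S.Y t i ω ^ 2|)
                + S.gaussAbsSq s t / S.gaussAbs s
                  * mean S.P (fun ω => |S.Y j i ω * S.Y l i ω * S.Y m i ω|))
          + 2 * ENNReal.ofReal |∫ ω, S.Y j i ω * S.Y l i ω ∂S.P| *
            (mean S.P (fun ω => |S.Y m i ω|)
              + 16 * (cConst U D : ℝ≥0∞) * e *
                ∑ t : Idx r q,
                  (4 * mean S.P (fun ω => |S.Y m i ω|) * mean S.P (fun ω => S.W t ω ^ 2)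
                    + 4 / (n : ℝ≥0∞) * mean S.P (fun ω => |S.Y m i ω * S.Y t i ω ^ 2|)
                    + S.gaussAbsSq s t / S.gaussAbs s * mean S.P (fun ω => |S.Y m i ω|))))
      ≤ 37278 * k ^ 4 * e ^ 3 := by
    intro i j l m
    have s1 : ∑ t : Idx r q,
              (4 * mean S.P (fun ω => |S.Y j i ω * S.Y l i ω * S.Y m i ω|)
                  * mean S.P (fun ω => S.W t ω ^ 2)
                + 4 / (n : ℝ≥0∞)
                  * mean S.P (fun ω => |S.Y j i ω * S.Y l i ω * S.Y m i ω * S.Y t i ω ^ 2|)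
                + S.gaussAbsSq s t / S.gaussAbs s
                  * mean S.P (fun ω => |S.Y j i ω * S.Y l i ω * S.Y m i ω|)) ≤ e * (186 * k ^ 2) :=
      sum_le_mul hcard fun t => (add_le_add (add_le_add (mul_le_mul'
        (mul_le_mul_right (y3 j l m i) _) (hW t)) (mul_le_mul' h4n (y5 j l m t i)))
        (mul_le_mul' (hR.gaussAbsSq_div_le s t) (y3 j l m i))).trans hin
    have s2 : ∑ t : Idx r q,
                  (4 * mean S.P (fun ω => |S.Y m i ω|) * mean S.P (fun ω => S.W t ω ^ 2)
                    + 4 / (n : ℝ≥0∞) * mean S.P (fun ω => |S.Y m i ω * S.Y t i ω ^ 2|)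
                    + S.gaussAbsSq s t / S.gaussAbs s * mean S.P (fun ω => |S.Y m i ω|))
        ≤ e * (186 * k ^ 2) :=
      sum_le_mul hcard fun t => (add_le_add (add_le_add (mul_le_mul'
        (mul_le_mul_right (y1 m i) _) (hW t)) (mul_le_mul' h4n (y13 m t i)))
        (mul_le_mul' (hR.gaussAbsSq_div_le s t) (y1 m i))).trans hin
    calc _ ≤ 6 * k + 8 * (e * k) * e * (e * (186 * k ^ 2))
          + 2 * (6 * k) * (6 * k + 16 * (e * k) * e * (e * (186 * k ^ 2))) :=
        add_le_add (add_le_add (y3 j l m i) (mul_le_mul' (by gcongr) s1))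
          (mul_le_mul' (mul_le_mul_right (y2 j l i) _)
            (add_le_add (y1 m i) (mul_le_mul' (by gcongr) s2)))
      _ = 6 * k * 1 + 1488 * k ^ 3 * e ^ 3 + 72 * k ^ 2 * 1 + 35712 * k ^ 4 * e ^ 3 := by ring
      _ ≤ 6 * k ^ 4 * e ^ 3 + 1488 * k ^ 4 * e ^ 3 + 72 * k ^ 4 * e ^ 3
          + 35712 * k ^ 4 * e ^ 3 := by
        have a1 : k ≤ k ^ 4 := le_self_pow₀ hk (by norm_num)
        have a2 : k ^ 2 ≤ k ^ 4 := pow_le_pow_right₀ hk (by norm_num)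
        have a3 : k ^ 3 ≤ k ^ 4 := pow_le_pow_right₀ hk (by norm_num)
        have a4 : 1 ≤ e ^ 3 := one_le_pow₀ he1
        gcongr
      _ = _ := by ring
  calc _ ≤ e * k / n * k * (n * (e * (e * (e * (37278 * k ^ 4 * e ^ 3))))) :=
        mul_le_mul' (mul_le_mul' (by gcongr) (hG s)) (sum_le_mul (by simp) fun i =>
          sum_le_mul hcard fun j => sum_le_mul hcard fun l => sum_le_mul hcard fun m =>
            hterm i j l m)
    _ = 37278 * k ^ 6 * e ^ 7 * ((n : ℝ≥0∞)⁻¹ * n) := by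
        rw [div_eq_mul_inv]; ring
    _ = _ := by
        rw [ENNReal.inv_mul_cancel (zero_lt_one.trans_le hn1).ne' (ENNReal.natCast_ne_top n),
          mul_one]

end Problem

namespace ErrData

theorem Scaling.K1_le_and_K2_le {ι Ω : Type*} [Fintype ι] [MeasurableSpace Ω] {E : ErrData ι Ω}
    {P : Measure Ω} [IsProbabilityMeasure P] {n : ℕ} {ε κ K : ℝ} (hE : E.Scaling P n ε κ)
    (hn : 1 ≤ n) (hκ : κ ≤ K) (hK : 1 ≤ K) (hQ : ∀ j, Measurable (E.Q j))
    (hM : ∀ j l m, AEMeasurable (E.M j l m) P) {e : ℝ≥0∞}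
    (he : (Fintype.card ι : ℝ≥0∞) ≤ e) (he1 : 1 ≤ e) (hε : 0 < ε) (hεK : 1 / ε ≤ K)
    (hJ : ∀ j l, |E.J j l| ≤ K) {h : ℝ → ℝ} (h0 : 0 ≤ supNorm h) (h1 : 0 ≤ supNorm (deriv h)) :
    E.K1 P n ≤ 108 * ENNReal.ofReal K ^ 5 * e ^ 7 ∧
      E.K2 P n h ε ≤ 279 * ENNReal.ofReal K ^ 5 * e ^ 7
        * ENNReal.ofReal (supNorm h + supNorm (deriv h)) := by
  have hn0 : (0 : ℝ) < n := by exact_mod_cast hn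
  have hsn : 0 < √(n : ℝ) := Real.sqrt_pos.2 hn0
  have hK0 : 0 ≤ K := zero_le_one.trans hK
  have hs2 : √(n : ℝ) ^ 2 = n := Real.sq_sqrt hn0.le
  have hk : 1 ≤ ENNReal.ofReal K := ENNReal.one_le_ofReal.2 hK
  have hw : 1 ≤ ENNReal.ofReal √n :=
    ENNReal.one_le_ofReal.2 (Real.one_le_sqrt.2 (by exact_mod_cast hn))
  have hw' : ENNReal.ofReal √n ≠ ∞ := ENNReal.ofReal_ne_top
  have hnw : (n : ℝ≥0∞) = ENNReal.ofReal √n ^ 2 := by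
    rw [← ENNReal.ofReal_pow hsn.le, hs2, ENNReal.ofReal_natCast]
  have hpow : ∀ (m : ℕ), κ * (n : ℝ) ^ m ≤ K * √(n : ℝ) ^ (2 * m) := fun m => by
    rw [pow_mul, hs2]; gcongr
  have hof : ∀ m : ℕ, ENNReal.ofReal (κ * (n : ℝ) ^ m)
      ≤ ENNReal.ofReal K * ENNReal.ofReal √n ^ (2 * m) := fun m => by
    rw [← ENNReal.ofReal_pow hsn.le, ← ENNReal.ofReal_mul hK0]
    exact ENNReal.ofReal_le_ofReal (hpow m)
  have hQ8 : ∀ j, mean P (fun ω => E.Q j ω ^ 8)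
      ≤ ENNReal.ofReal K * (ENNReal.ofReal √n)⁻¹ ^ 8 := fun j => by
    refine (hE.err j).trans ?_
    rw [← ENNReal.ofReal_inv_of_pos hsn, ← ENNReal.ofReal_pow (by positivity),
      ← ENNReal.ofReal_mul hK0]
    refine ENNReal.ofReal_le_ofReal ?_
    rw [inv_pow, ← div_eq_mul_inv, show √(n : ℝ) ^ 8 = (√(n : ℝ) ^ 2) ^ 4 by ring, hs2]
    gcongr
  have hJ' : ∀ j l, ENNReal.ofReal |E.J j l| ≤ ENNReal.ofReal K := fun j l =>
    ENNReal.ofReal_le_ofReal (hJ j l)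
  exact ⟨ErrData.K1_le prob_le_one hQ hk hw hw' hnw he he1 hQ8
      (fun j l => (hE.var j l).trans (ENNReal.ofReal_le_ofReal hκ))
      (fun j l => (hE.sixth j l).trans (hof 3)) hJ',
    K2_le hQ hM hk hw hw' rfl he he1 hQ8 hε (ENNReal.ofReal_le_ofReal hεK)
      (fun j l => (hE.condT j l).trans (hof 2)) (fun j l m => (hE.condM j l m).trans (hof 4)) hJ'
      h0 h1⟩

end ErrData

namespace Problem

variable {𝒳 Ω : Type*} [MeasurableSpace 𝒳] [MeasurableSpace Ω] {r q n : ℕ}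
  {S : Problem 𝒳 Ω r q n}

theorem Regular.bound_le (hR : S.Regular) (hr : 1 ≤ r) (hn : 1 ≤ n) {ε κ : ℝ} (hε : 0 < ε)
    (hSc : S.Scaling ε κ) {h : ℝ → ℝ} (hh : IsCb2 h) :
    S.bound h ε ≤ ENNReal.ofReal (75330 * max κ 1 ^ 6 *
      (supNorm h + supNorm (deriv h) + supNorm (deriv (deriv h))) *
      ((r + q : ℕ) : ℝ) ^ 7 / √n) := by
  have := hR.standing.prob
  -- The estimates raise the constant to higher powers and never take roots of it, which requires a
  -- constant of at least `1`.
  set K := max κ 1 with hKdef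
  have hκ : κ ≤ K := le_max_left _ _
  have hK : 1 ≤ K := le_max_right _ _
  have hK0 : 0 ≤ K := zero_le_one.trans hK
  have hk : 1 ≤ ENNReal.ofReal K := ENNReal.one_le_ofReal.2 hK
  have hn0 : (0 : ℝ) < n := by exact_mod_cast hn
  have hsn : 0 < √(n : ℝ) := Real.sqrt_pos.2 hn0
  have h0 := hh.supNorm_nonneg
  have h1 := hh.derivBounds.nonneg_fst
  have h2 := hh.derivBounds.nonneg_snd
  have hεK : 1 / ε ≤ K := by
    rw [div_le_iff₀ hε]
    exact hSc.radius.trans (by gcongr)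
  have hJ : ∀ j l, |(S.fisher S.θ₀)⁻¹ j l| ≤ K := fun j l => (hSc.invFisher j l).trans hκ
  obtain ⟨b1, b2, b3, b4⟩ := hR.abs_blocks_le hJ rfl rfl
  set e : ℝ≥0∞ := ((r + q : ℕ) : ℝ≥0∞) with he
  have he1 : 1 ≤ e := by rw [he]; exact_mod_cast (by omega : 1 ≤ r + q)
  have hc : (cConst (S.A - S.B * S.C⁻¹ * S.B.transpose)⁻¹ (S.B * S.C⁻¹) : ℝ≥0∞)
      ≤ e * ENNReal.ofReal K := by
    have hcK : (K.toNNReal : ℝ) = K := Real.coe_toNNReal _ hK0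
    have := cConst_le (U := (S.A - S.B * S.C⁻¹ * S.B.transpose)⁻¹) (D := S.B * S.C⁻¹)
      (K := K.toNNReal) (by rwa [hcK]) (by rwa [hcK]) (by rwa [hcK])
    rw [he, ENNReal.ofReal]
    exact_mod_cast this
  have hRle := hR.R_le hr hn hk
    (fun j => (hSc.score j).trans (ENNReal.ofReal_le_ofReal hκ))
    (fun s => ENNReal.ofReal_le_ofReal ((le_abs_self _).trans (hJ s s))) hc
  obtain ⟨f1, f2⟩ := hSc.full.K1_le_and_K2_le hn hκ hK hR.standing.measurable_Q
    (fun j k l => (hR.rc3.integrable j k l).aemeasurable) (e := e) (by simp [he]) he1 hε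
    hεK hJ h0 h1
  obtain ⟨g1, g2⟩ := hSc.null.K1_le_and_K2_le hn hκ hK hR.standing.measurable_Qnull
    hR.o1.measurable (e := e) (by simp [he]) he1 hε hεK b4 h0 h1
  set H := supNorm h + supNorm (deriv h) + supNorm (deriv (deriv h)) with hH
  have hH0 : 0 ≤ H := by positivity
  set k := ENNReal.ofReal K
  have hk56 : k ^ 5 ≤ k ^ 6 := pow_le_pow_right₀ hk (by norm_num)
  have a1 : ENNReal.ofReal (2 * (supNorm (deriv h) + supNorm (deriv (deriv h))) / √n)
      ≤ ENNReal.ofReal (1 / √n) * (2 * ENNReal.ofReal H) := by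
    rw [← ENNReal.ofReal_ofNat 2, ← ENNReal.ofReal_mul (by norm_num),
      ← ENNReal.ofReal_mul (by positivity), div_mul_eq_mul_div, one_mul]
    refine ENNReal.ofReal_le_ofReal ?_
    gcongr
    rw [hH]
    linarith
  have a2 : ENNReal.ofReal (supNorm (deriv h)) ≤ ENNReal.ofReal H :=
    ENNReal.ofReal_le_ofReal (by rw [hH]; linarith)
  have a3 : ENNReal.ofReal (supNorm h + supNorm (deriv h)) ≤ ENNReal.ofReal H :=
    ENNReal.ofReal_le_ofReal (by rw [hH]; linarith)
  have a4 : 279 * k ^ 5 * e ^ 7 * ENNReal.ofReal (supNorm h + supNorm (deriv h))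
      ≤ 279 * k ^ 6 * e ^ 7 * ENNReal.ofReal H := by gcongr
  have a5 : 108 * k ^ 5 * e ^ 7 ≤ 108 * k ^ 6 * e ^ 7 := by gcongr
  calc S.bound h ε
      ≤ ENNReal.ofReal (1 / √n) * (2 * ENNReal.ofReal H) * (37278 * k ^ 6 * e ^ 7)
        + ENNReal.ofReal (1 / √n) * (ENNReal.ofReal H * (108 * k ^ 6 * e ^ 7 + 108 * k ^ 6 * e ^ 7)
          + 279 * k ^ 6 * e ^ 7 * ENNReal.ofReal H + 279 * k ^ 6 * e ^ 7 * ENNReal.ofReal H) := by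
        rw [bound]
        exact add_le_add (mul_le_mul' a1 hRle) (mul_le_mul_right (add_le_add (add_le_add
          (mul_le_mul' a2 (add_le_add (f1.trans a5) (g1.trans a5))) (f2.trans a4))
          (g2.trans a4)) _)
    -- The constant is `2 · 37278 + 2 · 108 + 2 · 279`, from `R`, from the two `K₁` and from the two
    -- `K₂`.
    _ = ENNReal.ofReal (1 / √n) * (75330 * k ^ 6 * ENNReal.ofReal H * e ^ 7) := by ring
    _ = _ := by
        have e1 : (75330 : ℝ≥0∞) = ENNReal.ofReal 75330 := by simp
        rw [he, ← ENNReal.ofReal_natCast (r + q), e1, ← ENNReal.ofReal_pow hK0,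
          ← ENNReal.ofReal_pow (by positivity), ← ENNReal.ofReal_mul (by norm_num),
          ← ENNReal.ofReal_mul (by positivity), ← ENNReal.ofReal_mul (by positivity),
          ← ENNReal.ofReal_mul (by positivity)]
        congr 1
        ring

end Problem

end Wilks

theorem theorem1 :
    -- the bound
    (∀ (𝒳 Ω : Type*) [MeasurableSpace 𝒳] [MeasurableSpace Ω] (r q n : ℕ)
        (S : Wilks.Problem 𝒳 Ω r q n), 1 ≤ r → 1 ≤ n → S.Regular →
      ∀ ε : ℝ, 0 < ε → ε ≤ S.ε₀ → ∀ h : ℝ → ℝ, Wilks.IsCb2 h →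
        ENNReal.ofReal |∫ ω, h (S.llr ω) ∂S.P - ∫ y, h y ∂(Wilks.chiSq r)| ≤ S.bound h ε) ∧
    -- the order of the bound
    (∀ κ : ℝ, ∃ c : ℝ, ∀ (𝒳 Ω : Type*) [MeasurableSpace 𝒳] [MeasurableSpace Ω] (r q n : ℕ)
        (S : Wilks.Problem 𝒳 Ω r q n), 1 ≤ r → 1 ≤ n → S.Regular →
      ∀ ε : ℝ, 0 < ε → ε ≤ S.ε₀ → S.Scaling ε κ → ∀ h : ℝ → ℝ, Wilks.IsCb2 h →
        S.bound h ε ≤ ENNReal.ofReal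
          (c * (Wilks.supNorm h + Wilks.supNorm (deriv h) + Wilks.supNorm (deriv (deriv h))) *
            ((r + q : ℕ) : ℝ) ^ 7 / Real.sqrt n)) := by
  refine ⟨fun 𝒳 Ω _ _ r q n S hr hn hR ε hε hε₀ h hh =>
    hR.abs_integral_llr_sub_le hr hn hε hε₀ hh, fun κ => ⟨75330 * max κ 1 ^ 6, ?_⟩⟩
  intro 𝒳 Ω _ _ r q n S hr hn hR ε hε _ hSc h hh
  exact hR.bound_le hr hn hε hSc hh
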